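/- **Ball tangle diagrams.** Fix a round closed disc in the plane with four marked points NW, NE, SW, SE on its boundary circle, occurring there in the cyclic order NW, NE, SE, SW. A *ball tangle diagram* $B$ is a (polygonal) tangle diagram in this disc: the regular projection of a compact polygonal $1$-manifold properly embedded in the ball over the disc, whose boundary consists of the four marked points and whose interior projects into the open disc; the only multiple points of the projection are finitely many transversal double points (crossings), at each of which it is recorded which strand passes over. Closed components are allowed. Let $\mathbf{BT}$ be the class of all ball tangle diagrams. The *numerator closure* $B_1$ (resp. *denominator closure* $B_2$) is the link diagram obtained from $B$ by adding two disjoint arcs outside the disc, without crossings, joining NW to NE and SW to SE (resp. NW to SW and NE to SE). **Kauffman bracket.** Let $A=e^{i\pi/4}$. Rotating the overstrand of a crossing counterclockwise until it meets the understrand sweeps two opposite regions; the $A$-splitting of the crossing merges these two regions, and the $B$-splitting merges the other two. A state $\sigma$ of a link diagram $L$ is a choice of one of the two splittings at every crossing. Let $\alpha(\sigma)$ and $\beta(\sigma)$ be the numbers of $A$- and $B$-splittings, $d(\sigma)$ the number of circles obtained by performing all of them, and $$\langle L\rangle=\sum_{\sigma}A^{\alpha(\sigma)}(A^{-1})^{\beta(\sigma)}(-A^2-A^{-2})^{d(\sigma)-1},\qquad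 0^0=1 .$$ **The invariant.** Let $PM_{2\times1}(\mathbb Z)$ be the set of classes $\{M,-M\}$ of integer $2\times 1$ matrices $M$ modulo multiplication by $\pm1$, and for $B\in\mathbf{BT}$ put $$f(B)=\left\{\begin{pmatrix} z\langle B_1\rangle\\ i z\langle B_2\rangle\end{pmatrix}\;:\; z\in\mathbb C,\ z^8=1\right\}\cap M_{2\times1}(\mathbb Z).$$ **Theorem 4.4.** $f$ is a map $\mathbf{BT}\to PM_{2\times1}(\mathbb Z)$ (that is, $f(B)\in PM_{2\times 1}(\mathbb Z)$ for every $B\in\mathbf{BT}$), and it is onto: for every $P\in PM_{2\times1}(\mathbb Z)$ there is $B\in\mathbf{BT}$ with $f(B)=P$. -/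

import Mathlib

/-! Ball tangle diagrams are formalized as polygonal tangle diagrams in a round disc of the plane:
plane graphs with straight edges, whose vertices are the four end points, the bends of the polygonal
strands, and the crossings, at which the two strands form a straight X, one of them passing over. -/

/-- The four end points of a ball tangle. -/
inductive Corner where
  | NW | NE | SW | SE
  deriving DecidableEq

/-- The positions of the four end points, on the circle `x ^ 2 + y ^ 2 = 2`. -/
def Corner.pos : Corner → ℝ × ℝ
  | .NW => (-1, 1)
  | .NE => (1, 1)
  | .SW => (-1, -1)
  | .SE => (1, -1)

/-- Vertices of a polygonal tangle diagram with bends indexed by `W` and crossings indexed by `K`. -/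
inductive TangleVertex (W K : Type) where
  | endpoint (p : Corner)
  | bend (w : W)
  | crossing (c : K)

/-- A diagram of a ball tangle (a `0`-punctured ball tangle with four end points), in the closed disc
of radius `√2` about the origin. Strands may be arcs or closed curves. -/
structure BallTangleDiagram where
  /-- bends, that is the vertices of the polygonal strands other than end points and crossings -/
  W : Type
  /-- crossings -/
  K : Type
  [finiteW : Finite W]
  [fintypeK : Fintype K]
  [decidableEqK : DecidableEq K]
  /-- the positions of the vertices in the plane -/
  pos : TangleVertex W K → ℝ × ℝ
  /-- the graph whose edges are the straight pieces of the diagram -/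
  G : SimpleGraph (TangleVertex W K)
  /-- the four neighbours of a crossing in counterclockwise order, starting at one of the two ends of
  the overstrand: the overstrand runs from `nbr c 0` to `nbr c 2`, the understrand from `nbr c 1`
  to `nbr c 3` -/
  nbr : K → Fin 4 → TangleVertex W K
  pos_injective : Function.Injective pos
  pos_endpoint : ∀ p : Corner, pos (.endpoint p) = p.pos
  pos_bend : ∀ w : W, (pos (.bend w)).1 ^ 2 + (pos (.bend w)).2 ^ 2 < 2
  pos_crossing : ∀ c : K, (pos (.crossing c)).1 ^ 2 + (pos (.crossing c)).2 ^ 2 < 2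
  /-- two different edges meet at most in a common vertex -/
  edges_disjoint : ∀ u v u' v' : TangleVertex W K, G.Adj u v → G.Adj u' v' → s(u, v) ≠ s(u', v') →
    ∀ x ∈ segment ℝ (pos u) (pos v) ∩ segment ℝ (pos u') (pos v'),
      ∃ y, y ∈ s(u, v) ∧ y ∈ s(u', v') ∧ x = pos y
  degree_endpoint : ∀ p : Corner, (G.neighborSet (.endpoint p)).ncard = 1
  degree_bend : ∀ w : W, (G.neighborSet (.bend w)).ncard = 2
  neighbors_crossing : ∀ c : K, G.neighborSet (.crossing c) = Set.range (nbr c)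
  over_straight : ∀ c : K,
    pos (.crossing c) ∈ openSegment ℝ (pos (nbr c 0)) (pos (nbr c 2))
  under_straight : ∀ c : K,
    pos (.crossing c) ∈ openSegment ℝ (pos (nbr c 1)) (pos (nbr c 3))
  /-- the understrand end `nbr c 1` comes counterclockwise after the overstrand end `nbr c 0` -/
  counterclockwise : ∀ c : K,
    0 < ((pos (nbr c 0)).1 - (pos (.crossing c)).1) * ((pos (nbr c 1)).2 - (pos (.crossing c)).2) -
      ((pos (nbr c 0)).2 - (pos (.crossing c)).2) * ((pos (nbr c 1)).1 - (pos (.crossing c)).1)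

/-- The two ways of splitting a crossing. -/
inductive Splitting where
  | A | B
  deriving DecidableEq

instance : Fintype Splitting where
  elems := {.A, .B}
  complete s := by cases s <;> decide

/-- How a splitting reconnects the four ends `0, 1, 2, 3` at a crossing, listed counterclockwise with
the overstrand at `0, 2`. Turning the overstrand counterclockwise sweeps the regions between the ends
`0, 1` and between the ends `2, 3`; these are the `A`-regions. The `A`-splitting opens a channel
between them, hence connects `0` with `3` and `1` with `2`; the `B`-splitting connects `0` with `1`
and `2` with `3`. -/
def Splitting.partner : Splitting → Fin 4 → Fin 4
  | .A => ![3, 2, 1, 0]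
  | .B => ![1, 0, 3, 2]

/-- The two closures of a ball tangle diagram by two disjoint arcs outside the disc. -/
inductive TangleClosure where
  | numerator | denominator

/-- The end points connected by the closing arcs: `NW, NE` and `SW, SE` for the numerator closure,
`NW, SW` and `NE, SE` for the denominator closure. -/
def TangleClosure.partner : TangleClosure → Corner → Corner
  | .numerator, .NW => .NE
  | .numerator, .NE => .NW
  | .numerator, .SW => .SE
  | .numerator, .SE => .SW
  | .denominator, .NW => .SW
  | .denominator, .SW => .NW
  | .denominator, .NE => .SE
  | .denominator, .SE => .NE

namespace BallTangleDiagram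

attribute [instance] finiteW fintypeK decidableEqK

/-- A state of the diagram, or of one of its closures, which have the same crossings. -/
abbrev State (D : BallTangleDiagram) : Type := D.K → Splitting

/-- Half-edges (darts) that are directly connected in the crossingless diagram obtained from a closure
of `D` by splitting all crossings according to `σ`. -/
inductive Connects (D : BallTangleDiagram) (cl : TangleClosure) (σ : D.State) :
    D.G.Dart → D.G.Dart → Prop where
  | edge (d : D.G.Dart) : Connects D cl σ d d.symm
  | bend (w : D.W) (d e : D.G.Dart) (hd : d.fst = .bend w) (he : e.fst = .bend w) :
      Connects D cl σ d e
  | crossing (c : D.K) (i : Fin 4) (d e : D.G.Dart)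
      (hd : d.fst = .crossing c) (he : e.fst = .crossing c)
      (hdi : d.snd = D.nbr c i) (hei : e.snd = D.nbr c ((σ c).partner i)) : Connects D cl σ d e
  | closure (p : Corner) (d e : D.G.Dart)
      (hd : d.fst = .endpoint p) (he : e.fst = .endpoint (cl.partner p)) : Connects D cl σ d e

/-- The number of circles of the closure of `D` after splitting its crossings according to `σ`: the
number of classes of half-edges under the equivalence relation generated by `Connects`. -/
noncomputable def circles (D : BallTangleDiagram) (cl : TangleClosure) (σ : D.State) : ℕ :=
  Nat.card (Quot (D.Connects cl σ))

/-- The Kauffman bracket of a closure of `D`, at the variable `a`. -/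
noncomputable def bracket (D : BallTangleDiagram) (cl : TangleClosure) (a : ℂ) : ℂ :=
  ∑ σ : D.State,
    a ^ (Finset.univ.filter fun c => σ c = Splitting.A).card *
      a⁻¹ ^ (Finset.univ.filter fun c => σ c = Splitting.B).card *
        (-a ^ 2 - a⁻¹ ^ 2) ^ (D.circles cl σ - 1)

/-- The ball tangle invariant: the set of all integer matrices of the form
`(z⟨B₁⟩, i z⟨B₂⟩)ᵗ` with `z ^ 8 = 1`, where `B₁` and `B₂` are the numerator and the denominator closure
and the Kauffman bracket is taken at `exp (i π / 4)`. -/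
noncomputable def invariant (D : BallTangleDiagram) : Set (Matrix (Fin 2) (Fin 1) ℤ) :=
  {M | ∃ z : ℂ, z ^ 8 = 1 ∧
    M.map (Int.cast : ℤ → ℂ) =
      !![z * D.bracket .numerator (Complex.exp (Real.pi / 4 * Complex.I));
         Complex.I * z * D.bracket .denominator (Complex.exp (Real.pi / 4 * Complex.I))]}

end BallTangleDiagram

/-- Integer `m × n` matrices modulo multiplication by `-1`, as the set of classes `{M, -M}`. -/
def PM (m n : ℕ) : Set (Set (Matrix (Fin m) (Fin n) ℤ)) :=
  Set.range fun M => {M, -M}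

/-! At A = e^{iπ/4} the loop value -A² - A⁻² vanishes, so only the states with exactly one circle
contribute to a bracket (`bracket_eq`). Since A⁻² = -i, such a state contributes Aⁿ(-i)^β, with n
crossings and β of them split by B.

Why the invariant is one class {M, -M}: over the one-circle states of the numerator closure β has
constant parity, and over those of the denominator closure it has the opposite parity
(`exists_circles_parity`). Hence one bracket lies in Aⁿℤ and the other in iAⁿℤ. The factor i in the
second entry compensates for this, and z = A⁻ⁿ or z = iA⁻ⁿ makes both entries integral
(`exists_realizes`). Another admissible z differs by an eighth root of unity; if some entry is
nonzero, this root carries a nonzero integer to an integer and is ±1 (`Realizes.invariant_eq`).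

Why the parity holds: changing one splitting, or changing the closure, must change the number of
circles by an odd number. This is where planarity enters. A plane diagram has a source-sink
orientation, in which the edges around a crossing alternately arrive and leave, and so do the
strands around the boundary circle (`exists_orientation`). It comes from a checkerboard colouring,
obtained here without regions: in a generic direction, count modulo two the edges above a given
edge. Along an edge this count is consistent except for vertices of odd degree above it, which are
only the end points NW and NE; the upper closing arc corrects for these. Given the orientation, the
circles of a state are the orbits of a permutation of the half-edges of value 0, namely the product
of the reversal of edges with the involution joining half-edges at vertices and closing arcs. A
change of splitting or closure multiplies this permutation by a transposition. That flips its sign,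
hence the parity of the number of orbits (`card_quot_parity`).

Why the map is onto: inserting a diagram into a fixed outer piece acts on its pair (u, v). A
crossing on the right gives (u + v, v), a quarter turn gives (v, -u), and capping off the two right
ends beside a separate arc gives (v, 0). Each formula is a state sum over the outer piece alone,
because in every state the piece either closes up the inserted diagram like one of its two closures
or splits off a circle (`circles_glue_eq`, `circles_glue_ne_one`). Crossings and turns generate the
Euclidean algorithm but preserve the gcd; the cap supplies the pairs (n, 0) for arbitrary n, from
which everything is reached (`realizable`). -/

/-! ### Signs of permutations and parity of numbers of orbits. -/

open Equiv Equiv.Perm in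
/-- The sign of a permutation is determined by the parities of the numbers of points and of orbits. -/
theorem Equiv.Perm.sign_eq_neg_one_pow_card_add_orbits {P : Type*} [Fintype P] [DecidableEq P]
    (f : Equiv.Perm P) :
    Equiv.Perm.sign f =
      (-1) ^ (Fintype.card P + Nat.card (Quotient (Equiv.Perm.SameCycle.setoid f))) := by
  classical
  -- Orbits are fixed points or nontrivial cycles. Fixed points enter the exponent twice, once as
  -- points and once as orbits, and cancel; the rest is the sign formula by cycle type.
  let φ : P → {x // f x = x} ⊕ {c // c ∈ f.cycleFactorsFinset} := fun x =>
    if h : f x = x then .inl ⟨x, h⟩ else .inr ⟨f.cycleOf x, cycleOf_mem_cycleFactorsFinset_iff.2 (by simpa using h)⟩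
  have hφ : ∀ x y, f.SameCycle x y ↔ φ x = φ y := by
    intro x y
    by_cases hx : f x = x
    · by_cases hy : f y = y
      · simp only [φ, hx, hy, dif_pos, Sum.inl.injEq, Subtype.mk.injEq]
        exact ⟨fun h => h.eq_of_left hx, fun h => h ▸ SameCycle.refl _ _⟩
      · simp only [φ, hx, hy, dif_pos, dif_neg, not_false_eq_true, reduceCtorEq, iff_false]
        intro h
        exact hy (h.apply_eq_self_iff.1 hx)
    · by_cases hy : f y = y
      · simp only [φ, hx, hy, dif_pos, dif_neg, not_false_eq_true, reduceCtorEq, iff_false]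
        intro h
        exact hx (h.apply_eq_self_iff.2 hy)
      · simp only [φ, hx, hy, dif_neg, not_false_eq_true, Sum.inr.injEq, Subtype.mk.injEq]
        constructor
        · exact fun h => h.cycleOf_eq
        · intro h
          have : x ∈ (f.cycleOf y).support := by
            rw [← h, mem_support_cycleOf_iff]
            exact ⟨SameCycle.refl _ _, by simpa using hx⟩
          exact (mem_support_cycleOf_iff.1 this).1.symm
  have hbij : Function.Bijective
      (Quotient.lift φ (fun x y h => (hφ x y).1 h) :
        Quotient (SameCycle.setoid f) → _) := by
    constructor
    · intro a b
      induction a using Quotient.inductionOn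
      induction b using Quotient.inductionOn
      intro h
      exact Quotient.sound ((hφ _ _).2 h)
    · rintro (⟨x, hx⟩ | ⟨c, hc⟩)
      · exact ⟨Quotient.mk _ x, by simp [φ, hx]⟩
      · obtain ⟨x, hx⟩ := (mem_cycleFactorsFinset_iff.1 hc).1.nonempty_support
        have h1 : f x ≠ x := by
          have := mem_cycleFactorsFinset_support_le hc hx
          simpa using this
        have h2 := cycle_is_cycleOf hx hc
        refine ⟨Quotient.mk _ x, ?_⟩
        simp [φ, h1, h2]
  rw [Nat.card_eq_of_bijective _ hbij, Nat.card_sum, sign_of_cycleType, sum_cycleType]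
  have h1 : Nat.card {c // c ∈ f.cycleFactorsFinset} = Multiset.card f.cycleType := by
    rw [cycleType_def, Multiset.card_map]
    simp
  have h2 : Fintype.card P = f.support.card + Nat.card {x // f x = x} := by
    rw [Nat.card_eq_fintype_card, Fintype.card_subtype, ← Finset.card_univ,
      ← Finset.card_filter_add_card_filter_not (p := fun x => f x ≠ x)]
    simp only [not_not]
    rfl
  rw [h1, h2]
  have : f.support.card + Nat.card {x // f x = x} + (Nat.card {x // f x = x} + Multiset.card f.cycleType)
      = f.support.card + Multiset.card f.cycleType + 2 * Nat.card {x // f x = x} := by ring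
  rw [this, pow_add _ _ (2 * _), pow_mul]
  simp

/-- If `r` is generated by two involutions `a`, `b` that interchange the two values of `s`, its
classes are the orbits of a permutation of the points of value `0`. The permutation is returned
together with its values. -/
theorem exists_perm_card_quot {D : Type*} (s : D → ZMod 2) (a b : D → D)
    (ha : Function.Involutive a) (hb : Function.Involutive b)
    (hsa : ∀ d, s (a d) = s d + 1) (hsb : ∀ d, s (b d) = s d + 1) (r : D → D → Prop)
    (hra : ∀ d, r d (a d)) (hrb : ∀ d, r d (b d))
    (hr : ∀ d e, r d e → e = d ∨ e = a d ∨ e = b d) :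
    ∃ π : Equiv.Perm {d // s d = 0}, (∀ x, (π x : D) = b (a x)) ∧
      Nat.card (Quot r) = Nat.card (Quotient (Equiv.Perm.SameCycle.setoid π)) := by
  have h2 : ∀ t : ZMod 2, t + 1 + 1 = t := by decide
  let π : Equiv.Perm {d // s d = 0} :=
    { toFun := fun x => ⟨b (a x), by rw [hsb, hsa, h2]; exact x.2⟩
      invFun := fun x => ⟨a (b x), by rw [hsa, hsb, h2]; exact x.2⟩
      left_inv := fun x => Subtype.ext (by simp [hb (a x), ha x.1])
      right_inv := fun x => Subtype.ext (by simp [ha (b x), hb x.1]) }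
  have hπ : ∀ x, (π x : D) = b (a x) := fun _ => rfl
  refine ⟨π, hπ, ?_⟩
  have h01 : ∀ t : ZMod 2, t ≠ 0 → t + 1 = 0 := by decide
  have h10 : ∀ t : ZMod 2, t = 0 → ¬ (t + 1 = 0) := by decide
  classical
  -- Every class of `r` meets the points of value 0: a point of the other value is replaced by its
  -- image under `a`, which lies in the same class.
  let φ : D → Quotient (Equiv.Perm.SameCycle.setoid π) := fun d =>
    if h : s d = 0 then Quotient.mk _ ⟨d, h⟩ else Quotient.mk _ ⟨a d, by rw [hsa]; exact h01 _ h⟩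
  have hφa : ∀ d, φ (a d) = φ d := by
    intro d
    by_cases h : s d = 0
    · have : ¬ s (a d) = 0 := by rw [hsa]; exact h10 _ h
      simp [φ, h, this, ha d]
    · have : s (a d) = 0 := by rw [hsa]; exact h01 _ h
      simp [φ, h, this]
  have hφb1 : ∀ d, s d = 0 → φ (b d) = φ d := by
    intro d h
    have h' : ¬ s (b d) = 0 := by rw [hsb]; exact h10 _ h
    simp only [φ, h, h', dif_pos, dif_neg, not_false_eq_true]
    apply Quotient.sound
    refine ⟨1, Subtype.ext ?_⟩
    simp [hπ, ha (b d), hb d]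
  have hφb : ∀ d, φ (b d) = φ d := by
    intro d
    by_cases h : s d = 0
    · exact hφb1 d h
    · have : s (b d) = 0 := by rw [hsb]; exact h01 _ h
      rw [← hφb1 _ this, hb d]
  have hφr : ∀ d e, r d e → φ d = φ e := by
    intro d e h
    rcases hr d e h with rfl | rfl | rfl
    · rfl
    · exact (hφa d).symm
    · exact (hφb d).symm
  refine Nat.card_eq_of_bijective (Quot.lift φ hφr) ⟨?_, ?_⟩
  · have key : ∀ (x : {d // s d = 0}), (Quot.mk r (π x : D)) = Quot.mk r (x : D) := by
      intro x
      rw [hπ, ← Quot.sound (hrb (a x)), ← Quot.sound (hra x)]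
    have key2 : ∀ x y : {d // s d = 0}, π.SameCycle x y → Quot.mk r (x : D) = Quot.mk r (y : D) := by
      rintro x y ⟨i, rfl⟩
      induction i using Int.induction_on with
      | zero => simp
      | succ i ih => rw [add_comm, zpow_add, Equiv.Perm.mul_apply, zpow_one, key]; exact ih
      | pred i ih =>
        rw [ih, ← key ((π ^ (-(i : ℤ) - 1)) x), ← Equiv.Perm.mul_apply, ← zpow_one_add]
        congr 4
        ring
    have key3 : ∀ d, ∃ x : {d // s d = 0}, φ d = Quotient.mk _ x ∧ Quot.mk r d = Quot.mk r (x : D) := by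
      intro d
      by_cases h : s d = 0
      · exact ⟨⟨d, h⟩, by simp [φ, h], rfl⟩
      · exact ⟨⟨a d, by rw [hsa]; exact h01 _ h⟩, by simp [φ, h], Quot.sound (hra d)⟩
    rintro ⟨d⟩ ⟨e⟩ h
    obtain ⟨x, hx, hx'⟩ := key3 d
    obtain ⟨y, hy, hy'⟩ := key3 e
    change φ d = φ e at h
    rw [hx, hy] at h
    rw [hx', hy']
    exact key2 _ _ (Quotient.exact h)
  · intro q
    induction q using Quotient.inductionOn with
    | h x => exact ⟨Quot.mk r x, by simp [φ, x.2]⟩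

/-- Changing one of two involutions by a transposition changes the parity of the number of classes. -/
theorem card_quot_parity {D : Type*} [Finite D] (s : D → ZMod 2) (a b b' : D → D)
    (ha : Function.Involutive a) (hb : Function.Involutive b) (hb' : Function.Involutive b')
    (hsa : ∀ d, s (a d) = s d + 1) (hsb : ∀ d, s (b d) = s d + 1) (hsb' : ∀ d, s (b' d) = s d + 1)
    (r r' : D → D → Prop)
    (hra : ∀ d, r d (a d)) (hrb : ∀ d, r d (b d))
    (hr : ∀ d e, r d e → e = d ∨ e = a d ∨ e = b d)
    (hra' : ∀ d, r' d (a d)) (hrb' : ∀ d, r' d (b' d))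
    (hr' : ∀ d e, r' d e → e = d ∨ e = a d ∨ e = b' d)
    (x y : D) (hx : s x = 0) (hy : s y = 0) (hxy : x ≠ y)
    (hbx : ∀ d, b d = x → b' d = y) (hby : ∀ d, b d = y → b' d = x)
    (hbb : ∀ d, s d ≠ 0 → b d ≠ x → b d ≠ y → b' d = b d) :
    ((Nat.card (Quot r') : ℕ) : ZMod 2) = (Nat.card (Quot r) : ℕ) + 1 := by
  classical
  have := Fintype.ofFinite D
  obtain ⟨π, hπ, hc⟩ := exists_perm_card_quot s a b ha hb hsa hsb r hra hrb hr
  obtain ⟨π', hπ', hc'⟩ := exists_perm_card_quot s a b' ha hb' hsa hsb' r' hra' hrb' hr'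
  have h10 : ∀ t : ZMod 2, t = 0 → ¬ (t + 1 = 0) := by decide
  -- Both permutations first apply `a`, which leads to points of nonzero value, so `b` and `b'` need
  -- to be compared only there.
  have hmul : π' = Equiv.swap ⟨x, hx⟩ ⟨y, hy⟩ * π := by
    ext ⟨d, hd⟩
    rw [Equiv.Perm.mul_apply, Equiv.swap_apply_def]
    split_ifs with h1 h2
    · have : b (a d) = x := by rw [← hπ ⟨d, hd⟩, h1]
      rw [hπ']
      exact hbx _ this
    · have : b (a d) = y := by rw [← hπ ⟨d, hd⟩, h2]
      rw [hπ']
      exact hby _ this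
    · rw [hπ', hπ]
      apply hbb
      · rw [hsa]; exact h10 _ hd
      · intro h
        exact h1 (Subtype.ext (by rw [hπ]; exact h))
      · intro h
        exact h2 (Subtype.ext (by rw [hπ]; exact h))
  have hsign : Equiv.Perm.sign π' = - Equiv.Perm.sign π := by
    rw [hmul, Equiv.Perm.sign_mul, Equiv.Perm.sign_swap (by simpa using hxy)]
    simp
  rw [Equiv.Perm.sign_eq_neg_one_pow_card_add_orbits,
    Equiv.Perm.sign_eq_neg_one_pow_card_add_orbits, ← hc, ← hc', pow_add, pow_add,
    neg_mul_eq_mul_neg, mul_left_cancel_iff] at hsign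
  rcases Nat.even_or_odd (Nat.card (Quot r)) with h | h <;>
    rcases Nat.even_or_odd (Nat.card (Quot r')) with h' | h'
  · rw [h.neg_one_pow, h'.neg_one_pow] at hsign
    exact absurd hsign (by decide)
  · rw [(ZMod.natCast_eq_zero_iff_even).2 h, (ZMod.natCast_eq_one_iff_odd).2 h']; rfl
  · rw [(ZMod.natCast_eq_one_iff_odd).2 h, (ZMod.natCast_eq_zero_iff_even).2 h']; rfl
  · rw [h.neg_one_pow, h'.neg_one_pow] at hsign
    exact absurd hsign (by decide)

/-! ### Plane drawings seen along a generic direction: the order of edges by height. -/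

/-- A straight-line drawing of a graph in the plane without crossing edges and without two vertices
on a common vertical line; edges are compared by their heights over points of the `X`-axis. -/
structure SweepDrawing {V : Type} (G : SimpleGraph V) where
  X : V → ℝ
  Y : V → ℝ
  X_injective : Function.Injective X
  planar : ∀ a b a' b', G.Adj a b → G.Adj a' b' → X a < X b → X a' < X b' → ¬ (a = a' ∧ b = b') →
    ∀ x, X a ≤ x → x ≤ X b → X a' ≤ x → x ≤ X b' →
      Y a + (Y b - Y a) / (X b - X a) * (x - X a) =
        Y a' + (Y b' - Y a') / (X b' - X a') * (x - X a') →
      ∃ y, (y = a ∨ y = b) ∧ (y = a' ∨ y = b') ∧ x = X y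

namespace SweepDrawing

variable {V : Type} {G : SimpleGraph V} (S : SweepDrawing G)

/-- The slope of the line through two vertices. -/
noncomputable def slope (a b : V) : ℝ := (S.Y b - S.Y a) / (S.X b - S.X a)

theorem slope_comm (a b : V) : S.slope a b = S.slope b a := by
  unfold slope
  rw [← neg_sub (S.Y a), ← neg_sub (S.X a), neg_div_neg_eq]

/-- Edges, directed to the right. -/
def RightDart : Type := {d : V × V // G.Adj d.1 d.2 ∧ S.X d.1 < S.X d.2}

instance [Finite V] : Finite S.RightDart := by unfold RightDart; infer_instance

variable {S} in
/-- An edge with known left and right ends. -/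
def RightDart.of {a b : V} (h : G.Adj a b) (h' : S.X a < S.X b) : S.RightDart := ⟨(a, b), h, h'⟩

variable {S} in
/-- The left end of an edge. -/
def RightDart.src (d : S.RightDart) : V := d.1.1

variable {S} in
/-- The right end of an edge. -/
def RightDart.tgt (d : S.RightDart) : V := d.1.2

namespace RightDart

variable {S} (d e : S.RightDart)

theorem adj : G.Adj d.src d.tgt := d.2.1

theorem lt : S.X d.src < S.X d.tgt := d.2.2

variable {d e} in
theorem eq_of (h : d.src = e.src) (h' : d.tgt = e.tgt) : d = e := Subtype.ext (Prod.ext h h')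

/-- The height of an edge over a point of the axis. -/
noncomputable def height (x : ℝ) : ℝ := S.Y d.src + S.slope d.src d.tgt * (x - S.X d.src)

theorem height_eq' (x : ℝ) : d.height x = S.Y d.tgt + S.slope d.src d.tgt * (x - S.X d.tgt) := by
  have := d.lt
  have h : S.X d.tgt - S.X d.src ≠ 0 := by linarith
  unfold height slope
  field_simp
  ring

theorem height_src : d.height (S.X d.src) = S.Y d.src := by simp [height]

theorem height_tgt : d.height (S.X d.tgt) = S.Y d.tgt := by simp [height_eq']

variable {d e} in
theorem exists_common (hne : d ≠ e) {x : ℝ} (h1 : S.X d.src ≤ x) (h2 : x ≤ S.X d.tgt)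
    (h3 : S.X e.src ≤ x) (h4 : x ≤ S.X e.tgt) (h : d.height x = e.height x) :
    ∃ y, (y = d.src ∨ y = d.tgt) ∧ (y = e.src ∨ y = e.tgt) ∧ x = S.X y :=
  S.planar _ _ _ _ d.adj e.adj d.lt e.lt (fun h => hne (eq_of h.1 h.2)) x h1 h2 h3 h4 h

theorem continuous_height : Continuous d.height := by unfold height; fun_prop

-- By continuity, a change of order would produce a point of equal height in between. Planarity
-- allows such a point only at a common vertex, and `hc` excludes those.
variable {d e} in
theorem height_lt_of_height_lt (hne : d ≠ e) {x x' : ℝ}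
    (h1 : S.X d.src ≤ x) (h2 : x ≤ S.X d.tgt) (h3 : S.X e.src ≤ x) (h4 : x ≤ S.X e.tgt)
    (h1' : S.X d.src ≤ x') (h2' : x' ≤ S.X d.tgt) (h3' : S.X e.src ≤ x') (h4' : x' ≤ S.X e.tgt)
    (hc : ∀ y, (y = d.src ∨ y = d.tgt) → (y = e.src ∨ y = e.tgt) → S.X y ∉ Set.uIcc x x')
    (h : d.height x < e.height x) : d.height x' < e.height x' := by
  by_contra! hcon
  have hcont : ContinuousOn (fun t => e.height t - d.height t) (Set.uIcc x x') :=
    (e.continuous_height.sub d.continuous_height).continuousOn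
  have h0 : (0 : ℝ) ∈ Set.uIcc (e.height x - d.height x) (e.height x' - d.height x') :=
    Set.mem_uIcc.2 (Or.inr ⟨by linarith, by linarith⟩)
  obtain ⟨t, ht, ht0⟩ := intermediate_value_uIcc hcont h0
  have ht' := Set.mem_uIcc.1 ht
  obtain ⟨y, hy1, hy2, rfl⟩ := exists_common (d := d) (e := e) hne (x := t)
    (by rcases ht' with h | h <;> linarith) (by rcases ht' with h | h <;> linarith)
    (by rcases ht' with h | h <;> linarith) (by rcases ht' with h | h <;> linarith)
    (by simp only at ht0; linarith)
  exact hc y hy1 hy2 ht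

/-- The edge `e` passes above the edge `d`, over some point interior to both spans. -/
def Above : Prop := ∃ x, S.X d.src < x ∧ x < S.X d.tgt ∧ S.X e.src < x ∧ x < S.X e.tgt ∧
  d.height x < e.height x

-- The order of two edges is the same at all points of their common span other than shared vertices,
-- so it may be tested at the end of one of them, where its height is known. `hlr` and `hrl` say
-- that the spans overlap in an interval.
variable {d e} in
theorem above_iff (hne : d ≠ e) (hlr : S.X d.src < S.X e.tgt) (hrl : S.X e.src < S.X d.tgt) {x : ℝ}
    (h1 : S.X d.src ≤ x) (h2 : x ≤ S.X d.tgt) (h3 : S.X e.src ≤ x) (h4 : x ≤ S.X e.tgt)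
    (hc : ∀ y, (y = d.src ∨ y = d.tgt) → (y = e.src ∨ y = e.tgt) → S.X y ≠ x) :
    Above d e ↔ d.height x < e.height x := by
  have key : ∀ z, S.X d.src < z → z < S.X d.tgt → S.X e.src < z → z < S.X e.tgt →
      ∀ y, (y = d.src ∨ y = d.tgt) → (y = e.src ∨ y = e.tgt) → S.X y ∉ Set.uIcc x z := by
    intro z hz1 hz2 hz3 hz4 y hy1 hy2 hy
    have hxy := hc y hy1 hy2
    rcases Set.mem_uIcc.1 hy with h | h
    · have : x < S.X y := lt_of_le_of_ne h.1 hxy.symm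
      rcases hy1 with rfl | rfl <;> linarith
    · have : S.X y < x := lt_of_le_of_ne h.2 hxy
      rcases hy1 with rfl | rfl <;> linarith
  constructor
  · rintro ⟨z, hz1, hz2, hz3, hz4, hz⟩
    refine height_lt_of_height_lt hne hz1.le hz2.le hz3.le hz4.le h1 h2 h3 h4 ?_ hz
    intro y hy1 hy2
    rw [Set.uIcc_comm]
    exact key z hz1 hz2 hz3 hz4 y hy1 hy2
  · intro h
    obtain ⟨z, hz1, hz2⟩ := exists_between
      (show max (S.X d.src) (S.X e.src) < min (S.X d.tgt) (S.X e.tgt) from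
        max_lt (lt_min d.lt hlr) (lt_min hrl e.lt))
    rw [max_lt_iff] at hz1
    rw [lt_min_iff] at hz2
    exact ⟨z, hz1.1, hz2.1, hz1.2, hz2.2, height_lt_of_height_lt hne h1 h2 h3 h4 hz1.1.le hz2.1.le
      hz1.2.le hz2.2.le (key z hz1.1 hz2.1 hz1.2 hz2.2) h⟩

variable {d e} in
theorem Above.ne (h : Above d e) : d ≠ e := by
  rintro rfl
  obtain ⟨x, _, _, _, _, h⟩ := h
  exact lt_irrefl _ h

variable {d e} in
theorem Above.src_lt_tgt (h : Above d e) : S.X d.src < S.X e.tgt := by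
  obtain ⟨x, h1, _, _, h2, _⟩ := h
  linarith

variable {d e} in
theorem Above.src_lt_tgt' (h : Above d e) : S.X e.src < S.X d.tgt := by
  obtain ⟨x, _, h1, h2, _, _⟩ := h
  linarith

/-- For edges with the same left end, the upper one has the larger slope. -/
theorem above_iff_slope_of_src (h : e.src = d.src) :
    Above d e ↔ S.slope d.src d.tgt < S.slope e.src e.tgt := by
  constructor
  · rintro ⟨x, h1, _, _, _, hx⟩
    unfold height at hx
    rw [h] at hx ⊢
    have : 0 < x - S.X d.src := by linarith
    exact lt_of_mul_lt_mul_right (by linarith) this.le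
  · intro hs
    obtain ⟨z, hz1, hz2⟩ := exists_between
      (show S.X d.src < min (S.X d.tgt) (S.X e.tgt) from lt_min d.lt (h ▸ e.lt))
    rw [lt_min_iff] at hz2
    refine ⟨z, hz1, hz2.1, h ▸ hz1, hz2.2, ?_⟩
    unfold height
    rw [h] at hs ⊢
    have : 0 < z - S.X d.src := by linarith
    nlinarith

/-- For edges with the same right end, the upper one has the smaller slope. -/
theorem above_iff_slope_of_tgt (h : e.tgt = d.tgt) :
    Above d e ↔ S.slope e.src e.tgt < S.slope d.src d.tgt := by
  constructor
  · rintro ⟨x, _, h1, _, _, hx⟩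
    rw [height_eq', height_eq'] at hx
    rw [h] at hx ⊢
    have : 0 < S.X d.tgt - x := by linarith
    exact lt_of_mul_lt_mul_right (by linarith) this.le
  · intro hs
    obtain ⟨z, hz1, hz2⟩ := exists_between
      (show max (S.X d.src) (S.X e.src) < S.X d.tgt from max_lt d.lt (h ▸ e.lt))
    rw [max_lt_iff] at hz1
    refine ⟨z, hz1.1, hz2, hz1.2, h ▸ hz2, ?_⟩
    rw [height_eq', height_eq']
    rw [h] at hs ⊢
    have : 0 < S.X d.tgt - z := by linarith
    nlinarith

end RightDart

open RightDart

/-- Two edges at a vertex, on the same side, have different slopes. -/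
theorem slope_ne {v u w : V} (hu : G.Adj v u) (hw : G.Adj v w) (huw : u ≠ w)
    (hside : (S.X v < S.X u ∧ S.X v < S.X w) ∨ (S.X u < S.X v ∧ S.X w < S.X v)) :
    S.slope v u ≠ S.slope v w := by
  intro h
  rcases hside with ⟨h1, h2⟩ | ⟨h1, h2⟩
  · let d : S.RightDart := ⟨(v, u), hu, h1⟩
    let e : S.RightDart := ⟨(v, w), hw, h2⟩
    obtain ⟨z, hz1, hz2⟩ := exists_between (lt_min h1 h2)
    rw [lt_min_iff] at hz2
    obtain ⟨y, hy, -, rfl⟩ := exists_common (d := d) (e := e)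
      (fun h => huw (congrArg (fun d : S.RightDart => d.tgt) h)) (x := z) hz1.le hz2.1.le hz1.le
      hz2.2.le (by change _ + S.slope v u * _ = _ + S.slope v w * _; rw [h]; rfl)
    rcases hy with rfl | rfl
    · exact lt_irrefl _ hz1
    · exact lt_irrefl _ hz2.1
  · let d : S.RightDart := ⟨(u, v), hu.symm, h1⟩
    let e : S.RightDart := ⟨(w, v), hw.symm, h2⟩
    obtain ⟨z, hz1, hz2⟩ := exists_between (max_lt h1 h2)
    rw [max_lt_iff] at hz1
    obtain ⟨y, hy, -, rfl⟩ := exists_common (d := d) (e := e)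
      (fun h => huw (congrArg (fun d : S.RightDart => d.src) h)) (x := z) hz1.1.le hz2.le hz1.2.le
      hz2.le (by
        rw [height_eq', height_eq']
        change _ + S.slope u v * _ = _ + S.slope w v * _
        rw [S.slope_comm u v, S.slope_comm w v, h]; rfl)
    rcases hy with rfl | rfl
    · exact lt_irrefl _ hz1.1
    · exact lt_irrefl _ hz2

/-- No edge passes through a vertex that is not isolated. -/
theorem height_ne (d : S.RightDart) {v w : V} (hv : G.Adj v w) (h1 : S.X d.src < S.X v)
    (h2 : S.X v < S.X d.tgt) : d.height (S.X v) ≠ S.Y v := by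
  intro h
  have hX := S.X_injective.ne hv.ne
  have key : ∀ e : S.RightDart, d ≠ e → (v = e.src ∨ v = e.tgt) → False := by
    intro e hne he
    have : S.X e.src ≤ S.X v ∧ S.X v ≤ S.X e.tgt ∧ e.height (S.X v) = S.Y v := by
      rcases he with rfl | rfl
      · exact ⟨le_rfl, e.lt.le, e.height_src⟩
      · exact ⟨e.lt.le, le_rfl, e.height_tgt⟩
    obtain ⟨y, hy, -, hxy⟩ := exists_common hne h1.le h2.le this.1 this.2.1 (h.trans this.2.2.symm)
    rcases hy with rfl | rfl <;> linarith
  rcases lt_or_gt_of_ne hX with hlt | hlt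
  · refine key ⟨(v, w), hv, hlt⟩ ?_ (Or.inl rfl)
    rintro rfl
    exact lt_irrefl _ h1
  · refine key ⟨(w, v), hv.symm, hlt⟩ ?_ (Or.inr rfl)
    rintro rfl
    exact lt_irrefl _ h2

/-- The vertices strictly above an edge. -/
def upper (d : S.RightDart) : Set V :=
  {v | S.X d.src < S.X v ∧ S.X v < S.X d.tgt ∧ d.height (S.X v) < S.Y v}

/-- Comparing heights over the left end of `e` turns a relation between edges into membership of a
vertex in `upper d`; this is what lets degrees enter the count. -/
theorem above_and_src_lt_iff (d e : S.RightDart) :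
    (Above d e ∧ S.X d.src < S.X e.src) ↔ e.src ∈ S.upper d := by
  have hc : S.X d.src < S.X e.src → S.X e.src < S.X d.tgt →
      ∀ y, (y = d.src ∨ y = d.tgt) → (y = e.src ∨ y = e.tgt) → S.X y ≠ S.X e.src := by
    intro h1 h2 y hy1 _ hX
    rcases hy1 with rfl | rfl <;> linarith
  constructor
  · rintro ⟨hab, hlt⟩
    refine ⟨hlt, hab.src_lt_tgt', ?_⟩
    rwa [above_iff hab.ne hab.src_lt_tgt hab.src_lt_tgt' hlt.le hab.src_lt_tgt'.le le_rfl e.lt.le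
      (hc hlt hab.src_lt_tgt'), height_src] at hab
  · rintro ⟨h1, h2, h3⟩
    refine ⟨?_, h1⟩
    rw [above_iff (x := S.X e.src) _ (h1.trans e.lt) h2 h1.le h2.le le_rfl e.lt.le (hc h1 h2),
      height_src]
    · exact h3
    · rintro rfl
      exact lt_irrefl _ h1

theorem above_and_tgt_lt_iff (d e : S.RightDart) :
    (Above d e ∧ S.X e.tgt < S.X d.tgt) ↔ e.tgt ∈ S.upper d := by
  have hc : S.X d.src < S.X e.tgt → S.X e.tgt < S.X d.tgt →
      ∀ y, (y = d.src ∨ y = d.tgt) → (y = e.src ∨ y = e.tgt) → S.X y ≠ S.X e.tgt := by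
    intro h1 h2 y hy1 _ hX
    rcases hy1 with rfl | rfl <;> linarith
  constructor
  · rintro ⟨hab, hlt⟩
    refine ⟨hab.src_lt_tgt, hlt, ?_⟩
    rwa [above_iff hab.ne hab.src_lt_tgt hab.src_lt_tgt' hab.src_lt_tgt.le hlt.le e.lt.le le_rfl
      (hc hab.src_lt_tgt hlt), height_tgt] at hab
  · rintro ⟨h1, h2, h3⟩
    refine ⟨?_, h2⟩
    rw [above_iff (x := S.X e.tgt) _ h1 (e.lt.trans h2) h1.le h2.le e.lt.le le_rfl (hc h1 h2),
      height_tgt]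
    · exact h3
    · rintro rfl
      exact lt_irrefl _ h2

/-! ### Parity counts of the edges above an edge or a vertex. -/

section Counting

variable [Finite V]

/-- The number of edges passing above a vertex. -/
noncomputable def passing (v : V) : ℕ :=
  {e : S.RightDart | S.X e.src < S.X v ∧ S.X v < S.X e.tgt ∧ S.Y v < e.height (S.X v)}.ncard

/-- The orientation of the edge from `v` to `u`, as an element of `ℤ/2`: the parity of the number
of edges above the edge near `v`, changed if the edge leads to the left. -/
noncomputable def orient (v u : V) : ZMod 2 :=
  open Classical in
  if S.X v < S.X u then
    S.passing v + {w | G.Adj v w ∧ S.X v < S.X w ∧ S.slope v u < S.slope v w}.ncard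
  else
    1 + S.passing v + {w | G.Adj v w ∧ S.X w < S.X v ∧ S.slope v w < S.slope v u}.ncard

theorem ncard_src_mem (U : Set V) :
    {e : S.RightDart | e.src ∈ U}.ncard =
      ∑ᶠ v ∈ U, {w | G.Adj v w ∧ S.X v < S.X w}.ncard := by
  classical
  have := Fintype.ofFinite V
  have := Fintype.ofFinite S.RightDart
  rw [finsum_mem_eq_toFinset_sum, Set.ncard_eq_toFinset_card',
    Finset.card_eq_sum_card_fiberwise (f := RightDart.src) (t := U.toFinset)
      (fun e he => by simpa using he)]
  refine Finset.sum_congr rfl fun v hv => ?_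
  rw [Set.ncard_eq_toFinset_card']
  have hv' : v ∈ U := by simpa using hv
  refine Finset.card_bij' (fun e _ => RightDart.tgt e)
    (fun w hw => .of (by simpa using hw : G.Adj v w ∧ S.X v < S.X w).1
      (by simpa using hw : G.Adj v w ∧ S.X v < S.X w).2) ?_ ?_ ?_ ?_
  · intro e he
    simp only [Finset.mem_filter, Set.mem_toFinset, Set.mem_ofPred_eq] at he ⊢
    obtain ⟨-, rfl⟩ := he
    exact ⟨e.adj, e.lt⟩
  · intro w hw
    simp only [Finset.mem_filter, Set.mem_toFinset, Set.mem_ofPred_eq]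
    exact ⟨hv', rfl⟩
  · intro e he
    simp only [Finset.mem_filter] at he
    exact RightDart.eq_of he.2.symm rfl
  · intro w hw
    rfl

theorem ncard_tgt_mem (U : Set V) :
    {e : S.RightDart | e.tgt ∈ U}.ncard =
      ∑ᶠ v ∈ U, {w | G.Adj v w ∧ S.X w < S.X v}.ncard := by
  classical
  have := Fintype.ofFinite V
  have := Fintype.ofFinite S.RightDart
  rw [finsum_mem_eq_toFinset_sum, Set.ncard_eq_toFinset_card',
    Finset.card_eq_sum_card_fiberwise (f := RightDart.tgt) (t := U.toFinset)
      (fun e he => by simpa using he)]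
  refine Finset.sum_congr rfl fun v hv => ?_
  rw [Set.ncard_eq_toFinset_card']
  have hv' : v ∈ U := by simpa using hv
  refine Finset.card_bij' (fun e _ => RightDart.src e)
    (fun w hw => .of (by simpa using hw : G.Adj v w ∧ S.X w < S.X v).1.symm
      (by simpa using hw : G.Adj v w ∧ S.X w < S.X v).2) ?_ ?_ ?_ ?_
  · intro e he
    simp only [Finset.mem_filter, Set.mem_toFinset, Set.mem_ofPred_eq] at he ⊢
    obtain ⟨-, rfl⟩ := he
    exact ⟨e.adj.symm, e.lt⟩
  · intro w hw
    simp only [Finset.mem_filter, Set.mem_toFinset, Set.mem_ofPred_eq]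
    exact ⟨hv', rfl⟩
  · intro e he
    simp only [Finset.mem_filter] at he
    exact RightDart.eq_of rfl he.2.symm
  · intro w hw
    rfl

/-- The ends of edges in a set of vertices are counted by degrees. -/
theorem ncard_src_mem_add_ncard_tgt_mem (U : Set V) :
    {e : S.RightDart | e.src ∈ U}.ncard + {e : S.RightDart | e.tgt ∈ U}.ncard =
      ∑ᶠ v ∈ U, (G.neighborSet v).ncard := by
  rw [ncard_src_mem, ncard_tgt_mem, ← finsum_mem_add_distrib U.toFinite]
  refine finsum_mem_congr rfl fun v _ => ?_
  rw [← Set.ncard_union_eq _ (Set.toFinite _) (Set.toFinite _)]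
  · congr 1
    ext w
    simp only [Set.mem_union, Set.mem_ofPred_eq, SimpleGraph.mem_neighborSet, ← and_or_left,
      and_iff_left_iff_imp]
    exact fun h => lt_or_gt_of_ne (S.X_injective.ne h.ne)
  · rw [Set.disjoint_left]
    rintro w ⟨_, h1⟩ ⟨_, h2⟩
    exact lt_asymm h1 h2

/-- An edge above `d` that starts no further right either passes over the left end of `d` or starts
there with larger slope. The right side is the count used by `orient` at that end. -/
theorem ncard_above_left (d : S.RightDart) :
    {e : S.RightDart | Above d e ∧ S.X e.src ≤ S.X d.src}.ncard =
      S.passing d.src +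
        {w | G.Adj d.src w ∧ S.X d.src < S.X w ∧ S.slope d.src d.tgt < S.slope d.src w}.ncard := by
  have h1 : {w | G.Adj d.src w ∧ S.X d.src < S.X w ∧
      S.slope d.src d.tgt < S.slope d.src w}.ncard =
      {e : S.RightDart | e.src = d.src ∧ Above d e}.ncard := by
    refine Set.ncard_congr (fun w hw => .of hw.1 hw.2.1) ?_ ?_ ?_
    · intro w hw
      exact ⟨rfl, (above_iff_slope_of_src d (.of hw.1 hw.2.1) rfl).2 hw.2.2⟩
    · intro w w' _ _ h
      exact congrArg (fun e : S.RightDart => e.tgt) h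
    · rintro e ⟨he, hab⟩
      have := (above_iff_slope_of_src d e he).1 hab
      rw [he] at this
      exact ⟨e.tgt, ⟨he ▸ e.adj, he ▸ e.lt, this⟩, RightDart.eq_of he.symm rfl⟩
  rw [h1, passing, ← Set.ncard_union_eq _ (Set.toFinite _) (Set.toFinite _)]
  · congr 1
    ext e
    simp only [Set.mem_ofPred_eq, Set.mem_union]
    constructor
    · rintro ⟨hab, hle⟩
      rcases hle.lt_or_eq with hlt | heq
      · refine Or.inl ⟨hlt, hab.src_lt_tgt, ?_⟩
        rw [above_iff hab.ne hab.src_lt_tgt hab.src_lt_tgt' le_rfl d.lt.le hle hab.src_lt_tgt.le,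
          height_src] at hab
        · exact hab
        · intro y _ hy2 hX
          have := hab.src_lt_tgt
          rcases hy2 with rfl | rfl <;> linarith
      · exact Or.inr ⟨S.X_injective heq, hab⟩
    · rintro (⟨h2, h3, h4⟩ | ⟨h2, h3⟩)
      · refine ⟨?_, h2.le⟩
        rw [above_iff (x := S.X d.src) _ h3 (h2.trans d.lt) le_rfl d.lt.le h2.le h3.le, height_src]
        · exact h4
        · intro y _ hy2 hX
          rcases hy2 with rfl | rfl <;> linarith
        · rintro rfl
          exact lt_irrefl _ h2
      · exact ⟨h3, h2 ▸ le_rfl⟩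
  · rw [Set.disjoint_left]
    rintro e ⟨h2, _⟩ ⟨h3, _⟩
    exact lt_irrefl _ (h3 ▸ h2)

theorem ncard_above_right (d : S.RightDart) :
    {e : S.RightDart | Above d e ∧ S.X d.tgt ≤ S.X e.tgt}.ncard =
      S.passing d.tgt +
        {w | G.Adj d.tgt w ∧ S.X w < S.X d.tgt ∧ S.slope d.tgt w < S.slope d.tgt d.src}.ncard := by
  have h1 : {w | G.Adj d.tgt w ∧ S.X w < S.X d.tgt ∧
      S.slope d.tgt w < S.slope d.tgt d.src}.ncard =
      {e : S.RightDart | e.tgt = d.tgt ∧ Above d e}.ncard := by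
    refine Set.ncard_congr (fun w hw => .of hw.1.symm hw.2.1) ?_ ?_ ?_
    · intro w hw
      refine ⟨rfl, (above_iff_slope_of_tgt d (.of hw.1.symm hw.2.1) rfl).2 ?_⟩
      rw [S.slope_comm d.src]
      exact (S.slope_comm _ _).trans_lt hw.2.2
    · intro w w' _ _ h
      exact congrArg (fun e : S.RightDart => e.src) h
    · rintro e ⟨he, hab⟩
      have := (above_iff_slope_of_tgt d e he).1 hab
      rw [he, S.slope_comm, S.slope_comm d.src] at this
      exact ⟨e.src, ⟨he ▸ e.adj.symm, he ▸ e.lt, this⟩, RightDart.eq_of rfl he.symm⟩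
  rw [h1, passing, ← Set.ncard_union_eq _ (Set.toFinite _) (Set.toFinite _)]
  · congr 1
    ext e
    simp only [Set.mem_ofPred_eq, Set.mem_union]
    constructor
    · rintro ⟨hab, hle⟩
      rcases hle.lt_or_eq with hlt | heq
      · refine Or.inl ⟨hab.src_lt_tgt', hlt, ?_⟩
        rw [above_iff hab.ne hab.src_lt_tgt hab.src_lt_tgt' d.lt.le le_rfl hab.src_lt_tgt'.le hle,
          height_tgt] at hab
        · exact hab
        · intro y _ hy2 hX
          have := hab.src_lt_tgt'
          rcases hy2 with rfl | rfl <;> linarith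
      · exact Or.inr ⟨S.X_injective heq.symm, hab⟩
    · rintro (⟨h2, h3, h4⟩ | ⟨h2, h3⟩)
      · refine ⟨?_, h3.le⟩
        rw [above_iff (x := S.X d.tgt) _ (d.lt.trans h3) h2 d.lt.le le_rfl h2.le h3.le, height_tgt]
        · exact h4
        · intro y _ hy2 hX
          rcases hy2 with rfl | rfl <;> linarith
        · rintro rfl
          exact lt_irrefl _ h3
      · exact ⟨h3, h2 ▸ le_rfl⟩
  · rw [Set.disjoint_left]
    rintro e ⟨_, h2, _⟩ ⟨h3, _⟩
    exact lt_irrefl _ (h3 ▸ h2)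

/-- The orientations of the two directions of an edge differ, up to the degrees of the vertices above
the edge. -/
theorem orient_add_orient_swap (d : S.RightDart) :
    S.orient d.src d.tgt + S.orient d.tgt d.src =
      1 + ((∑ᶠ v ∈ S.upper d, (G.neighborSet v).ncard : ℕ) : ZMod 2) := by
  -- The edges above `d` are counted twice, sorted by their left ends and by their right ends. The
  -- ends lying over the interior of `d`, left ones in one count and right ones in the other, add up
  -- to the degrees of the vertices in `upper d`.
  have hL : {e : S.RightDart | Above d e}.ncard =
      {e : S.RightDart | Above d e ∧ S.X e.src ≤ S.X d.src}.ncard +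
        {e : S.RightDart | e.src ∈ S.upper d}.ncard := by
    rw [← Set.ncard_union_eq _ (Set.toFinite _) (Set.toFinite _)]
    · congr 1
      ext e
      have := S.above_and_src_lt_iff d e
      simp only [Set.mem_ofPred_eq, Set.mem_union, ← this, ← and_or_left, le_or_gt, and_true]
    · rw [Set.disjoint_left]
      rintro e ⟨_, h1⟩ h2
      exact not_lt.2 h1 h2.1
  have hR : {e : S.RightDart | Above d e}.ncard =
      {e : S.RightDart | Above d e ∧ S.X d.tgt ≤ S.X e.tgt}.ncard +
        {e : S.RightDart | e.tgt ∈ S.upper d}.ncard := by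
    rw [← Set.ncard_union_eq _ (Set.toFinite _) (Set.toFinite _)]
    · congr 1
      ext e
      have := S.above_and_tgt_lt_iff d e
      simp only [Set.mem_ofPred_eq, Set.mem_union, ← this, ← and_or_left, le_or_gt, and_true]
    · rw [Set.disjoint_left]
      rintro e ⟨_, h1⟩ h2
      exact not_lt.2 h1 h2.2.1
  have key := hL.symm.trans hR
  rw [ncard_above_left, ncard_above_right] at key
  rw [← ncard_src_mem_add_ncard_tgt_mem, orient, orient, if_pos d.lt, if_neg d.lt.not_gt]
  have h2 : ∀ a b : ZMod 2, a + b = 0 → a = b := by decide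
  have key' := congrArg (Nat.cast : ℕ → ZMod 2) key
  push_cast at key' ⊢
  have e2 : ∀ x : ZMod 2, x + x = 0 := by decide
  apply h2
  linear_combination key' + (CharTwo.two_eq_zero (R := ZMod 2)) * (S.passing d.tgt : ZMod 2) +
    (CharTwo.two_eq_zero (R := ZMod 2)) * (1 + ({w | G.Adj d.tgt w ∧ S.X w < S.X d.tgt ∧ S.slope d.tgt w < S.slope d.tgt d.src}.ncard : ZMod 2) + ({e : S.RightDart | e.tgt ∈ S.upper d}.ncard : ZMod 2))

/-- The number of edges over a vertex and to its left has the parity of the sum of the degrees of the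
vertices to the left. -/
theorem passing_parity (v : V)
    (hv : ∀ e : S.RightDart, S.X e.src < S.X v → S.X v < S.X e.tgt → S.Y v < e.height (S.X v)) :
    (S.passing v + {w | G.Adj v w ∧ S.X w < S.X v}.ncard : ZMod 2) =
      ((∑ᶠ u ∈ {u | S.X u < S.X v}, (G.neighborSet u).ncard : ℕ) : ZMod 2) := by
  rw [← ncard_src_mem_add_ncard_tgt_mem]
  -- An edge starting to the left of `v` passes over `v`, ends at `v`, or ends to the left; `hv`
  -- guarantees that `passing` misses none of the first kind. Edges of the last kind occur a second
  -- time in the degree sum and cancel modulo two.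
  have h1 : {e : S.RightDart | e.src ∈ {u | S.X u < S.X v}}.ncard =
      (S.passing v + {w | G.Adj v w ∧ S.X w < S.X v}.ncard) +
        {e : S.RightDart | e.tgt ∈ {u | S.X u < S.X v}}.ncard := by
    have h2 : {w | G.Adj v w ∧ S.X w < S.X v}.ncard = {e : S.RightDart | e.tgt ∈ ({v} : Set V)}.ncard := by
      rw [ncard_tgt_mem, finsum_mem_singleton]
    rw [h2, passing, ← Set.ncard_union_eq _ (Set.toFinite _) (Set.toFinite _),
      ← Set.ncard_union_eq _ (Set.toFinite _) (Set.toFinite _)]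
    · congr 1
      ext e
      simp only [Set.mem_ofPred_eq, Set.mem_union, Set.mem_singleton_iff]
      constructor
      · intro h
        rcases lt_trichotomy (S.X e.tgt) (S.X v) with h3 | h3 | h3
        · exact Or.inr h3
        · exact Or.inl (Or.inr (S.X_injective h3))
        · exact Or.inl (Or.inl ⟨h, h3, hv e h h3⟩)
      · rintro ((h3 | rfl) | h3)
        · exact h3.1
        · exact e.lt
        · exact e.lt.trans h3
    · rw [Set.disjoint_left]
      rintro e (⟨_, h3, _⟩ | h3) h4
      · exact lt_asymm h3 h4
      · change e.tgt = v at h3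
        simp [h3] at h4
    · rw [Set.disjoint_left]
      rintro e ⟨_, h3, _⟩ h4
      change e.tgt = v at h4
      simp [h4] at h3
  rw [h1]
  push_cast
  have e2 : ∀ x : ZMod 2, x + x = 0 := by decide
  rw [add_assoc, e2, add_zero]

end Counting

end SweepDrawing

/-! ### Behaviour of the orientation at end points, bends and crossings. -/

namespace SweepDrawing

variable {V : Type} {G : SimpleGraph V} (S : SweepDrawing G)

theorem ncard_setOf_eq_zero {p : V → Prop} (h : ∀ w, ¬ p w) : {w | p w}.ncard = 0 := by
  rw [show {w | p w} = ∅ from Set.eq_empty_iff_forall_notMem.2 h, Set.ncard_empty]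

theorem orient_of_lt {v u : V} (h : S.X v < S.X u) {k : ℕ}
    (hk : {w | G.Adj v w ∧ S.X v < S.X w ∧ S.slope v u < S.slope v w}.ncard = k) :
    S.orient v u = S.passing v + k := by
  rw [orient, if_pos h, hk]

theorem orient_of_gt {v u : V} (h : S.X u < S.X v) {k : ℕ}
    (hk : {w | G.Adj v w ∧ S.X w < S.X v ∧ S.slope v w < S.slope v u}.ncard = k) :
    S.orient v u = 1 + S.passing v + k := by
  rw [orient, if_neg h.not_gt, hk]

theorem orient_of_neighborSet_eq_singleton {v u : V} (h : G.neighborSet v = {u}) :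
    S.orient v u = S.passing v + {w | G.Adj v w ∧ S.X w < S.X v}.ncard := by
  have hadj : ∀ w, G.Adj v w ↔ w = u := fun w => by
    rw [← SimpleGraph.mem_neighborSet, h, Set.mem_singleton_iff]
  have hu : G.Adj v u := (hadj u).2 rfl
  rcases lt_or_gt_of_ne (S.X_injective.ne hu.ne) with hlt | hlt
  · rw [S.orient_of_lt hlt (k := 0), show {w | G.Adj v w ∧ S.X w < S.X v} = ∅ from ?_]
    · simp
    · ext w
      simp only [hadj, Set.mem_ofPred_eq, Set.mem_empty_iff_false, iff_false]
      rintro ⟨rfl, h'⟩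
      exact lt_asymm h' hlt
    · rw [show {w | G.Adj v w ∧ S.X v < S.X w ∧ S.slope v u < S.slope v w} = ∅ from ?_]
      · simp
      ext w
      simp only [hadj, Set.mem_ofPred_eq, Set.mem_empty_iff_false, iff_false]
      rintro ⟨rfl, _, h⟩
      exact lt_irrefl _ h
  · rw [S.orient_of_gt hlt (k := 0), show {w | G.Adj v w ∧ S.X w < S.X v} = {u} from ?_]
    · simp [add_comm]
    · ext w
      simp only [hadj, Set.mem_ofPred_eq, Set.mem_singleton_iff, and_iff_left_iff_imp]
      rintro rfl
      exact hlt
    · rw [show {w | G.Adj v w ∧ S.X w < S.X v ∧ S.slope v w < S.slope v u} = ∅ from ?_]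
      · simp
      ext w
      simp only [hadj, Set.mem_ofPred_eq, Set.mem_empty_iff_false, iff_false]
      rintro ⟨rfl, _, h⟩
      exact lt_irrefl _ h

/-- At a vertex of degree two, one edge arrives and the other one leaves. -/
theorem orient_of_neighborSet_eq_pair {v a b : V} (hab : a ≠ b) (h : G.neighborSet v = {a, b}) :
    S.orient v b = S.orient v a + 1 := by
  have hadj : ∀ w, G.Adj v w ↔ w = a ∨ w = b := fun w => by
    rw [← SimpleGraph.mem_neighborSet, h, Set.mem_insert_iff, Set.mem_singleton_iff]
  have ha : G.Adj v a := (hadj a).2 (Or.inl rfl)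
  have hb : G.Adj v b := (hadj b).2 (Or.inr rfl)
  clear h
  have h2 : ∀ t : ZMod 2, t + 1 + 1 = t := by decide
  -- The claim is symmetric in `a` and `b`. Two edges on the same side of `v` differ by one in the
  -- number of edges above them; on opposite sides these numbers agree and only the horizontal
  -- direction changes.
  wlog hX : S.X a < S.X b generalizing a b
  · have := this hab.symm (fun w => (hadj w).trans or_comm) hb ha
      (lt_of_le_of_ne (not_lt.1 hX) (S.X_injective.ne hab.symm))
    rw [this, h2]
  rcases lt_or_gt_of_ne (S.X_injective.ne ha.ne) with hva | hva
  · have hvb := hva.trans hX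
    have hne := S.slope_ne ha hb hab (Or.inl ⟨hva, hvb⟩)
    rcases lt_or_gt_of_ne hne with hs | hs
    · rw [S.orient_of_lt hva (k := 1), S.orient_of_lt hvb (k := 0)]
      · push_cast; rw [add_zero, h2]
      · refine ncard_setOf_eq_zero ?_
        rintro w ⟨h1, -, h3⟩
        rcases (hadj w).1 h1 with rfl | rfl <;> linarith
      · rw [Set.ncard_eq_one]
        refine ⟨b, Set.ext fun w => ⟨?_, ?_⟩⟩
        · rintro ⟨h1, -, h3⟩
          rcases (hadj w).1 h1 with rfl | rfl
          · exact absurd h3 (lt_irrefl _)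
          · rfl
        · rintro rfl
          exact ⟨hb, hvb, hs⟩
    · rw [S.orient_of_lt hva (k := 0), S.orient_of_lt hvb (k := 1)]
      · push_cast; rw [add_zero]
      · rw [Set.ncard_eq_one]
        refine ⟨a, Set.ext fun w => ⟨?_, ?_⟩⟩
        · rintro ⟨h1, -, h3⟩
          rcases (hadj w).1 h1 with rfl | rfl
          · rfl
          · exact absurd h3 (lt_irrefl _)
        · rintro rfl
          exact ⟨ha, hva, hs⟩
      · refine ncard_setOf_eq_zero ?_
        rintro w ⟨h1, -, h3⟩
        rcases (hadj w).1 h1 with rfl | rfl <;> linarith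
  · rcases lt_or_gt_of_ne (S.X_injective.ne hb.ne) with hvb | hvb
    · rw [S.orient_of_gt hva (k := 0), S.orient_of_lt hvb (k := 0)]
      · push_cast; rw [add_zero, add_zero, add_comm 1, h2]
      · refine ncard_setOf_eq_zero ?_
        rintro w ⟨h1, h2, h3⟩
        rcases (hadj w).1 h1 with rfl | rfl <;> linarith
      · refine ncard_setOf_eq_zero ?_
        rintro w ⟨h1, h2, h3⟩
        rcases (hadj w).1 h1 with rfl | rfl <;> linarith
    · have hne := S.slope_ne ha hb hab (Or.inr ⟨hva, hvb⟩)
      rcases lt_or_gt_of_ne hne with hs | hs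
      · rw [S.orient_of_gt hva (k := 0), S.orient_of_gt hvb (k := 1)]
        · push_cast; rw [add_zero]
        · rw [Set.ncard_eq_one]
          refine ⟨a, Set.ext fun w => ⟨?_, ?_⟩⟩
          · rintro ⟨h1, -, h3⟩
            rcases (hadj w).1 h1 with rfl | rfl
            · rfl
            · exact absurd h3 (lt_irrefl _)
          · rintro rfl
            exact ⟨ha, hva, hs⟩
        · refine ncard_setOf_eq_zero ?_
          rintro w ⟨h1, -, h3⟩
          rcases (hadj w).1 h1 with rfl | rfl <;> linarith
      · rw [S.orient_of_gt hva (k := 1), S.orient_of_gt hvb (k := 0)]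
        · push_cast; rw [add_zero, h2]
        · refine ncard_setOf_eq_zero ?_
          rintro w ⟨h1, -, h3⟩
          rcases (hadj w).1 h1 with rfl | rfl <;> linarith
        · rw [Set.ncard_eq_one]
          refine ⟨b, Set.ext fun w => ⟨?_, ?_⟩⟩
          · rintro ⟨h1, -, h3⟩
            rcases (hadj w).1 h1 with rfl | rfl
            · exact absurd h3 (lt_irrefl _)
            · rfl
          · rintro rfl
            exact ⟨hb, hvb, hs⟩

/-- Of two lines through `v`, the one of larger slope is the upper one on the right and the lower
one on the left. Passing to the opposite end of a line thus changes the number of edges above by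
one, and the change of horizontal direction cancels this. -/
theorem orient_of_cross {v a a' b b' : V}
    (hadj : ∀ w, G.Adj v w ↔ w = a ∨ w = a' ∨ w = b ∨ w = b')
    (ha : S.X v < S.X a) (ha' : S.X a' < S.X v) (hb : S.X v < S.X b) (hb' : S.X b' < S.X v)
    (hsa : S.slope v a = S.slope v a') (hsb : S.slope v b = S.slope v b')
    (hab : S.slope v a ≠ S.slope v b) :
    S.orient v a' = S.orient v a ∧ S.orient v b = S.orient v a + 1 ∧
      S.orient v b' = S.orient v a + 1 := by
  have h2 : ∀ t : ZMod 2, t + 1 + 1 = t := by decide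
  wlog hs : S.slope v a < S.slope v b generalizing a a' b b'
  · obtain ⟨h3, h4, h5⟩ := this (fun w => (hadj w).trans (by tauto)) hb hb' ha ha' hsb hsa hab.symm
      (lt_of_le_of_ne (not_lt.1 hs) hab.symm)
    rw [h3, h4, h5, h2]
    exact ⟨rfl, rfl, rfl⟩
  rw [S.orient_of_lt ha (k := 1), S.orient_of_lt hb (k := 0), S.orient_of_gt ha' (k := 0),
    S.orient_of_gt hb' (k := 1)]
  · push_cast
    refine ⟨?_, ?_, ?_⟩ <;> generalize (S.passing v : ZMod 2) = t <;> revert t <;> decide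
  · rw [Set.ncard_eq_one]
    refine ⟨a', Set.ext fun w => ⟨?_, ?_⟩⟩
    · rintro ⟨h1, h3, h4⟩
      rcases (hadj w).1 h1 with rfl | rfl | rfl | rfl
      · exact absurd h3 ha.not_gt
      · rfl
      · exact absurd h3 hb.not_gt
      · exact absurd h4 (lt_irrefl _)
    · rintro rfl
      exact ⟨(hadj _).2 (by simp), ha', by rwa [← hsa, ← hsb]⟩
  · refine ncard_setOf_eq_zero ?_
    rintro w ⟨h1, h3, h4⟩
    rcases (hadj w).1 h1 with rfl | rfl | rfl | rfl <;> linarith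
  · refine ncard_setOf_eq_zero ?_
    rintro w ⟨h1, h3, h4⟩
    rcases (hadj w).1 h1 with rfl | rfl | rfl | rfl <;> linarith
  · rw [Set.ncard_eq_one]
    refine ⟨b, Set.ext fun w => ⟨?_, ?_⟩⟩
    · rintro ⟨h1, h3, h4⟩
      rcases (hadj w).1 h1 with rfl | rfl | rfl | rfl
      · exact absurd h4 (lt_irrefl _)
      · exact absurd h3 ha'.not_gt
      · rfl
      · exact absurd h3 hb'.not_gt
    · rintro rfl
      exact ⟨(hadj _).2 (by simp), hb, hs⟩

/-- At a straight crossing, opposite edges both arrive or both leave, and adjacent ones do not. -/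
theorem orient_crossing {v : V} {n : Fin 4 → V} (h : G.neighborSet v = Set.range n)
    (h02 : (S.X v < S.X (n 0) ∧ S.X (n 2) < S.X v) ∨ (S.X (n 0) < S.X v ∧ S.X v < S.X (n 2)))
    (h13 : (S.X v < S.X (n 1) ∧ S.X (n 3) < S.X v) ∨ (S.X (n 1) < S.X v ∧ S.X v < S.X (n 3)))
    (hs02 : S.slope v (n 0) = S.slope v (n 2)) (hs13 : S.slope v (n 1) = S.slope v (n 3))
    (hne : S.slope v (n 0) ≠ S.slope v (n 1)) (i : Fin 4) :
    S.orient v (n (i + 1)) = S.orient v (n i) + 1 := by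
  have hadj : ∀ w, G.Adj v w ↔ w = n 0 ∨ w = n 2 ∨ w = n 1 ∨ w = n 3 := fun w => by
    rw [← SimpleGraph.mem_neighborSet, h, Set.mem_range]
    simp only [Fin.exists_fin_succ, eq_comm (b := w)]
    simp
    tauto
  have key : S.orient v (n 2) = S.orient v (n 0) ∧ S.orient v (n 1) = S.orient v (n 0) + 1 ∧
      S.orient v (n 3) = S.orient v (n 0) + 1 := by
    rcases h02 with h02 | h02 <;> rcases h13 with h13 | h13
    · exact S.orient_of_cross hadj h02.1 h02.2 h13.1 h13.2 hs02 hs13 hne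
    · obtain ⟨h3, h4, h5⟩ := S.orient_of_cross (a := n 0) (a' := n 2) (b := n 3) (b' := n 1)
        (fun w => (hadj w).trans (by tauto)) h02.1 h02.2 h13.2 h13.1 hs02 hs13.symm (hs13 ▸ hne)
      exact ⟨h3, h5, h4⟩
    · obtain ⟨h3, h4, h5⟩ := S.orient_of_cross (a := n 2) (a' := n 0) (b := n 1) (b' := n 3)
        (fun w => (hadj w).trans (by tauto)) h02.2 h02.1 h13.1 h13.2 hs02.symm hs13 (hs02 ▸ hne)
      rw [h3, h4, h5]
      exact ⟨rfl, rfl, rfl⟩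
    · obtain ⟨h3, h4, h5⟩ := S.orient_of_cross (a := n 2) (a' := n 0) (b := n 3) (b' := n 1)
        (fun w => (hadj w).trans (by tauto)) h02.2 h02.1 h13.2 h13.1 hs02.symm hs13.symm
        (by rw [← hs02, ← hs13]; exact hne)
      rw [h3, h4, h5]
      exact ⟨rfl, rfl, rfl⟩
  obtain ⟨h3, h4, h5⟩ := key
  have h2 : ∀ t : ZMod 2, t + 1 + 1 = t := by decide
  fin_cases i
  · exact h4
  · change S.orient v (n 2) = S.orient v (n 1) + 1
    rw [h3, h4, h2]
  · change S.orient v (n 3) = S.orient v (n 2) + 1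
    rw [h3, h5]
  · change S.orient v (n 0) = S.orient v (n 3) + 1
    rw [h5, h2]

end SweepDrawing

/-! ### General position and elementary geometry of tangle diagrams. -/

instance : Fintype Corner where
  elems := {.NW, .NE, .SW, .SE}
  complete p := by cases p <;> decide

/-- The sum of a function over the four corners. -/
theorem Corner.sum_eq {M : Type*} [AddCommMonoid M] (f : Corner → M) :
    ∑ p, f p = f .NW + (f .NE + (f .SW + f .SE)) := by
  change Finset.sum {Corner.NW, .NE, .SW, .SE} f = _
  rw [Finset.sum_insert (by decide), Finset.sum_insert (by decide), Finset.sum_insert (by decide),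
    Finset.sum_singleton]

instance {W K : Type} [Finite W] [Finite K] : Finite (TangleVertex W K) := by
  let f : TangleVertex W K → Corner ⊕ W ⊕ K := fun
    | .endpoint p => .inl p
    | .bend w => .inr (.inl w)
    | .crossing c => .inr (.inr c)
  refine Finite.of_injective f ?_
  rintro (_ | _ | _) (_ | _ | _) h <;> simp_all [f]

/-- Points of a finite planar configuration are separated by almost every linear functional. -/
theorem exists_injective_functional {V : Type*} [Finite V] {pos : V → ℝ × ℝ}
    (hpos : Function.Injective pos) :
    ∃ ε : ℝ, 0 < ε ∧ ε < 1 ∧ Function.Injective fun v => (pos v).1 + ε * (pos v).2 := by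
  let bad : Set ℝ := ⋃ u : V, ⋃ v : V, {ε | u ≠ v ∧ (pos u).1 + ε * (pos u).2 = (pos v).1 + ε * (pos v).2}
  have hbad : bad.Finite := by
    refine Set.finite_iUnion fun u => Set.finite_iUnion fun v => Set.Subsingleton.finite ?_
    -- Two points are aligned for at most one `ε`: two such values would force equal second
    -- coordinates, then equal first ones.
    rintro ε ⟨hne, h⟩ ε' ⟨_, h'⟩
    have h3 : (ε - ε') * ((pos u).2 - (pos v).2) = 0 := by linear_combination h - h'
    rcases mul_eq_zero.1 h3 with h4 | h4
    · linarith
    · have h5 : (pos u).2 = (pos v).2 := by linarith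
      exact absurd (hpos (Prod.ext (by rw [h5] at h; linarith) h5)) hne
  obtain ⟨ε, hε, hn⟩ := (Set.Ioo_infinite (zero_lt_one' ℝ)).exists_notMem_finite hbad
  refine ⟨ε, hε.1, hε.2, fun u v h => ?_⟩
  by_contra hne
  exact hn (Set.mem_iUnion.2 ⟨u, Set.mem_iUnion.2 ⟨v, hne, h⟩⟩)

/-- A point of a segment is determined by a coordinate that separates the ends. -/
theorem mem_segment_of_coord {ε : ℝ} {p q : ℝ × ℝ} (hlt : p.1 + ε * p.2 < q.1 + ε * q.2) {x h : ℝ}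
    (h1 : p.1 + ε * p.2 ≤ x) (h2 : x ≤ q.1 + ε * q.2)
    (hh : h = p.2 + (q.2 - p.2) / ((q.1 + ε * q.2) - (p.1 + ε * p.2)) * (x - (p.1 + ε * p.2))) :
    (x - ε * h, h) ∈ segment ℝ p q := by
  have hpos : 0 < (q.1 + ε * q.2) - (p.1 + ε * p.2) := by linarith
  refine ⟨1 - (x - (p.1 + ε * p.2)) / ((q.1 + ε * q.2) - (p.1 + ε * p.2)),
    (x - (p.1 + ε * p.2)) / ((q.1 + ε * q.2) - (p.1 + ε * p.2)), ?_, ?_, by ring, ?_⟩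
  · rw [sub_nonneg, div_le_one hpos]
    linarith
  · exact div_nonneg (by linarith) hpos.le
  · rw [hh]
    ext
    · simp
      field_simp
      ring
    · simp
      field_simp
      ring

namespace BallTangleDiagram

variable (D : BallTangleDiagram)

theorem normSq_pos_le (v : TangleVertex D.W D.K) : (D.pos v).1 ^ 2 + (D.pos v).2 ^ 2 ≤ 2 := by
  rcases v with p | w | c
  · rw [D.pos_endpoint]
    cases p <;> norm_num [Corner.pos]
  · exact (D.pos_bend w).le
  · exact (D.pos_crossing c).le

theorem normSq_le_of_mem_segment {p q x : ℝ × ℝ} (hp : p.1 ^ 2 + p.2 ^ 2 ≤ 2)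
    (hq : q.1 ^ 2 + q.2 ^ 2 ≤ 2) (hx : x ∈ segment ℝ p q) : x.1 ^ 2 + x.2 ^ 2 ≤ 2 := by
  obtain ⟨a, b, ha, hb, hab, rfl⟩ := hx
  obtain rfl : a = 1 - b := by linarith
  simp
  nlinarith [mul_nonneg (mul_nonneg ha hb) (add_nonneg (sq_nonneg (p.1 - q.1)) (sq_nonneg (p.2 - q.2))),
    mul_le_mul_of_nonneg_left hp ha, mul_le_mul_of_nonneg_left hq hb]

/-- By `counterclockwise` the directions to the neighbours 0 and 1 are linearly independent, and
straightness makes those to 2 and 3 negative multiples of them, so the four directions are distinct.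
-/
theorem nbr_injective (c : D.K) : Function.Injective (D.nbr c) := by
  have hcc := D.counterclockwise c
  obtain ⟨a, b, ha, hb, hab, h02⟩ := D.over_straight c
  obtain ⟨a', b', ha', hb', hab', h13⟩ := D.under_straight c
  have e1 := congrArg Prod.fst h02
  have e2 := congrArg Prod.snd h02
  have e3 := congrArg Prod.fst h13
  have e4 := congrArg Prod.snd h13
  simp at e1 e2 e3 e4
  have f1 : a * ((D.pos (D.nbr c 0)).1 - (D.pos (.crossing c)).1) = -b * ((D.pos (D.nbr c 2)).1 - (D.pos (.crossing c)).1) := by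
    obtain rfl : a = 1 - b := by linarith
    linear_combination e1
  have f2 : a * ((D.pos (D.nbr c 0)).2 - (D.pos (.crossing c)).2) = -b * ((D.pos (D.nbr c 2)).2 - (D.pos (.crossing c)).2) := by
    obtain rfl : a = 1 - b := by linarith
    linear_combination e2
  have f3 : a' * ((D.pos (D.nbr c 1)).1 - (D.pos (.crossing c)).1) = -b' * ((D.pos (D.nbr c 3)).1 - (D.pos (.crossing c)).1) := by
    obtain rfl : a' = 1 - b' := by linarith
    linear_combination e3
  have f4 : a' * ((D.pos (D.nbr c 1)).2 - (D.pos (.crossing c)).2) = -b' * ((D.pos (D.nbr c 3)).2 - (D.pos (.crossing c)).2) := by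
    obtain rfl : a' = 1 - b' := by linarith
    linear_combination e4
  have n01 : D.nbr c 0 ≠ D.nbr c 1 := by
    intro h; rw [h] at hcc; nlinarith
  have n02 : D.nbr c 0 ≠ D.nbr c 2 := by
    intro h; rw [h] at hcc f1 f2
    have g1 : (a + b) * ((D.pos (D.nbr c 2)).1 - (D.pos (.crossing c)).1) = 0 := by linear_combination f1
    have g2 : (a + b) * ((D.pos (D.nbr c 2)).2 - (D.pos (.crossing c)).2) = 0 := by linear_combination f2
    rw [hab, one_mul] at g1 g2
    rw [g1, g2] at hcc
    simp at hcc
  have n13 : D.nbr c 1 ≠ D.nbr c 3 := by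
    intro h; rw [h] at hcc f3 f4
    have g1 : (a' + b') * ((D.pos (D.nbr c 3)).1 - (D.pos (.crossing c)).1) = 0 := by linear_combination f3
    have g2 : (a' + b') * ((D.pos (D.nbr c 3)).2 - (D.pos (.crossing c)).2) = 0 := by linear_combination f4
    rw [hab', one_mul] at g1 g2
    rw [g1, g2] at hcc
    simp at hcc
  have n03 : D.nbr c 0 ≠ D.nbr c 3 := by
    intro h; rw [h] at hcc
    have : a' * 0 < a' * _ := mul_lt_mul_of_pos_left hcc ha'
    apply this.ne
    linear_combination (-((D.pos (D.nbr c 3)).1 - (D.pos (.crossing c)).1)) * f4 + ((D.pos (D.nbr c 3)).2 - (D.pos (.crossing c)).2) * f3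
  have n12 : D.nbr c 1 ≠ D.nbr c 2 := by
    intro h; rw [h] at hcc
    have : a * 0 < a * _ := mul_lt_mul_of_pos_left hcc ha
    apply this.ne
    linear_combination (-((D.pos (D.nbr c 2)).2 - (D.pos (.crossing c)).2)) * f1 + ((D.pos (D.nbr c 2)).1 - (D.pos (.crossing c)).1) * f2
  have n23 : D.nbr c 2 ≠ D.nbr c 3 := by
    intro h; rw [h] at f1 f2
    have : (a * a') * 0 < (a * a') * _ := mul_lt_mul_of_pos_left hcc (mul_pos ha ha')
    apply this.ne
    linear_combination (-a' * ((D.pos (D.nbr c 1)).2 - (D.pos (.crossing c)).2)) * f1 +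
      a' * ((D.pos (D.nbr c 1)).1 - (D.pos (.crossing c)).1) * f2 +
      b * ((D.pos (D.nbr c 3)).1 - (D.pos (.crossing c)).1) * f4 * (-1) * (-1) +
      (-b) * ((D.pos (D.nbr c 3)).2 - (D.pos (.crossing c)).2) * f3
  intro i j hij
  fin_cases i <;> fin_cases j <;> first | rfl | (exfalso; revert hij; first | exact n01 | exact n02 | exact n03 | exact n12 | exact n13 | exact n23 | exact n01.symm | exact n02.symm | exact n03.symm | exact n12.symm | exact n13.symm | exact n23.symm)

end BallTangleDiagram

/-! ### The source-sink orientation of a tangle diagram. -/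

/-- The alternating orientation of the four end points. -/
def Corner.orientation : Corner → ZMod 2
  | .NW => 1
  | .NE => 0
  | .SW => 0
  | .SE => 1

namespace BallTangleDiagram

variable (D : BallTangleDiagram)

/-- A diagram, seen along a direction in which no two vertices are aligned. -/
noncomputable def sweep {ε : ℝ} (hinj : Function.Injective fun v => (D.pos v).1 + ε * (D.pos v).2) :
    SweepDrawing D.G where
  X v := (D.pos v).1 + ε * (D.pos v).2
  Y v := (D.pos v).2
  X_injective := hinj
  planar := by
    intro a b a' b' hab hab' hlt hlt' hne x h1 h2 h1' h2' hh
    have hs : s(a, b) ≠ s(a', b') := by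
      rw [Ne, Sym2.eq_iff]
      rintro (h | ⟨rfl, rfl⟩)
      · exact hne h
      · exact lt_asymm hlt hlt'
    obtain ⟨y, hy1, hy2, hy⟩ := D.edges_disjoint a b a' b' hab hab' hs _
      ⟨mem_segment_of_coord hlt h1 h2 rfl, mem_segment_of_coord hlt' h1' h2' hh⟩
    refine ⟨y, Sym2.mem_iff.1 hy1, Sym2.mem_iff.1 hy2, ?_⟩
    rw [← hy]
    ring

/-- The sum of the degrees of a set of vertices has the parity of the number of its end points. -/
theorem sum_degree (U : Set (TangleVertex D.W D.K)) :
    ((∑ᶠ v ∈ U, (D.G.neighborSet v).ncard : ℕ) : ZMod 2) =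
      open Classical in ∑ p : Corner, if TangleVertex.endpoint p ∈ U then 1 else 0 := by
  classical
  have := D.finiteW
  have hev : ∀ v ∈ U, ((D.G.neighborSet v).ncard : ZMod 2) ≠ 0 → ∃ p, v = .endpoint p := by
    rintro (p | w | c) _ h
    · exact ⟨p, rfl⟩
    · rw [D.degree_bend] at h
      exact absurd (by decide) h
    · rw [D.neighbors_crossing, ← Set.image_univ, Set.ncard_image_of_injective _ (D.nbr_injective c),
        Set.ncard_univ, Nat.card_eq_fintype_card] at h
      exact absurd (by decide) h
  have := Fintype.ofFinite (TangleVertex D.W D.K)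
  rw [finsum_mem_eq_toFinset_sum, Nat.cast_sum, ← Finset.sum_filter, Finset.sum_const, nsmul_one]
  have h1 : ∑ v ∈ U.toFinset, ((D.G.neighborSet v).ncard : ZMod 2) =
      ∑ v ∈ (Finset.univ.filter fun p : Corner => TangleVertex.endpoint p ∈ U).image
        (TangleVertex.endpoint : Corner → TangleVertex D.W D.K), ((D.G.neighborSet v).ncard : ZMod 2) := by
    symm
    refine Finset.sum_subset ?_ ?_
    · intro v hv
      obtain ⟨p, hp, rfl⟩ := Finset.mem_image.1 hv
      simpa using hp
    · intro v hv hv'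
      by_contra h
      obtain ⟨p, rfl⟩ := hev v (by simpa using hv) h
      exact hv' (Finset.mem_image_of_mem _ (by simpa using hv))
  rw [h1, Finset.sum_image fun a _ b _ h => by simpa using h]
  simp [D.degree_endpoint]

section Orientation

variable {ε : ℝ} (hinj : Function.Injective fun v => (D.pos v).1 + ε * (D.pos v).2)

theorem sweep_X_endpoint (p : Corner) :
    (D.sweep hinj).X (.endpoint p) = p.pos.1 + ε * p.pos.2 := by
  simp [sweep, D.pos_endpoint]

theorem sweep_Y_endpoint (p : Corner) : (D.sweep hinj).Y (.endpoint p) = p.pos.2 := by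
  simp [sweep, D.pos_endpoint]

theorem exists_neighborSet_endpoint (p : Corner) :
    ∃ u, D.G.neighborSet (.endpoint p) = {u} :=
  Set.ncard_eq_one.1 (D.degree_endpoint p)

theorem height_ne_endpoint (p : Corner) (d : (D.sweep hinj).RightDart)
    (h1 : (D.sweep hinj).X d.src < (D.sweep hinj).X (.endpoint p))
    (h2 : (D.sweep hinj).X (.endpoint p) < (D.sweep hinj).X d.tgt) :
    d.height ((D.sweep hinj).X (.endpoint p)) ≠ p.pos.2 := by
  obtain ⟨u, hu⟩ := D.exists_neighborSet_endpoint p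
  rw [← D.sweep_Y_endpoint hinj]
  exact (D.sweep hinj).height_ne d (show u ∈ D.G.neighborSet (.endpoint p) by rw [hu]; rfl) h1 h2

theorem height_normSq_le (d : (D.sweep hinj).RightDart) {x : ℝ}
    (h1 : (D.sweep hinj).X d.src < x) (h2 : x < (D.sweep hinj).X d.tgt) :
    (x - ε * d.height x) ^ 2 + d.height x ^ 2 ≤ 2 :=
  normSq_le_of_mem_segment (D.normSq_pos_le _) (D.normSq_pos_le _)
    (mem_segment_of_coord d.lt h1.le h2.le rfl)

/-- No edge passes above an upper end point. -/
theorem height_lt_of_upper (hε : 0 < ε) (hε1 : ε < 1) {p : Corner} (hp : p = .NW ∨ p = .NE)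
    (d : (D.sweep hinj).RightDart) (h1 : (D.sweep hinj).X d.src < (D.sweep hinj).X (.endpoint p))
    (h2 : (D.sweep hinj).X (.endpoint p) < (D.sweep hinj).X d.tgt) :
    d.height ((D.sweep hinj).X (.endpoint p)) < (D.sweep hinj).Y (.endpoint p) := by
  have hne := D.height_ne_endpoint hinj p d h1 h2
  have hle := D.height_normSq_le hinj d h1 h2
  rw [D.sweep_X_endpoint] at hne hle ⊢
  rw [D.sweep_Y_endpoint]
  refine lt_of_le_of_ne ?_ hne
  by_contra! hlt
  generalize d.height (p.pos.1 + ε * p.pos.2) = h at *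
  -- With k = h - 1 > 0, the point (x - εh, h) of the sweep line has squared norm 2 + 2(1 ± ε)k + (1
  -- + ε²)k², the sign being plus at NW and minus at NE. It exceeds 2 because ε < 1, so the point
  -- lies outside the disc.
  rcases hp with rfl | rfl
  · simp only [Corner.pos] at *
    nlinarith [mul_pos hε (sub_pos.2 hlt), sq_nonneg (ε * (h - 1)), sq_nonneg (h - 1)]
  · simp only [Corner.pos] at *
    nlinarith [mul_pos (sub_pos.2 hε1) (sub_pos.2 hlt), sq_nonneg (ε * (h - 1)), sq_nonneg (h - 1)]

/-- No edge passes below a lower end point. -/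
theorem lt_height_of_lower (hε : 0 < ε) (hε1 : ε < 1) {p : Corner} (hp : p = .SW ∨ p = .SE)
    (d : (D.sweep hinj).RightDart) (h1 : (D.sweep hinj).X d.src < (D.sweep hinj).X (.endpoint p))
    (h2 : (D.sweep hinj).X (.endpoint p) < (D.sweep hinj).X d.tgt) :
    (D.sweep hinj).Y (.endpoint p) < d.height ((D.sweep hinj).X (.endpoint p)) := by
  have hne := D.height_ne_endpoint hinj p d h1 h2
  have hle := D.height_normSq_le hinj d h1 h2
  rw [D.sweep_X_endpoint] at hne hle ⊢
  rw [D.sweep_Y_endpoint]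
  refine lt_of_le_of_ne ?_ hne.symm
  by_contra! hlt
  generalize d.height (p.pos.1 + ε * p.pos.2) = h at *
  rcases hp with rfl | rfl
  · simp only [Corner.pos] at *
    nlinarith [mul_pos (sub_pos.2 hε1) (sub_pos.2 hlt), sq_nonneg (ε * (h + 1)), sq_nonneg (h + 1)]
  · simp only [Corner.pos] at *
    nlinarith [mul_pos hε (sub_pos.2 hlt), sq_nonneg (ε * (h + 1)), sq_nonneg (h + 1)]

/-- The contribution of the upper closing arc of the numerator closure to the orientation of the edge
from `v` to `u`. -/
noncomputable def arcTerm (v u : TangleVertex D.W D.K) : ZMod 2 :=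
  open Classical in
  if (D.sweep hinj).X v < (D.sweep hinj).X u then
    -- Modulo two, the indicators test whether a point slightly displaced from `v` along the edge
    -- lies under the arc, which spans -1 + ε to 1 + ε. Hence `≤` for edges to the right and `<` for
    -- edges to the left.
    (if -1 + ε ≤ (D.sweep hinj).X v then 1 else 0) + (if 1 + ε ≤ (D.sweep hinj).X v then 1 else 0)
  else (if -1 + ε < (D.sweep hinj).X v then 1 else 0) + (if 1 + ε < (D.sweep hinj).X v then 1 else 0)

theorem arcTerm_eq {v : TangleVertex D.W D.K} (h1 : v ≠ .endpoint .NW) (h2 : v ≠ .endpoint .NE)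
    (u u' : TangleVertex D.W D.K) : D.arcTerm hinj v u = D.arcTerm hinj v u' := by
  have h3 : (D.sweep hinj).X v ≠ -1 + ε := fun h => h1 ((D.sweep hinj).X_injective
    (by rw [h, D.sweep_X_endpoint]; simp [Corner.pos]))
  have h4 : (D.sweep hinj).X v ≠ 1 + ε := fun h => h2 ((D.sweep hinj).X_injective
    (by rw [h, D.sweep_X_endpoint]; simp [Corner.pos]))
  have h5 : ∀ w, D.arcTerm hinj v w = (open Classical in
      (if -1 + ε < (D.sweep hinj).X v then 1 else 0) +
        (if 1 + ε < (D.sweep hinj).X v then 1 else 0)) := by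
    intro w
    simp only [arcTerm, le_iff_lt_or_eq, h3.symm, h4.symm, or_false, ite_self]
  rw [h5, h5]

/-- The defect in `orient_add_orient_swap` is the number of end points above `d`, since all other
degrees are even. The lower ones are never above an edge, and each upper one above `d` is matched by
a jump of `arcTerm` between the two ends. -/
theorem orient_symm_of_lt (hε : 0 < ε) (hε1 : ε < 1) (d : (D.sweep hinj).RightDart) :
    (D.sweep hinj).orient d.src d.tgt + D.arcTerm hinj d.src d.tgt +
      ((D.sweep hinj).orient d.tgt d.src + D.arcTerm hinj d.tgt d.src) = 1 := by
  classical
  have := D.finiteW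
  have h1 := (D.sweep hinj).orient_add_orient_swap d
  rw [D.sum_degree, Corner.sum_eq, arcTerm, arcTerm, if_pos d.lt, if_neg d.lt.not_gt] at *
  have hup : ∀ p : Corner, p = .NW ∨ p = .NE → (TangleVertex.endpoint p ∈ (D.sweep hinj).upper d ↔
      (D.sweep hinj).X d.src < p.pos.1 + ε * p.pos.2 ∧ p.pos.1 + ε * p.pos.2 < (D.sweep hinj).X d.tgt) := by
    intro p hp
    rw [← D.sweep_X_endpoint hinj]
    exact ⟨fun h => ⟨h.1, h.2.1⟩, fun h => ⟨h.1, h.2, D.height_lt_of_upper hinj hε hε1 hp d h.1 h.2⟩⟩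
  have hlow : ∀ p : Corner, p = .SW ∨ p = .SE → ¬ TangleVertex.endpoint p ∈ (D.sweep hinj).upper d :=
    fun p hp h => lt_asymm h.2.2 (D.lt_height_of_lower hinj hε hε1 hp d h.1 h.2.1)
  rw [if_neg (hlow .SW (.inl rfl)), if_neg (hlow .SE (.inr rfl))] at h1
  simp only [hup .NW (.inl rfl), hup .NE (.inr rfl), Corner.pos, mul_one] at h1
  have key : ∀ x l r : ℝ, l < r → (if l < x ∧ x < r then 1 else 0 : ZMod 2) =
      (if x ≤ l then 1 else 0) + (if x < r then 1 else 0) := by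
    intro x l r h
    rcases le_or_gt x l with h2 | h2
    · rw [if_neg (fun h => not_lt.2 h2 h.1), if_pos h2, if_pos (h2.trans_lt h)]; decide
    · by_cases h3 : x < r
      · rw [if_pos ⟨h2, h3⟩, if_neg (not_le.2 h2), if_pos h3]; decide
      · rw [if_neg (fun h => h3 h.2), if_neg (not_le.2 h2), if_neg h3]; decide
  rw [key _ _ _ d.lt, key _ _ _ d.lt] at h1
  have e2 : ∀ x : ZMod 2, x + x = 0 := by decide
  generalize (if -1 + ε ≤ (D.sweep hinj).X d.src then 1 else 0 : ZMod 2) = a1 at *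
  generalize (if 1 + ε ≤ (D.sweep hinj).X d.src then 1 else 0 : ZMod 2) = a2 at *
  generalize (if -1 + ε < (D.sweep hinj).X d.tgt then 1 else 0 : ZMod 2) = a3 at *
  generalize (if 1 + ε < (D.sweep hinj).X d.tgt then 1 else 0 : ZMod 2) = a4 at *
  linear_combination h1 + e2 a1 + e2 a2 + e2 a3 + e2 a4

theorem slope_eq_of_mem_openSegment {a v b : TangleVertex D.W D.K}
    (h : D.pos v ∈ openSegment ℝ (D.pos a) (D.pos b)) (hav : D.G.Adj v a) (hvb : D.G.Adj v b) :
    (((D.sweep hinj).X v < (D.sweep hinj).X a ∧ (D.sweep hinj).X b < (D.sweep hinj).X v) ∨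
      ((D.sweep hinj).X a < (D.sweep hinj).X v ∧ (D.sweep hinj).X v < (D.sweep hinj).X b)) ∧
    (D.sweep hinj).slope v a = (D.sweep hinj).slope v b := by
  obtain ⟨s, t, hs, ht, hst, h⟩ := h
  have e1 := congrArg Prod.fst h
  have e2 := congrArg Prod.snd h
  simp at e1 e2
  have n1 := (D.sweep hinj).X_injective.ne hav.ne
  have n2 := (D.sweep hinj).X_injective.ne hvb.ne
  obtain rfl : s = 1 - t := by linarith
  have f1 : (1 - t) * ((D.sweep hinj).X a - (D.sweep hinj).X v) =
      -t * ((D.sweep hinj).X b - (D.sweep hinj).X v) := by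
    simp only [sweep]
    linear_combination e1 + ε * e2
  have f2 : (1 - t) * ((D.sweep hinj).Y a - (D.sweep hinj).Y v) =
      -t * ((D.sweep hinj).Y b - (D.sweep hinj).Y v) := by
    simp only [sweep]
    linear_combination e2
  constructor
  · rcases lt_or_gt_of_ne n1 with h1 | h1
    · refine Or.inl ⟨h1, ?_⟩
      by_contra! h2
      nlinarith [mul_pos hs (sub_pos.2 h1), mul_nonneg ht.le (sub_nonneg.2 h2)]
    · refine Or.inr ⟨h1, ?_⟩
      by_contra! h2
      nlinarith [mul_pos hs (sub_pos.2 h1), mul_nonneg ht.le (sub_nonneg.2 h2)]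
  · unfold SweepDrawing.slope
    have m1 : (D.sweep hinj).X a - (D.sweep hinj).X v ≠ 0 := sub_ne_zero.2 n1.symm
    have m2 : (D.sweep hinj).X b - (D.sweep hinj).X v ≠ 0 := sub_ne_zero.2 n2.symm
    rw [div_eq_div_iff m1 m2]
    apply mul_left_cancel₀ (mul_ne_zero hs.ne' ht.ne')
    linear_combination (t * ((D.sweep hinj).X b - (D.sweep hinj).X v)) * f2 -
      t * ((D.sweep hinj).Y b - (D.sweep hinj).Y v) * f1

theorem adj_nbr (c : D.K) (i : Fin 4) : D.G.Adj (.crossing c) (D.nbr c i) := by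
  rw [← SimpleGraph.mem_neighborSet, D.neighbors_crossing]
  exact ⟨i, rfl⟩

open Classical in
theorem arcTerm_NW (u : TangleVertex D.W D.K) :
    D.arcTerm hinj (.endpoint .NW) u = if (D.sweep hinj).X (.endpoint .NW) < (D.sweep hinj).X u then 1 else 0 := by
  have hX := D.sweep_X_endpoint hinj .NW
  rw [arcTerm]
  simp only [Corner.pos] at hX
  split_ifs <;> first | rfl | (exfalso; linarith)

open Classical in
theorem arcTerm_NE (u : TangleVertex D.W D.K) :
    D.arcTerm hinj (.endpoint .NE) u = if (D.sweep hinj).X (.endpoint .NE) < (D.sweep hinj).X u then 0 else 1 := by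
  have hX := D.sweep_X_endpoint hinj .NE
  rw [arcTerm]
  simp only [Corner.pos] at hX
  split_ifs <;> first | rfl | (exfalso; linarith)

theorem arcTerm_SW (hε : 0 < ε) (hε1 : ε < 1) (u : TangleVertex D.W D.K) :
    D.arcTerm hinj (.endpoint .SW) u = 0 := by
  have hX := D.sweep_X_endpoint hinj .SW
  rw [arcTerm]
  simp only [Corner.pos] at hX
  split_ifs <;> first | rfl | (exfalso; linarith)

theorem arcTerm_SE (hε : 0 < ε) (hε1 : ε < 1) (u : TangleVertex D.W D.K) :
    D.arcTerm hinj (.endpoint .SE) u = 1 := by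
  have hX := D.sweep_X_endpoint hinj .SE
  rw [arcTerm]
  simp only [Corner.pos] at hX
  split_ifs <;> first | rfl | (exfalso; linarith)

/-- The orientations at the end points: the strands leave the disc at `NE`, `SW` and enter it at
`NW`, `SE`. -/
theorem orient_endpoint (hε : 0 < ε) (hε1 : ε < 1) (p : Corner) {u : TangleVertex D.W D.K}
    (hu : D.G.Adj (.endpoint p) u) :
    (D.sweep hinj).orient (.endpoint p) u + D.arcTerm hinj (.endpoint p) u =
      p.orientation := by
  classical
  have := D.finiteW
  obtain ⟨u', hu'⟩ := D.exists_neighborSet_endpoint p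
  obtain rfl : u = u' := by
    rw [← SimpleGraph.mem_neighborSet, hu'] at hu
    exact hu
  rw [(D.sweep hinj).orient_of_neighborSet_eq_singleton hu']
  have hadj : ∀ w, D.G.Adj (.endpoint p) w ↔ w = u := fun w => by
    rw [← SimpleGraph.mem_neighborSet, hu', Set.mem_singleton_iff]
  have hupper : p = .NW ∨ p = .NE → (D.sweep hinj).passing (.endpoint p) = 0 := fun hp =>
    SweepDrawing.ncard_setOf_eq_zero fun e he =>
      lt_asymm he.2.2 (D.height_lt_of_upper hinj hε hε1 hp e he.1 he.2.1)
  -- The parity is that of the number of end points to the left. As 0 < ε < 1, the sweep order is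
  -- SW, NW, SE, NE, so there are none to the left of SW and two to the left of SE.
  have hlower : p = .SW ∨ p = .SE → ((D.sweep hinj).passing (.endpoint p) +
      {w | D.G.Adj (.endpoint p) w ∧ (D.sweep hinj).X w < (D.sweep hinj).X (.endpoint p)}.ncard : ZMod 2) = 0 := by
    intro hp
    rw [(D.sweep hinj).passing_parity _ fun e h1 h2 => D.lt_height_of_lower hinj hε hε1 hp e h1 h2,
      D.sum_degree, Corner.sum_eq]
    simp only [Set.mem_ofPred_eq, D.sweep_X_endpoint]
    clear hupper hadj hu' hu
    rcases hp with rfl | rfl <;> split_ifs <;>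
      first | rfl | (exfalso; simp only [Corner.pos] at *; linarith)
  have hside : p = .NW ∨ p = .NE → (({w | D.G.Adj (.endpoint p) w ∧
      (D.sweep hinj).X w < (D.sweep hinj).X (.endpoint p)}.ncard : ZMod 2)) =
      if (D.sweep hinj).X (.endpoint p) < (D.sweep hinj).X u then 0 else 1 := by
    intro hp
    have hne := (D.sweep hinj).X_injective.ne hu.ne
    split_ifs with h
    · rw [SweepDrawing.ncard_setOf_eq_zero]
      · rfl
      · rintro w ⟨hw1, hw⟩
        rw [(hadj w).1 hw1] at hw
        exact lt_asymm h hw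
    · rw [Set.ncard_eq_one.2 ⟨u, Set.ext fun w => ⟨fun hw => (hadj w).1 hw.1, ?_⟩⟩]
      · rfl
      · rintro rfl
        exact ⟨hu, lt_of_le_of_ne (not_lt.1 h) hne.symm⟩
  clear hadj hu' hu
  cases p
  · rw [hupper (.inl rfl), hside (.inl rfl), D.arcTerm_NW]
    split_ifs <;> decide
  · rw [hupper (.inr rfl), hside (.inr rfl), D.arcTerm_NE]
    split_ifs <;> decide
  · rw [hlower (.inl rfl), D.arcTerm_SW hinj hε hε1]
    rfl
  · rw [hlower (.inr rfl), D.arcTerm_SE hinj hε hε1]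
    rfl

end Orientation

/-- A tangle diagram has a source-sink orientation of its edges, as obtained from a checkerboard
colouring of the regions: it is continuous at bends, alternates around crossings, and alternates
around the boundary circle. -/
theorem exists_orientation : ∃ s : D.G.Dart → ZMod 2,
    (∀ d, s d.symm = s d + 1) ∧
    (∀ w d e, d.fst = .bend w → e.fst = .bend w → d ≠ e → s e = s d + 1) ∧
    (∀ c d e i, d.fst = .crossing c → e.fst = .crossing c → d.snd = D.nbr c i →
      e.snd = D.nbr c (i + 1) → s e = s d + 1) ∧
    ∀ p d, d.fst = .endpoint p → s d = p.orientation := by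
  have := D.finiteW
  obtain ⟨ε, hε, hε1, hinj⟩ := exists_injective_functional D.pos_injective
  refine ⟨fun d => (D.sweep hinj).orient d.fst d.snd + D.arcTerm hinj d.fst d.snd, ?_, ?_, ?_, ?_⟩
  · intro d
    have key : ∀ x y : ZMod 2, x + y = 1 → y = x + 1 := by decide
    apply key
    rcases lt_or_gt_of_ne ((D.sweep hinj).X_injective.ne d.adj.ne) with h | h
    · exact D.orient_symm_of_lt hinj hε hε1 (.of d.adj h)
    · rw [add_comm]
      exact D.orient_symm_of_lt hinj hε hε1 (.of d.adj.symm h)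
  · intro w d e hd he hne
    obtain ⟨⟨v, a⟩, hva⟩ := d
    obtain ⟨⟨v', b⟩, hvb⟩ := e
    obtain rfl : v = .bend w := hd
    obtain rfl : v' = .bend w := he
    have hab : a ≠ b := by rintro rfl; exact hne rfl
    have hN : D.G.neighborSet (.bend w) = {a, b} := by
      symm
      apply Set.eq_of_subset_of_ncard_le
      · rintro x (rfl | rfl)
        exacts [hva, hvb]
      · rw [D.degree_bend, Set.ncard_pair hab]
      · exact Set.toFinite _
    change (D.sweep hinj).orient _ b + D.arcTerm hinj _ b = (D.sweep hinj).orient _ a + D.arcTerm hinj _ a + 1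
    rw [(D.sweep hinj).orient_of_neighborSet_eq_pair hab hN, D.arcTerm_eq hinj (by simp) (by simp) b a]
    ring
  · intro c d e i hd he hdi hei
    obtain ⟨⟨v, a⟩, hva⟩ := d
    obtain ⟨⟨v', b⟩, hvb⟩ := e
    obtain rfl : v = .crossing c := hd
    obtain rfl : v' = .crossing c := he
    obtain rfl : a = _ := hdi
    obtain rfl : b = _ := hei
    change (D.sweep hinj).orient _ _ + D.arcTerm hinj _ _ = (D.sweep hinj).orient _ _ + D.arcTerm hinj _ _ + 1
    obtain ⟨h02, hs02⟩ := D.slope_eq_of_mem_openSegment hinj (D.over_straight c) (D.adj_nbr c 0) (D.adj_nbr c 2)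
    obtain ⟨h13, hs13⟩ := D.slope_eq_of_mem_openSegment hinj (D.under_straight c) (D.adj_nbr c 1) (D.adj_nbr c 3)
    rw [(D.sweep hinj).orient_crossing (D.neighbors_crossing c) h02 h13 hs02 hs13 ?_ i,
      D.arcTerm_eq hinj (by simp) (by simp) (D.nbr c (i + 1)) (D.nbr c i)]
    · ring
    -- Equal slopes would make the determinant in `counterclockwise` vanish; the shear by `ε` does
    -- not affect it.
    · intro h
      have hcc := D.counterclockwise c
      have n0 := sub_ne_zero.2 ((D.sweep hinj).X_injective.ne (D.adj_nbr c 0).ne).symm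
      have n1 := sub_ne_zero.2 ((D.sweep hinj).X_injective.ne (D.adj_nbr c 1).ne).symm
      unfold SweepDrawing.slope at h
      rw [div_eq_div_iff n0 n1] at h
      simp only [sweep] at h
      apply hcc.ne
      linear_combination h
  · intro p d hd
    obtain ⟨⟨v, a⟩, hva⟩ := d
    obtain rfl : v = .endpoint p := hd
    exact D.orient_endpoint hinj hε hε1 p hva

end BallTangleDiagram

/-! ### States as pairs of involutions on half-edges, and the parity of circle counts. -/

namespace BallTangleDiagram

variable (D : BallTangleDiagram)

instance : Finite D.G.Dart := by
  have := D.finiteW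
  exact Finite.of_injective (fun d => d.toProd) SimpleGraph.Dart.toProd_injective

/-- Two different half-edges at the same vertex, or at the two ends of a closing arc, that are connected
there. -/
def Joined (cl : TangleClosure) (σ : D.State) (d e : D.G.Dart) : Prop :=
  (∃ w, d.fst = .bend w ∧ e.fst = .bend w ∧ d ≠ e) ∨
  (∃ c i, d.fst = .crossing c ∧ e.fst = .crossing c ∧ d.snd = D.nbr c i ∧
    e.snd = D.nbr c ((σ c).partner i)) ∨
  ∃ p, d.fst = .endpoint p ∧ e.fst = .endpoint (cl.partner p)

theorem Splitting.partner_partner (x : Splitting) (i : Fin 4) : x.partner (x.partner i) = i := by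
  revert x i; decide

theorem TangleClosure.partner_partner (cl : TangleClosure) (p : Corner) :
    cl.partner (cl.partner p) = p := by
  cases cl <;> cases p <;> rfl

/-- The half-edge leaving a crossing in a given direction. -/
def crossingDart (c : D.K) (i : Fin 4) : D.G.Dart := ⟨(.crossing c, D.nbr c i), D.adj_nbr c i⟩

theorem exists_endDart (p : Corner) : ∃ d : D.G.Dart, d.fst = .endpoint p := by
  obtain ⟨u, hu⟩ := D.exists_neighborSet_endpoint p
  exact ⟨⟨(.endpoint p, u), show u ∈ D.G.neighborSet (.endpoint p) by rw [hu]; rfl⟩, rfl⟩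

/-- The half-edge at an end point. -/
noncomputable def endDart (p : Corner) : D.G.Dart := (D.exists_endDart p).choose

theorem endDart_fst (p : Corner) : (D.endDart p).fst = .endpoint p := (D.exists_endDart p).choose_spec

variable {D} in
theorem dart_ext {d e : D.G.Dart} (h1 : d.fst = e.fst) (h2 : d.snd = e.snd) : d = e :=
  SimpleGraph.Dart.ext _ _ (Prod.ext h1 h2)

theorem eq_endDart {d : D.G.Dart} {p : Corner} (h : d.fst = .endpoint p) : d = D.endDart p := by
  obtain ⟨u, hu⟩ := D.exists_neighborSet_endpoint p
  have key : ∀ e : D.G.Dart, e.fst = .endpoint p → e.snd = u := by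
    intro e he
    have h1 : e.snd ∈ D.G.neighborSet (.endpoint p) := he ▸ e.adj
    rwa [hu] at h1
  exact dart_ext (h.trans (D.endDart_fst p).symm) ((key d h).trans (key _ (D.endDart_fst p)).symm)

theorem eq_crossingDart {d : D.G.Dart} {c : D.K} (h : d.fst = .crossing c) :
    ∃ i, d = D.crossingDart c i := by
  have h1 : d.snd ∈ D.G.neighborSet (.crossing c) := h ▸ d.adj
  rw [D.neighbors_crossing] at h1
  obtain ⟨i, hi⟩ := h1
  exact ⟨i, dart_ext h hi.symm⟩

theorem crossingDart_injective (c : D.K) : Function.Injective (D.crossingDart c) := fun _ _ h =>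
  D.nbr_injective c (congrArg (fun d : D.G.Dart => d.snd) h)

theorem joined_crossingDart {cl : TangleClosure} {σ : D.State} {c : D.K} {i : Fin 4} {e : D.G.Dart} :
    D.Joined cl σ (D.crossingDart c i) e ↔ e = D.crossingDart c ((σ c).partner i) := by
  constructor
  · rintro (⟨w, h, -⟩ | ⟨c', j, h1, h2, h3, h4⟩ | ⟨p, h, -⟩)
    · cases h
    · cases h1
      obtain rfl := D.nbr_injective c h3
      exact dart_ext h2 h4
    · cases h
  · rintro rfl
    exact Or.inr (Or.inl ⟨c, i, rfl, rfl, rfl, rfl⟩)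

theorem joined_endDart {cl : TangleClosure} {σ : D.State} {p : Corner} {e : D.G.Dart} :
    D.Joined cl σ (D.endDart p) e ↔ e = D.endDart (cl.partner p) := by
  constructor
  · rintro (⟨w, h, -⟩ | ⟨c', j, h, -⟩ | ⟨q, h1, h2⟩)
    · cases (D.endDart_fst p).symm.trans h
    · cases (D.endDart_fst p).symm.trans h
    · cases (D.endDart_fst p).symm.trans h1
      exact D.eq_endDart h2
  · rintro rfl
    exact Or.inr (Or.inr ⟨p, D.endDart_fst _, D.endDart_fst _⟩)

theorem joined_bend {cl : TangleClosure} {σ : D.State} {w : D.W} {d e : D.G.Dart}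
    (hd : d.fst = .bend w) : D.Joined cl σ d e ↔ e.fst = .bend w ∧ d ≠ e := by
  constructor
  · rintro (⟨w', h1, h2, h3⟩ | ⟨c', j, h, -⟩ | ⟨q, h, -⟩)
    · cases hd.symm.trans h1
      exact ⟨h2, h3⟩
    · cases hd.symm.trans h
    · cases hd.symm.trans h
  · exact fun h => Or.inl ⟨w, hd, h.1, h.2⟩

theorem existsUnique_joined (cl : TangleClosure) (σ : D.State) (d : D.G.Dart) :
    ∃! e, D.Joined cl σ d e := by
  rcases hd : d.fst with p | w | c
  · rw [D.eq_endDart hd]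
    simp [joined_endDart]
  · obtain ⟨a, b, hab, hN⟩ := Set.ncard_eq_two.1 (D.degree_bend w)
    have hadj : ∀ x, D.G.Adj (.bend w) x ↔ x = a ∨ x = b := fun x => by
      rw [← SimpleGraph.mem_neighborSet, hN, Set.mem_insert_iff, Set.mem_singleton_iff]
    have key : ∀ a b, a ≠ b → (∀ x, D.G.Adj (.bend w) x ↔ x = a ∨ x = b) → d.snd = a →
        ∃! e, D.Joined cl σ d e := by
      intro a b hab hadj hda
      refine ⟨⟨(.bend w, b), (hadj b).2 (Or.inr rfl)⟩, ?_, ?_⟩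
      · refine (D.joined_bend hd).2 ⟨rfl, ?_⟩
        rintro rfl
        exact hab hda.symm
      · intro e he
        rw [D.joined_bend hd] at he
        rcases (hadj e.snd).1 (he.1 ▸ e.adj) with h | h
        · exact absurd (dart_ext (hd.trans he.1.symm) (hda.trans h.symm)) he.2
        · exact dart_ext he.1 h
    rcases (hadj d.snd).1 (hd ▸ d.adj) with h | h
    · exact key a b hab hadj h
    · exact key b a hab.symm (fun x => (hadj x).trans or_comm) h
  · obtain ⟨i, rfl⟩ := D.eq_crossingDart hd
    simp [joined_crossingDart]

/-- The half-edge connected to a given one in a state of a closure. -/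
noncomputable def next (cl : TangleClosure) (σ : D.State) (d : D.G.Dart) : D.G.Dart :=
  (D.existsUnique_joined cl σ d).exists.choose

theorem joined_iff {cl : TangleClosure} {σ : D.State} {d e : D.G.Dart} :
    D.Joined cl σ d e ↔ D.next cl σ d = e :=
  ⟨fun h => (D.existsUnique_joined cl σ d).unique
    (D.existsUnique_joined cl σ d).exists.choose_spec h,
    fun h => h ▸ (D.existsUnique_joined cl σ d).exists.choose_spec⟩

theorem joined_symm {cl : TangleClosure} {σ : D.State} {d e : D.G.Dart} (h : D.Joined cl σ d e) :
    D.Joined cl σ e d := by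
  rcases h with ⟨w, h1, h2, h3⟩ | ⟨c, i, h1, h2, h3, h4⟩ | ⟨p, h1, h2⟩
  · exact Or.inl ⟨w, h2, h1, h3.symm⟩
  · exact Or.inr (Or.inl ⟨c, _, h2, h1, h4, by rw [Splitting.partner_partner]; exact h3⟩)
  · exact Or.inr (Or.inr ⟨_, h2, by rw [TangleClosure.partner_partner]; exact h1⟩)

theorem next_next (cl : TangleClosure) (σ : D.State) : Function.Involutive (D.next cl σ) := fun _ =>
  D.joined_iff.1 (D.joined_symm (D.joined_iff.2 rfl))

theorem next_crossingDart (cl : TangleClosure) (σ : D.State) (c : D.K) (i : Fin 4) :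
    D.next cl σ (D.crossingDart c i) = D.crossingDart c ((σ c).partner i) :=
  D.joined_iff.1 (D.joined_crossingDart.2 rfl)

theorem next_endDart (cl : TangleClosure) (σ : D.State) (p : Corner) :
    D.next cl σ (D.endDart p) = D.endDart (cl.partner p) :=
  D.joined_iff.1 (D.joined_endDart.2 rfl)

theorem connects_next (cl : TangleClosure) (σ : D.State) (d : D.G.Dart) :
    D.Connects cl σ d (D.next cl σ d) := by
  rcases D.joined_iff.2 (rfl : D.next cl σ d = _) with
    ⟨w, h1, h2, h3⟩ | ⟨c, i, h1, h2, h3, h4⟩ | ⟨p, h1, h2⟩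
  · exact .bend w _ _ h1 h2
  · exact .crossing c i _ _ h1 h2 h3 h4
  · exact .closure p _ _ h1 h2

/-- Up to the reflexive pairs that `Connects` admits at bends, the relation is generated by two
involutions, so circles can be counted as orbits of a permutation. -/
theorem connects_cases (cl : TangleClosure) (σ : D.State) (d e : D.G.Dart)
    (h : D.Connects cl σ d e) : e = d ∨ e = d.symm ∨ e = D.next cl σ d := by
  rcases h with _ | ⟨w, _, _, h1, h2⟩ | ⟨c, i, _, _, h1, h2, h3, h4⟩ | ⟨p, _, _, h1, h2⟩
  · exact Or.inr (Or.inl rfl)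
  · by_cases hde : d = e
    · exact Or.inl hde.symm
    · exact Or.inr (Or.inr (D.joined_iff.1 (Or.inl ⟨w, h1, h2, hde⟩)).symm)
  · exact Or.inr (Or.inr (D.joined_iff.1 (Or.inr (Or.inl ⟨c, i, h1, h2, h3, h4⟩))).symm)
  · exact Or.inr (Or.inr (D.joined_iff.1 (Or.inr (Or.inr ⟨p, h1, h2⟩))).symm)

variable {D} in
theorem orientation_crossingDart_succ {s : D.G.Dart → ZMod 2}
    (hcross : ∀ c d e i, d.fst = .crossing c → e.fst = .crossing c → d.snd = D.nbr c i →
      e.snd = D.nbr c (i + 1) → s e = s d + 1) (c : D.K) (i : Fin 4) :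
    s (D.crossingDart c (i + 1)) = s (D.crossingDart c i) + 1 :=
  hcross c _ _ i rfl rfl rfl rfl

-- Both splittings join cyclically adjacent ends of a crossing, and closing arcs join adjacent
-- corners. A source-sink orientation alternates in each case, so every state is compatible with it.
variable {D} in
theorem orientation_next {s : D.G.Dart → ZMod 2}
    (hbend : ∀ w d e, d.fst = .bend w → e.fst = .bend w → d ≠ e → s e = s d + 1)
    (hcross : ∀ c d e i, d.fst = .crossing c → e.fst = .crossing c → d.snd = D.nbr c i →
      e.snd = D.nbr c (i + 1) → s e = s d + 1)
    (hend : ∀ p d, d.fst = .endpoint p → s d = p.orientation)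
    (cl : TangleClosure) (σ : D.State) (d : D.G.Dart) :
    s (D.next cl σ d) = s d + 1 := by
  have h2 : ∀ x y : ZMod 2, x = y + 1 → y = x + 1 := by decide
  rcases hd : d.fst with p | w | c
  · rw [D.eq_endDart hd, next_endDart, hend _ _ (D.endDart_fst _), hend _ _ (D.endDart_fst _)]
    cases cl <;> cases p <;> rfl
  · have h := (D.joined_bend hd).1 (D.joined_iff.2 (rfl : D.next cl σ d = _))
    exact hbend w _ _ hd h.1 h.2
  · obtain ⟨i, rfl⟩ := D.eq_crossingDart hd
    rw [next_crossingDart]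
    have key := orientation_crossingDart_succ hcross c
    have hp : (σ c).partner i = i + 1 ∨ i = (σ c).partner i + 1 := by
      have hall : ∀ (x : Splitting) (i : Fin 4), x.partner i = i + 1 ∨ i = x.partner i + 1 := by
        decide
      exact hall _ i
    rcases hp with hp | hp
    · rw [hp, key]
    · refine h2 _ _ ?_
      rw [← key, ← hp]

/-- The end half-edges of nonzero value are those at NW and SE. The two closures differ only in
exchanging their partners NE and SW, which is a transposition. -/
theorem circles_closure (σ : D.State) :
    (D.circles .denominator σ : ZMod 2) = D.circles .numerator σ + 1 := by
  obtain ⟨s, hsymm, hbend, hcross, hend⟩ := D.exists_orientation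
  have hnext := orientation_next hbend hcross hend
  refine card_quot_parity s SimpleGraph.Dart.symm (D.next .numerator σ) (D.next .denominator σ)
    SimpleGraph.Dart.symm_involutive (D.next_next _ _) (D.next_next _ _) hsymm (hnext _ _) (hnext _ _)
    _ _ .edge (D.connects_next _ _) (D.connects_cases _ _) .edge (D.connects_next _ _)
    (D.connects_cases _ _) (D.endDart .NE) (D.endDart .SW) ?_ ?_ ?_ ?_ ?_ ?_
  · exact hend _ _ (D.endDart_fst _)
  · exact hend _ _ (D.endDart_fst _)
  · intro h
    cases (D.endDart_fst .NE).symm.trans ((congrArg (fun d : D.G.Dart => d.fst) h).trans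
      (D.endDart_fst .SW))
  · intro d hd
    rw [← D.next_next .numerator σ d, hd, next_endDart, next_endDart]
    rfl
  · intro d hd
    rw [← D.next_next .numerator σ d, hd, next_endDart, next_endDart]
    rfl
  · intro d hs hx hy
    rcases hd : d.fst with p | w | c
    · obtain rfl := D.eq_endDart hd
      rw [hend _ _ hd] at hs
      rw [next_endDart] at hx hy
      cases p
      · exact absurd rfl hx
      · exact absurd rfl hs
      · exact absurd rfl hs
      · exact absurd rfl hy
    · exact D.joined_iff.1 ((D.joined_bend hd).2 ((D.joined_bend hd).1 (D.joined_iff.2 rfl)))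
    · obtain ⟨i, rfl⟩ := D.eq_crossingDart hd
      rw [next_crossingDart, next_crossingDart]

/-- Two opposite ends at `c` have value 0. Passing from the A- to the B-splitting exchanges them as
partners of the other two ends, which is again a transposition. -/
theorem circles_update (cl : TangleClosure) (σ : D.State) (c : D.K) (hc : σ c = .A) :
    (D.circles cl (Function.update σ c .B) : ZMod 2) = D.circles cl σ + 1 := by
  obtain ⟨s, hsymm, hbend, hcross, hend⟩ := D.exists_orientation
  have hnext := orientation_next hbend hcross hend
  have key := orientation_crossingDart_succ hcross c
  have h2 : ∀ t : ZMod 2, t + 1 + 1 = t := by decide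
  obtain ⟨i, hi⟩ : ∃ i, s (D.crossingDart c i) = 0 := by
    have h01 : ∀ t : ZMod 2, t = 0 ∨ t + 1 = 0 := by decide
    rcases h01 (s (D.crossingDart c 0)) with h | h
    · exact ⟨0, h⟩
    · exact ⟨0 + 1, by rw [key, h]⟩
  have hi2 : ∀ j, s (D.crossingDart c (j + 2)) = s (D.crossingDart c j) := by
    intro j
    rw [show j + 2 = j + 1 + 1 by rw [add_assoc]; rfl, key, key, h2]
  have hAB : ∀ j, Splitting.B.partner (Splitting.A.partner j) = j + 2 := by decide
  refine card_quot_parity s SimpleGraph.Dart.symm (D.next cl σ) (D.next cl (Function.update σ c .B))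
    SimpleGraph.Dart.symm_involutive (D.next_next _ _) (D.next_next _ _) hsymm (hnext _ _) (hnext _ _)
    _ _ .edge (D.connects_next _ _) (D.connects_cases _ _) .edge (D.connects_next _ _)
    (D.connects_cases _ _) (D.crossingDart c i) (D.crossingDart c (i + 2)) hi ?_ ?_ ?_ ?_ ?_
  · rw [hi2, hi]
  · intro h
    have hall : ∀ i : Fin 4, i ≠ i + 2 := by decide
    exact hall i (D.crossingDart_injective c h)
  · intro d hd
    rw [← D.next_next cl σ d, hd, next_crossingDart, next_crossingDart, Function.update_self, hc, hAB]
  · intro d hd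
    rw [← D.next_next cl σ d, hd, next_crossingDart, next_crossingDart, Function.update_self, hc, hAB,
      add_assoc, show (2 : Fin 4) + 2 = 0 from rfl, add_zero]
  · intro d hs hx hy
    rcases hd : d.fst with p | w | c'
    · obtain rfl := D.eq_endDart hd
      rw [next_endDart, next_endDart]
    · exact D.joined_iff.1 ((D.joined_bend hd).2 ((D.joined_bend hd).1 (D.joined_iff.2 rfl)))
    · obtain ⟨j, rfl⟩ := D.eq_crossingDart hd
      rw [next_crossingDart, next_crossingDart]
      by_cases hcc : c' = c
      · subst hcc
        exfalso
        rw [next_crossingDart, hc] at hx hy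
        have hk : Splitting.A.partner j = i ∨ Splitting.A.partner j = i + 2 ∨ j = i ∨ j = i + 2 := by
          clear hs hx hy hd hi
          revert i j
          decide
        rcases hk with hk | hk | hk | hk
        · exact hx (by rw [hk])
        · exact hy (by rw [hk])
        · exact hs (by rw [hk, hi])
        · exact hs (by rw [hk, hi2, hi])
      · rw [Function.update_of_ne hcc]

/-- The parity of the number of circles of a state is determined by the number of its `B`-splittings
and by the closure. -/
theorem exists_circles_parity : ∃ q : ZMod 2, ∀ σ : D.State,
    (D.circles .numerator σ : ZMod 2) =
      q + (Finset.univ.filter fun c => σ c = Splitting.B).card ∧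
    (D.circles .denominator σ : ZMod 2) =
      q + (Finset.univ.filter fun c => σ c = Splitting.B).card + 1 := by
  refine ⟨D.circles .numerator fun _ => .A, fun σ => ?_⟩
  have key : ∀ T : Finset D.K, (D.circles .numerator (fun c => if c ∈ T then .B else .A) : ZMod 2) =
      D.circles .numerator (fun _ => .A) + T.card := by
    intro T
    induction T using Finset.induction_on with
    | empty => simp
    | insert c T hc ih =>
      have h := D.circles_update .numerator (fun c => if c ∈ T then .B else .A) c (by simp [hc])
      rw [ih] at h
      rw [Finset.card_insert_of_notMem hc, Nat.cast_add, Nat.cast_one, ← add_assoc, ← h]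
      congr 2
      funext c'
      by_cases hcc : c' = c
      · subst hcc; simp
      · simp [hcc]
  have hσ : σ = fun c => if c ∈ Finset.univ.filter (fun c => σ c = Splitting.B) then .B else .A := by
    funext c
    rcases h : σ c with _ | _ <;> simp [h]
  have h := key (Finset.univ.filter fun c => σ c = Splitting.B)
  rw [← hσ] at h
  refine ⟨h, ?_⟩
  rw [circles_closure, h]

end BallTangleDiagram

/-! ### Brackets at the eighth root of unity, and integrality of the invariant. -/

/-- The primitive eighth root of unity at which brackets are evaluated. -/
noncomputable def kauffmanRoot : ℂ := Complex.exp (Real.pi / 4 * Complex.I)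

theorem kauffmanRoot_sq : kauffmanRoot ^ 2 = Complex.I := by
  rw [kauffmanRoot, ← Complex.exp_nat_mul]
  convert Complex.exp_pi_div_two_mul_I using 2
  push_cast
  ring

theorem kauffmanRoot_inv_sq : kauffmanRoot⁻¹ ^ 2 = -Complex.I := by
  rw [inv_pow, kauffmanRoot_sq, Complex.inv_I]

theorem kauffmanRoot_ne_zero : kauffmanRoot ≠ 0 := Complex.exp_ne_zero _

theorem kauffmanRoot_pow_eight : kauffmanRoot ^ 8 = 1 := by
  rw [show 8 = 2 * 4 from rfl, pow_mul, kauffmanRoot_sq, Complex.I_pow_four]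

theorem kauffmanRoot_loop : -kauffmanRoot ^ 2 - kauffmanRoot⁻¹ ^ 2 = 0 := by
  rw [kauffmanRoot_inv_sq, kauffmanRoot_sq]; ring

/-- The weight of a splitting in the bracket. -/
noncomputable def Splitting.weight : Splitting → ℂ
  | .A => kauffmanRoot
  | .B => kauffmanRoot⁻¹

theorem prod_weight {K : Type*} [Fintype K] (σ : K → Splitting) :
    ∏ c, (σ c).weight = kauffmanRoot ^ (Finset.univ.filter fun c => σ c = Splitting.A).card *
      kauffmanRoot⁻¹ ^ (Finset.univ.filter fun c => σ c = Splitting.B).card := by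
  have h1 : ∀ c, (σ c).weight = (if σ c = .A then kauffmanRoot else 1) *
      (if σ c = .B then kauffmanRoot⁻¹ else 1) := by
    intro c
    cases σ c <;> simp [Splitting.weight]
  simp only [h1, Finset.prod_mul_distrib, ← Finset.prod_filter, Finset.prod_const]

/-- Since A⁻¹ = A·(-i), all states share the factor Aⁿ, and only a power of -i depends on the state.
-/
theorem prod_weight_eq {K : Type*} [Fintype K] (σ : K → Splitting) :
    ∏ c, (σ c).weight = kauffmanRoot ^ Fintype.card K *
      (-Complex.I) ^ (Finset.univ.filter fun c => σ c = Splitting.B).card := by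
  have h1 : ∀ c, (σ c).weight = kauffmanRoot * (if σ c = .B then -Complex.I else 1) := by
    intro c
    cases σ c
    · simp [Splitting.weight]
    · rw [← kauffmanRoot_inv_sq]
      have := kauffmanRoot_ne_zero
      simp only [Splitting.weight, if_true]
      field_simp
  simp only [h1, Finset.prod_mul_distrib, ← Finset.prod_filter, Finset.prod_const, Finset.card_univ]

theorem neg_I_pow_of_even {n : ℕ} (h : (n : ZMod 2) = 0) : ∃ m : ℤ, (-Complex.I) ^ n = m := by
  obtain ⟨k, rfl⟩ := (ZMod.natCast_eq_zero_iff_even).1 h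
  exact ⟨(-1) ^ k, by rw [← two_mul, pow_mul]; simp⟩

theorem neg_I_pow_of_odd {n : ℕ} (h : (n : ZMod 2) = 1) :
    ∃ m : ℤ, (-Complex.I) ^ n = Complex.I * m := by
  obtain ⟨k, rfl⟩ := (ZMod.natCast_eq_one_iff_odd).1 h
  exact ⟨-(-1) ^ k, by rw [pow_succ, pow_mul]; simp [mul_comm]⟩

theorem exists_int_sum {ι : Type*} [Fintype ι] {f : ι → ℂ} {w : ℂ} (h : ∀ i, ∃ m : ℤ, f i = w * m) :
    ∃ m : ℤ, ∑ i, f i = w * m := by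
  choose m hm using h
  exact ⟨∑ i, m i, by simp [hm, Finset.mul_sum]⟩

namespace BallTangleDiagram

variable (D : BallTangleDiagram)

theorem circles_pos (cl : TangleClosure) (σ : D.State) : 0 < D.circles cl σ := by
  have : Nonempty (Quot (D.Connects cl σ)) := ⟨Quot.mk _ (D.endDart .NW)⟩
  exact Nat.card_pos

/-- Only the states with a single circle contribute to the bracket at an eighth root of unity. -/
theorem bracket_eq (cl : TangleClosure) :
    D.bracket cl kauffmanRoot =
      ∑ σ : D.State, if D.circles cl σ = 1 then ∏ c, (σ c).weight else 0 := by
  unfold bracket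
  refine Finset.sum_congr rfl fun σ _ => ?_
  -- One circle gives exponent 0, hence 0⁰ = 1. Positivity keeps the truncated difference from
  -- treating zero circles in the same way.
  have := D.circles_pos cl σ
  rw [kauffmanRoot_loop, ← prod_weight]
  split_ifs with h
  · rw [h]; simp
  · rw [zero_pow (by omega), mul_zero]

/-- The invariant of the diagram is the class of the integers `u`, `v`. -/
def Realizes (u v : ℤ) : Prop :=
  ∃ z : ℂ, z ^ 8 = 1 ∧ z * D.bracket .numerator kauffmanRoot = u ∧
    Complex.I * z * D.bracket .denominator kauffmanRoot = v

theorem exists_int_bracket {cl : TangleClosure} {w : ℂ}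
    (h : ∀ σ : D.State, D.circles cl σ = 1 → ∃ m : ℤ,
      (-Complex.I) ^ (Finset.univ.filter fun c => σ c = Splitting.B).card = w * m) :
    ∃ m : ℤ, D.bracket cl kauffmanRoot = kauffmanRoot ^ Fintype.card D.K * w * m := by
  rw [bracket_eq]
  refine exists_int_sum fun σ => ?_
  split_ifs with hσ
  · obtain ⟨m, hm⟩ := h σ hσ
    exact ⟨m, by rw [prod_weight_eq, hm, mul_assoc]⟩
  · exact ⟨0, by simp⟩

theorem exists_realizes : ∃ u v : ℤ, D.Realizes u v := by
  obtain ⟨q, hq⟩ := D.exists_circles_parity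
  have hz : (kauffmanRoot⁻¹ ^ Fintype.card D.K) * kauffmanRoot ^ Fintype.card D.K = 1 := by
    rw [← mul_pow, inv_mul_cancel₀ kauffmanRoot_ne_zero, one_pow]
  have hz8 : (kauffmanRoot⁻¹ ^ Fintype.card D.K) ^ 8 = 1 := by
    rw [← pow_mul, mul_comm, pow_mul, inv_pow, kauffmanRoot_pow_eight, inv_one, one_pow]
  have hq2 : q = 1 ∨ q = 0 := by
    have hall : ∀ q : ZMod 2, q = 1 ∨ q = 0 := by decide
    exact hall q
  -- For q = 1 the one-circle states have β even for the numerator and odd for the denominator, so z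
  -- = A⁻ⁿ works. For q = 0 the parities are exchanged, and a further factor i is needed in z.
  rcases hq2 with rfl | rfl
  · obtain ⟨m, hm⟩ := D.exists_int_bracket (cl := .numerator) (w := 1) fun σ hσ => by
      simp only [one_mul]
      apply neg_I_pow_of_even
      have h := (hq σ).1
      rw [hσ] at h
      generalize ((Finset.univ.filter fun c => σ c = Splitting.B).card : ZMod 2) = x at *
      revert h x; decide
    obtain ⟨m', hm'⟩ := D.exists_int_bracket (cl := .denominator) (w := Complex.I) fun σ hσ => by
      apply neg_I_pow_of_odd
      have h := (hq σ).2
      rw [hσ] at h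
      generalize ((Finset.univ.filter fun c => σ c = Splitting.B).card : ZMod 2) = x at *
      revert h x; decide
    refine ⟨m, -m', kauffmanRoot⁻¹ ^ Fintype.card D.K, hz8, ?_, ?_⟩
    · rw [hm]
      linear_combination (m : ℂ) * hz
    · rw [hm']
      push_cast
      linear_combination (m' : ℂ) * Complex.I ^ 2 * hz + m' * Complex.I_sq
  · obtain ⟨m, hm⟩ := D.exists_int_bracket (cl := .numerator) (w := Complex.I) fun σ hσ => by
      apply neg_I_pow_of_odd
      have h := (hq σ).1
      rw [hσ] at h
      generalize ((Finset.univ.filter fun c => σ c = Splitting.B).card : ZMod 2) = x at *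
      revert h x; decide
    obtain ⟨m', hm'⟩ := D.exists_int_bracket (cl := .denominator) (w := 1) fun σ hσ => by
      simp only [one_mul]
      apply neg_I_pow_of_even
      have h := (hq σ).2
      rw [hσ] at h
      generalize ((Finset.univ.filter fun c => σ c = Splitting.B).card : ZMod 2) = x at *
      revert h x; decide
    refine ⟨-m, -m', Complex.I * kauffmanRoot⁻¹ ^ Fintype.card D.K, ?_, ?_, ?_⟩
    · rw [mul_pow, hz8, show 8 = 4 * 2 from rfl, pow_mul, Complex.I_pow_four]; simp
    · rw [hm]
      push_cast
      linear_combination (m : ℂ) * Complex.I ^ 2 * hz + m * Complex.I_sq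
    · rw [hm']
      push_cast
      linear_combination (m' : ℂ) * Complex.I ^ 2 * hz + m' * Complex.I_sq

variable {D} in
theorem Realizes.neg {u v : ℤ} (h : D.Realizes u v) : D.Realizes (-u) (-v) := by
  obtain ⟨z, hz, h1, h2⟩ := h
  refine ⟨-z, by rw [Even.neg_pow (by decide), hz], ?_, ?_⟩
  · push_cast; rw [← h1]; ring
  · push_cast; rw [← h2]; ring

/-- An eighth root of unity that maps a nonzero integer to an integer is real. -/
theorem eq_one_or_neg_one_of_int {t : ℂ} (ht : t ^ 8 = 1) {u p : ℤ} (hu : u ≠ 0)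
    (h : (p : ℂ) = t * u) : t = 1 ∨ t = -1 := by
  have hu' : (u : ℂ) ≠ 0 := by exact_mod_cast hu
  have h1 : t = ((p / u : ℝ) : ℂ) := by
    push_cast
    rw [h]
    field_simp
  rw [h1] at ht ⊢
  have h2 : ((p / u : ℝ)) ^ 8 = 1 := by exact_mod_cast ht
  have h3 := (pow_eq_one_iff_of_ne_zero (by norm_num)).1 h2
  rcases h3 with h3 | ⟨h3, _⟩
  · left; rw [h3]; simp
  · right; rw [h3]; simp

variable {D} in
theorem Realizes.invariant_eq {u v : ℤ} (h : D.Realizes u v) :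
    D.invariant = {!![u; v], -!![u; v]} := by
  have hmem : ∀ {a b : ℤ}, D.Realizes a b → !![a; b] ∈ D.invariant := by
    rintro a b ⟨z, hz, h1, h2⟩
    refine ⟨z, hz, ?_⟩
    change _ = !![z * D.bracket .numerator kauffmanRoot; Complex.I * z * D.bracket .denominator kauffmanRoot]
    rw [h1, h2]
    ext i j
    fin_cases i <;> fin_cases j <;> rfl
  have hneg : -!![u; v] = !![-u; -v] := by
    ext i j
    fin_cases i <;> fin_cases j <;> rfl
  ext M
  constructor
  · rintro ⟨z', hz', hM⟩
    obtain ⟨z, hz, h1, h2⟩ := h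
    have hz0 : z ≠ 0 := by rintro rfl; norm_num at hz
    have e1 : (M 0 0 : ℂ) = z' * D.bracket .numerator kauffmanRoot := congrFun (congrFun hM 0) 0
    have e2 : (M 1 0 : ℂ) = Complex.I * z' * D.bracket .denominator kauffmanRoot :=
      congrFun (congrFun hM 1) 0
    have f1 : (M 0 0 : ℂ) = (z' / z) * u := by rw [e1, ← h1]; field_simp
    have f2 : (M 1 0 : ℂ) = (z' / z) * v := by rw [e2, ← h2]; field_simp
    have ht : (z' / z) ^ 8 = 1 := by rw [div_pow, hz, hz', div_one]
    -- A nonzero entry forces the quotient to be a sign. If both entries vanish the quotient is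
    -- arbitrary, but the matrix is zero in any case.
    have hcase : (z' / z = 1 ∨ z' / z = -1) ∨ (u = 0 ∧ v = 0) := by
      by_cases hu : u = 0
      · by_cases hv : v = 0
        · exact Or.inr ⟨hu, hv⟩
        · exact Or.inl (eq_one_or_neg_one_of_int ht hv f2)
      · exact Or.inl (eq_one_or_neg_one_of_int ht hu f1)
    rw [hneg]
    rcases hcase with (ht | ht) | ⟨rfl, rfl⟩
    · rw [ht, one_mul] at f1 f2
      left
      have g1 : M 0 0 = u := by exact_mod_cast f1
      have g2 : M 1 0 = v := by exact_mod_cast f2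
      ext i j
      fin_cases i <;> fin_cases j
      exacts [g1, g2]
    · rw [ht, neg_one_mul] at f1 f2
      right
      have g1 : M 0 0 = -u := by exact_mod_cast f1
      have g2 : M 1 0 = -v := by exact_mod_cast f2
      ext i j
      fin_cases i <;> fin_cases j
      exacts [g1, g2]
    · left
      have g1 : M 0 0 = 0 := by simpa using f1
      have g2 : M 1 0 = 0 := by simpa using f2
      ext i j
      fin_cases i <;> fin_cases j
      exacts [g1, g2]
  · rintro (rfl | rfl)
    · exact hmem h
    · rw [hneg]
      exact hmem h.neg

theorem invariant_mem_PM : D.invariant ∈ PM 2 1 := by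
  obtain ⟨u, v, h⟩ := D.exists_realizes
  exact ⟨!![u; v], h.invariant_eq.symm⟩

end BallTangleDiagram

/-! ### Outer pieces and the insertion of a diagram into their inner disc. -/

/-- A piece of a tangle diagram in the complement of a smaller disc, the image of the standard disc under
the similarity `z ↦ rot * z + center` (in complex notation). Its vertices are the four inner end points,
where a smaller diagram is to be inserted, and those of a tangle diagram. -/
structure OuterPiece where
  W : Type
  K : Type
  E : Type
  [finiteW : Finite W]
  [fintypeK : Fintype K]
  [decidableEqK : DecidableEq K]
  /-- the ends of the edges -/
  ends : E → (Corner ⊕ TangleVertex W K) × (Corner ⊕ TangleVertex W K)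
  rot : ℝ × ℝ
  center : ℝ × ℝ
  pos : TangleVertex W K → ℝ × ℝ
  nbr : K → Fin 4 → Corner ⊕ TangleVertex W K
  ends_ne : ∀ e, (ends e).1 ≠ (ends e).2
  ends_injective : ∀ e e', s((ends e).1, (ends e).2) = s((ends e').1, (ends e').2) → e = e'
  rot_ne : 0 < rot.1 ^ 2 + rot.2 ^ 2
  inner_disc : ∀ p : ℝ × ℝ, p.1 ^ 2 + p.2 ^ 2 ≤ 2 →
    (rot.1 * p.1 - rot.2 * p.2 + center.1) ^ 2 + (rot.2 * p.1 + rot.1 * p.2 + center.2) ^ 2 < 2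
  pos_injective : Function.Injective pos
  pos_endpoint : ∀ p : Corner, pos (.endpoint p) = p.pos
  pos_bend : ∀ w, (pos (.bend w)).1 ^ 2 + (pos (.bend w)).2 ^ 2 < 2
  pos_crossing : ∀ c, (pos (.crossing c)).1 ^ 2 + (pos (.crossing c)).2 ^ 2 < 2
  pos_outside : ∀ v, 2 * (rot.1 ^ 2 + rot.2 ^ 2) <
    ((pos v).1 - center.1) ^ 2 + ((pos v).2 - center.2) ^ 2
  inner_adj : ∀ p, ∃ v, ∀ y, (∃ e, s((ends e).1, (ends e).2) = s(.inl p, y)) ↔ y = .inr v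
  endpoint_adj : ∀ p, ∃ v, ∀ y, (∃ e, s((ends e).1, (ends e).2) = s(.inr (.endpoint p), y)) ↔ y = v
  bend_adj : ∀ w, ∃ v v', v ≠ v' ∧
    ∀ y, (∃ e, s((ends e).1, (ends e).2) = s(.inr (.bend w), y)) ↔ y = v ∨ y = v'
  crossing_adj : ∀ c y, (∃ e, s((ends e).1, (ends e).2) = s(.inr (.crossing c), y)) ↔
    ∃ i, nbr c i = y

namespace OuterPiece

attribute [instance] finiteW fintypeK decidableEqK

variable (S : OuterPiece)

/-- The similarity onto the inner disc. -/
def shrink (p : ℝ × ℝ) : ℝ × ℝ :=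
  (S.rot.1 * p.1 - S.rot.2 * p.2 + S.center.1, S.rot.2 * p.1 + S.rot.1 * p.2 + S.center.2)

/-- The positions of the vertices and of the inner end points. -/
def place : Corner ⊕ TangleVertex S.W S.K → ℝ × ℝ
  | .inl p => S.shrink p.pos
  | .inr v => S.pos v

/-- The edges of an outer piece stay outside the inner disc and meet only in common ends; its crossings
are straight. -/
structure IsPlane : Prop where
  edge_outside : ∀ e, ∀ x ∈ segment ℝ (S.place (S.ends e).1) (S.place (S.ends e).2),
    2 * (S.rot.1 ^ 2 + S.rot.2 ^ 2) < (x.1 - S.center.1) ^ 2 + (x.2 - S.center.2) ^ 2 ∨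
      ∃ p, ((S.ends e).1 = .inl p ∨ (S.ends e).2 = .inl p) ∧ x = S.place (.inl p)
  edges_disjoint : ∀ e e', e ≠ e' → ∀ x,
    x ∈ segment ℝ (S.place (S.ends e).1) (S.place (S.ends e).2) →
    x ∈ segment ℝ (S.place (S.ends e').1) (S.place (S.ends e').2) →
    ∃ y, ((S.ends e).1 = y ∨ (S.ends e).2 = y) ∧ ((S.ends e').1 = y ∨ (S.ends e').2 = y) ∧
      x = S.place y
  over_straight : ∀ c, S.pos (.crossing c) ∈ openSegment ℝ (S.place (S.nbr c 0)) (S.place (S.nbr c 2))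
  under_straight : ∀ c, S.pos (.crossing c) ∈ openSegment ℝ (S.place (S.nbr c 1)) (S.place (S.nbr c 3))
  counterclockwise : ∀ c,
    0 < ((S.place (S.nbr c 0)).1 - (S.pos (.crossing c)).1) *
        ((S.place (S.nbr c 1)).2 - (S.pos (.crossing c)).2) -
      ((S.place (S.nbr c 0)).2 - (S.pos (.crossing c)).2) *
        ((S.place (S.nbr c 1)).1 - (S.pos (.crossing c)).1)

theorem normSq_shrink_sub (p : ℝ × ℝ) :
    ((S.shrink p).1 - S.center.1) ^ 2 + ((S.shrink p).2 - S.center.2) ^ 2 =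
      (S.rot.1 ^ 2 + S.rot.2 ^ 2) * (p.1 ^ 2 + p.2 ^ 2) := by
  simp only [shrink]
  ring

theorem shrink_injective : Function.Injective S.shrink := by
  intro p q h
  have h1 := congrArg Prod.fst h
  have h2 := congrArg Prod.snd h
  simp only [shrink] at h1 h2
  have h0 := S.rot_ne.ne'
  ext
  · apply mul_left_cancel₀ h0
    linear_combination S.rot.1 * h1 + S.rot.2 * h2
  · apply mul_left_cancel₀ h0
    linear_combination S.rot.1 * h2 - S.rot.2 * h1

theorem shrink_combo (p q : ℝ × ℝ) {a b : ℝ} (hab : a + b = 1) :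
    S.shrink (a • p + b • q) = a • S.shrink p + b • S.shrink q := by
  obtain rfl : a = 1 - b := by linarith
  ext
  · simp [shrink]; ring
  · simp [shrink]; ring

theorem mem_segment_shrink {p q x : ℝ × ℝ} (h : x ∈ segment ℝ (S.shrink p) (S.shrink q)) :
    ∃ y ∈ segment ℝ p q, x = S.shrink y := by
  obtain ⟨a, b, ha, hb, hab, rfl⟩ := h
  exact ⟨a • p + b • q, ⟨a, b, ha, hb, hab, rfl⟩, (S.shrink_combo p q hab).symm⟩

theorem shrink_mem_openSegment {p q x : ℝ × ℝ} (h : x ∈ openSegment ℝ p q) :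
    S.shrink x ∈ openSegment ℝ (S.shrink p) (S.shrink q) := by
  obtain ⟨a, b, ha, hb, hab, rfl⟩ := h
  exact ⟨a, b, ha, hb, hab, (S.shrink_combo p q hab).symm⟩

variable (B : BallTangleDiagram)

/-- The vertices of the glued diagram. -/
abbrev GluedVertex : Type := TangleVertex (B.W ⊕ Corner ⊕ S.W) (B.K ⊕ S.K)

/-- Vertices of the inserted diagram, in the glued one. -/
def inner : TangleVertex B.W B.K → S.GluedVertex B
  | .endpoint p => .bend (.inr (.inl p))
  | .bend w => .bend (.inl w)
  | .crossing c => .crossing (.inl c)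

/-- Vertices of the outer piece, in the glued diagram. -/
def outer : Corner ⊕ TangleVertex S.W S.K → S.GluedVertex B
  | .inl p => .bend (.inr (.inl p))
  | .inr (.endpoint p) => .endpoint p
  | .inr (.bend w) => .bend (.inr (.inr w))
  | .inr (.crossing c) => .crossing (.inr c)

theorem inner_injective : Function.Injective (S.inner B) := by
  rintro (_ | _ | _) (_ | _ | _) h <;> simp_all [inner]

theorem outer_injective : Function.Injective (S.outer B) := by
  rintro (_ | _ | _ | _) (_ | _ | _ | _) h <;> simp_all [outer]

theorem inner_eq_outer_iff {u : TangleVertex B.W B.K} {v : Corner ⊕ TangleVertex S.W S.K} :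
    S.inner B u = S.outer B v ↔ ∃ p, u = .endpoint p ∧ v = .inl p := by
  rcases u with _ | _ | _ <;> rcases v with _ | _ | _ | _ <;> simp [inner, outer, eq_comm]

theorem exists_inner_or_outer (x : S.GluedVertex B) :
    (∃ u, x = S.inner B u) ∨ ∃ v, x = S.outer B (.inr v) := by
  rcases x with p | (w | p | w) | (c | c)
  · exact Or.inr ⟨.endpoint p, rfl⟩
  · exact Or.inl ⟨.bend w, rfl⟩
  · exact Or.inl ⟨.endpoint p, rfl⟩
  · exact Or.inr ⟨.bend w, rfl⟩
  · exact Or.inl ⟨.crossing c, rfl⟩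
  · exact Or.inr ⟨.crossing c, rfl⟩

/-- The positions in the glued diagram. -/
def gluedPos : S.GluedVertex B → ℝ × ℝ
  | .endpoint p => S.pos (.endpoint p)
  | .bend (.inl w) => S.shrink (B.pos (.bend w))
  | .bend (.inr (.inl p)) => S.shrink p.pos
  | .bend (.inr (.inr w)) => S.pos (.bend w)
  | .crossing (.inl c) => S.shrink (B.pos (.crossing c))
  | .crossing (.inr c) => S.pos (.crossing c)

theorem gluedPos_inner (u : TangleVertex B.W B.K) :
    S.gluedPos B (S.inner B u) = S.shrink (B.pos u) := by
  rcases u with p | _ | _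
  · simp [gluedPos, inner, B.pos_endpoint]
  · rfl
  · rfl

theorem gluedPos_outer (v : Corner ⊕ TangleVertex S.W S.K) :
    S.gluedPos B (S.outer B v) = S.place v := by
  rcases v with _ | _ | _ | _ <;> rfl

/-- Adjacency in the glued diagram. -/
def GluedAdj (x y : S.GluedVertex B) : Prop :=
  (∃ u v, B.G.Adj u v ∧ x = S.inner B u ∧ y = S.inner B v) ∨
    ∃ e, s(S.outer B (S.ends e).1, S.outer B (S.ends e).2) = s(x, y)

/-- The graph of the glued diagram. -/
def gluedGraph : SimpleGraph (S.GluedVertex B) where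
  Adj := S.GluedAdj B
  symm := ⟨by
    rintro x y (⟨u, v, h, rfl, rfl⟩ | ⟨e, h⟩)
    · exact Or.inl ⟨v, u, h.symm, rfl, rfl⟩
    · exact Or.inr ⟨e, h.trans Sym2.eq_swap⟩⟩
  loopless := ⟨by
    rintro x (⟨u, v, h, h1, h2⟩ | ⟨e, h⟩)
    · exact h.ne (S.inner_injective B (h1.symm.trans h2))
    · rw [Sym2.eq_iff] at h
      refine S.ends_ne e (S.outer_injective B ?_)
      rcases h with h | h <;> exact h.1.trans h.2.symm⟩

variable {B}

theorem outer_edge_iff {e : S.E} {v : Corner ⊕ TangleVertex S.W S.K} {y : S.GluedVertex B} :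
    s(S.outer B (S.ends e).1, S.outer B (S.ends e).2) = s(S.outer B v, y) ↔
      ∃ v', y = S.outer B v' ∧ s((S.ends e).1, (S.ends e).2) = s(v, v') := by
  simp only [Sym2.eq_iff]
  constructor
  · rintro (⟨h1, rfl⟩ | ⟨rfl, h2⟩)
    · exact ⟨_, rfl, Or.inl ⟨S.outer_injective B h1, rfl⟩⟩
    · exact ⟨_, rfl, Or.inr ⟨rfl, S.outer_injective B h2⟩⟩
  · rintro ⟨v', rfl, ⟨rfl, rfl⟩ | ⟨rfl, rfl⟩⟩
    · exact Or.inl ⟨rfl, rfl⟩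
    · exact Or.inr ⟨rfl, rfl⟩

theorem gluedAdj_outer_iff {v : TangleVertex S.W S.K} {y : S.GluedVertex B} :
    S.GluedAdj B (S.outer B (.inr v)) y ↔
      ∃ v', y = S.outer B v' ∧ ∃ e, s((S.ends e).1, (S.ends e).2) = s(.inr v, v') := by
  constructor
  · rintro (⟨u, w, _, h, _⟩ | ⟨e, h⟩)
    · obtain ⟨p, _, h⟩ := (S.inner_eq_outer_iff B).1 h.symm
      cases h
    · obtain ⟨v', h1, h2⟩ := S.outer_edge_iff.1 h
      exact ⟨v', h1, e, h2⟩
  · rintro ⟨v', h1, e, h2⟩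
    exact Or.inr ⟨e, S.outer_edge_iff.2 ⟨v', h1, h2⟩⟩

theorem gluedAdj_inner_iff {u : TangleVertex B.W B.K} (hu : ∀ p, u ≠ .endpoint p)
    {y : S.GluedVertex B} :
    S.GluedAdj B (S.inner B u) y ↔ ∃ v, y = S.inner B v ∧ B.G.Adj u v := by
  constructor
  · rintro (⟨u', w, h, h1, h2⟩ | ⟨e, h⟩)
    · obtain rfl := S.inner_injective B h1
      exact ⟨w, h2, h⟩
    · have : ∃ v, S.inner B u = S.outer B v := by
        rcases Sym2.eq_iff.1 h with ⟨h, _⟩ | ⟨_, h⟩ <;> exact ⟨_, h.symm⟩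
      obtain ⟨v, hv⟩ := this
      obtain ⟨p, hp, _⟩ := (S.inner_eq_outer_iff B).1 hv
      exact absurd hp (hu p)
  · rintro ⟨v, rfl, h⟩
    exact Or.inl ⟨u, v, h, rfl, rfl⟩

theorem gluedAdj_inner_endpoint_iff {p : Corner} {y : S.GluedVertex B} :
    S.GluedAdj B (S.inner B (.endpoint p)) y ↔ (∃ v, y = S.inner B v ∧ B.G.Adj (.endpoint p) v) ∨
      ∃ v, y = S.outer B (.inr v) ∧ ∃ e, s((S.ends e).1, (S.ends e).2) = s(.inl p, .inr v) := by
  constructor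
  · rintro (⟨u', w, h, h1, h2⟩ | ⟨e, h⟩)
    · obtain rfl := S.inner_injective B h1
      exact Or.inl ⟨w, h2, h⟩
    · obtain ⟨v', h1, h2⟩ := (S.outer_edge_iff (v := .inl p)).1 h
      obtain ⟨v, hv⟩ := S.inner_adj p
      obtain rfl := (hv v').1 ⟨e, h2⟩
      exact Or.inr ⟨v, h1, e, h2⟩
  · rintro (⟨v, rfl, h⟩ | ⟨v, h1, e, h2⟩)
    · exact Or.inl ⟨_, v, h, rfl, rfl⟩
    · exact Or.inr ⟨e, S.outer_edge_iff.2 ⟨_, h1, h2⟩⟩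

/-- The end point lies on its own edge, and different edges meet only in common vertices. Hence an
inserted edge touches the outer piece at an inner end point only by ending there. -/
theorem eq_endpoint_of_mem_segment (B : BallTangleDiagram) {p : Corner} {u v : TangleVertex B.W B.K}
    (h : B.G.Adj u v) (hp : p.pos ∈ segment ℝ (B.pos u) (B.pos v)) :
    u = .endpoint p ∨ v = .endpoint p := by
  obtain ⟨w, hw⟩ := B.exists_neighborSet_endpoint p
  have hadj : B.G.Adj (.endpoint p) w := show w ∈ B.G.neighborSet (.endpoint p) by rw [hw]; rfl
  by_cases hs : s(u, v) = s(.endpoint p, w)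
  · rcases Sym2.eq_iff.1 hs with h | h
    · exact Or.inl h.1
    · exact Or.inr h.2
  · obtain ⟨y, hy, -, h⟩ := B.edges_disjoint u v _ w h hadj hs p.pos
      ⟨hp, by rw [B.pos_endpoint]; exact left_mem_segment ℝ _ _⟩
    rw [← B.pos_endpoint] at h
    rw [← B.pos_injective h] at hy
    rcases Sym2.mem_iff.1 hy with h | h
    · exact Or.inl h.symm
    · exact Or.inr h.symm

variable {S}

/-- By convexity inserted edges stay in the inner disc, and outer edges leave its closure except at
inner end points. Contact is thus possible only at a shared bend. -/
theorem inner_outer_disjoint (hS : S.IsPlane) {u v : TangleVertex B.W B.K} (h : B.G.Adj u v) (e : S.E)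
    {x : ℝ × ℝ} (h1 : x ∈ segment ℝ (S.gluedPos B (S.inner B u)) (S.gluedPos B (S.inner B v)))
    (h2 : x ∈ segment ℝ (S.place (S.ends e).1) (S.place (S.ends e).2)) :
    ∃ y, y ∈ s(S.inner B u, S.inner B v) ∧
      y ∈ s(S.outer B (S.ends e).1, S.outer B (S.ends e).2) ∧ x = S.gluedPos B y := by
  rw [gluedPos_inner, gluedPos_inner] at h1
  obtain ⟨q, hq, rfl⟩ := S.mem_segment_shrink h1
  have hq2 := BallTangleDiagram.normSq_le_of_mem_segment (B.normSq_pos_le u) (B.normSq_pos_le v) hq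
  rcases hS.edge_outside e _ h2 with h3 | ⟨p, hp, hx⟩
  · rw [normSq_shrink_sub] at h3
    nlinarith [S.rot_ne]
  · have := S.shrink_injective hx
    subst this
    refine ⟨S.outer B (.inl p), ?_, ?_, ?_⟩
    · rcases eq_endpoint_of_mem_segment B h hq with rfl | rfl
      · exact Sym2.mem_mk_left _ _
      · exact Sym2.mem_mk_right _ _
    · rcases hp with hp | hp <;> rw [hp]
      · exact Sym2.mem_mk_left _ _
      · exact Sym2.mem_mk_right _ _
    · rw [gluedPos_outer]; rfl

theorem segment_congr {V : Type*} (f : V → ℝ × ℝ) {a b c d : V} (h : s(a, b) = s(c, d)) :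
    segment ℝ (f a) (f b) = segment ℝ (f c) (f d) := by
  rcases Sym2.eq_iff.1 h with ⟨rfl, rfl⟩ | ⟨rfl, rfl⟩
  · rfl
  · exact segment_symm _ _ _

theorem glued_edges_disjoint (hS : S.IsPlane) (u v u' v' : S.GluedVertex B)
    (h : S.GluedAdj B u v) (h' : S.GluedAdj B u' v') (hne : s(u, v) ≠ s(u', v'))
    (x : ℝ × ℝ) (hx : x ∈ segment ℝ (S.gluedPos B u) (S.gluedPos B v) ∩
      segment ℝ (S.gluedPos B u') (S.gluedPos B v')) :
    ∃ y, y ∈ s(u, v) ∧ y ∈ s(u', v') ∧ x = S.gluedPos B y := by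
  obtain ⟨hx, hx'⟩ := hx
  rcases h with ⟨a, b, hab, rfl, rfl⟩ | ⟨e, he⟩ <;> rcases h' with ⟨a', b', hab', rfl, rfl⟩ | ⟨e', he'⟩
  · rw [gluedPos_inner, gluedPos_inner] at hx hx'
    obtain ⟨q, hq, rfl⟩ := S.mem_segment_shrink hx
    obtain ⟨q', hq', h⟩ := S.mem_segment_shrink hx'
    obtain rfl := S.shrink_injective h
    have hne' : s(a, b) ≠ s(a', b') := fun h => hne (by
      rcases Sym2.eq_iff.1 h with ⟨rfl, rfl⟩ | ⟨rfl, rfl⟩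
      · rfl
      · exact Sym2.eq_swap)
    obtain ⟨y, hy, hy', rfl⟩ := B.edges_disjoint a b a' b' hab hab' hne' q ⟨hq, hq'⟩
    refine ⟨S.inner B y, ?_, ?_, (S.gluedPos_inner B y).symm⟩
    · rcases Sym2.mem_iff.1 hy with rfl | rfl
      · exact Sym2.mem_mk_left _ _
      · exact Sym2.mem_mk_right _ _
    · rcases Sym2.mem_iff.1 hy' with rfl | rfl
      · exact Sym2.mem_mk_left _ _
      · exact Sym2.mem_mk_right _ _
  · rw [← segment_congr (S.gluedPos B) he', gluedPos_outer, gluedPos_outer] at hx'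
    obtain ⟨y, h1, h2, h3⟩ := inner_outer_disjoint hS hab e' hx hx'
    exact ⟨y, h1, he' ▸ h2, h3⟩
  · rw [← segment_congr (S.gluedPos B) he, gluedPos_outer, gluedPos_outer] at hx
    obtain ⟨y, h1, h2, h3⟩ := inner_outer_disjoint hS hab' e hx' hx
    exact ⟨y, he ▸ h2, h1, h3⟩
  · rw [← segment_congr (S.gluedPos B) he, gluedPos_outer, gluedPos_outer] at hx
    rw [← segment_congr (S.gluedPos B) he', gluedPos_outer, gluedPos_outer] at hx'
    have hee : e ≠ e' := by
      rintro rfl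
      exact hne (he.symm.trans he')
    obtain ⟨y, h1, h2, h3⟩ := hS.edges_disjoint e e' hee x hx hx'
    refine ⟨S.outer B y, ?_, ?_, by rw [gluedPos_outer]; exact h3⟩
    · rw [← he]
      rcases h1 with rfl | rfl
      · exact Sym2.mem_mk_left _ _
      · exact Sym2.mem_mk_right _ _
    · rw [← he']
      rcases h2 with rfl | rfl
      · exact Sym2.mem_mk_left _ _
      · exact Sym2.mem_mk_right _ _

variable (S B) in
theorem gluedPos_injective : Function.Injective (S.gluedPos B) := by
  intro x y h
  have key : ∀ (u : TangleVertex B.W B.K) (v : TangleVertex S.W S.K),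
      S.gluedPos B (S.inner B u) ≠ S.gluedPos B (S.outer B (.inr v)) := by
    intro u v h
    rw [gluedPos_inner, gluedPos_outer] at h
    have h1 := S.pos_outside v
    change S.shrink _ = S.pos v at h
    rw [← h, normSq_shrink_sub] at h1
    nlinarith [S.rot_ne, B.normSq_pos_le u]
  rcases S.exists_inner_or_outer B x with ⟨u, rfl⟩ | ⟨u, rfl⟩ <;>
    rcases S.exists_inner_or_outer B y with ⟨v, rfl⟩ | ⟨v, rfl⟩
  · rw [gluedPos_inner, gluedPos_inner] at h
    rw [B.pos_injective (S.shrink_injective h)]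
  · exact absurd h (key _ _)
  · exact absurd h.symm (key _ _)
  · rw [gluedPos_outer, gluedPos_outer] at h
    rw [S.pos_injective h]

/-- A similarity scales determinants by the positive factor |rot|², so the cyclic order at inserted
crossings survives. -/
theorem shrink_det (p q c : ℝ × ℝ) :
    ((S.shrink p).1 - (S.shrink c).1) * ((S.shrink q).2 - (S.shrink c).2) -
      ((S.shrink p).2 - (S.shrink c).2) * ((S.shrink q).1 - (S.shrink c).1) =
    (S.rot.1 ^ 2 + S.rot.2 ^ 2) * ((p.1 - c.1) * (q.2 - c.2) - (p.2 - c.2) * (q.1 - c.1)) := by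
  simp only [shrink]
  ring

variable (B) in
/-- The neighbours of the crossings of the glued diagram. -/
def gluedNbr : B.K ⊕ S.K → Fin 4 → S.GluedVertex B
  | .inl c, i => S.inner B (B.nbr c i)
  | .inr c, i => S.outer B (S.nbr c i)

/-- The diagram obtained by inserting a diagram into the inner disc of an outer piece. -/
def glue (hS : S.IsPlane) (B : BallTangleDiagram) : BallTangleDiagram where
  W := B.W ⊕ Corner ⊕ S.W
  K := B.K ⊕ S.K
  finiteW := have := B.finiteW; inferInstance
  pos := S.gluedPos B
  G := S.gluedGraph B
  nbr := S.gluedNbr B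
  pos_injective := S.gluedPos_injective B
  pos_endpoint := S.pos_endpoint
  pos_bend := by
    rintro (w | p | w)
    · exact S.inner_disc _ (B.pos_bend w).le
    · exact S.inner_disc _ (by rw [← B.pos_endpoint]; exact B.normSq_pos_le _)
    · exact S.pos_bend w
  pos_crossing := by
    rintro (c | c)
    · exact S.inner_disc _ (B.pos_crossing c).le
    · exact S.pos_crossing c
  edges_disjoint := glued_edges_disjoint hS
  degree_endpoint := by
    intro p
    obtain ⟨v, hv⟩ := S.endpoint_adj p
    rw [Set.ncard_eq_one]
    refine ⟨S.outer B v, Set.ext fun y => ?_⟩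
    refine (S.gluedAdj_outer_iff (v := .endpoint p)).trans ?_
    simp only [hv, exists_eq_right]
    rfl
  degree_bend := by
    have himage : ∀ (u : TangleVertex B.W B.K), (∀ p, u ≠ .endpoint p) →
        (S.gluedGraph B).neighborSet (S.inner B u) = S.inner B '' B.G.neighborSet u := by
      intro u hu
      ext y
      refine (S.gluedAdj_inner_iff hu).trans ?_
      simp only [Set.mem_image, SimpleGraph.mem_neighborSet]
      exact exists_congr fun v => ⟨fun h => ⟨h.2, h.1.symm⟩, fun h => ⟨h.2.symm, h.1⟩⟩
    rintro (w | p | w)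
    · rw [← B.degree_bend w]
      refine (congrArg Set.ncard (himage (.bend w) (by simp))).trans ?_
      exact Set.ncard_image_of_injective _ (S.inner_injective B)
    · obtain ⟨v, hv⟩ := S.inner_adj p
      obtain ⟨u, hu⟩ := B.exists_neighborSet_endpoint p
      rw [Set.ncard_eq_two]
      refine ⟨S.inner B u, S.outer B (.inr v), ?_, Set.ext fun y => ?_⟩
      · intro h
        obtain ⟨q, _, hq⟩ := (S.inner_eq_outer_iff B).1 h
        cases hq
      · refine (S.gluedAdj_inner_endpoint_iff (p := p)).trans ?_
        have hadj : ∀ x, B.G.Adj (.endpoint p) x ↔ x = u := fun x => by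
          rw [← SimpleGraph.mem_neighborSet, hu, Set.mem_singleton_iff]
        simp only [hv, hadj, Sum.inr.injEq, exists_eq_right]
        rfl
    · obtain ⟨v, v', hne, hv⟩ := S.bend_adj w
      rw [Set.ncard_eq_two]
      refine ⟨S.outer B v, S.outer B v', fun h => hne (S.outer_injective B h), Set.ext fun y => ?_⟩
      refine (S.gluedAdj_outer_iff (v := .bend w)).trans ?_
      simp only [hv, and_or_left, exists_or, exists_eq_right]
      rfl
  neighbors_crossing := by
    rintro (c | c)
    · ext y
      refine (S.gluedAdj_inner_iff (u := .crossing c) (by simp)).trans ?_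
      simp only [← SimpleGraph.mem_neighborSet, B.neighbors_crossing, Set.mem_range]
      constructor
      · rintro ⟨_, rfl, i, rfl⟩
        exact ⟨i, rfl⟩
      · rintro ⟨i, rfl⟩
        exact ⟨_, rfl, i, rfl⟩
    · ext y
      refine (S.gluedAdj_outer_iff (v := .crossing c)).trans ?_
      simp only [S.crossing_adj, Set.mem_range]
      constructor
      · rintro ⟨_, rfl, i, rfl⟩
        exact ⟨i, rfl⟩
      · rintro ⟨i, rfl⟩
        exact ⟨_, rfl, i, rfl⟩
  over_straight := by
    rintro (c | c)
    · simp only [gluedNbr, gluedPos_inner]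
      exact S.shrink_mem_openSegment (B.over_straight c)
    · simp only [gluedNbr, gluedPos_outer]
      exact hS.over_straight c
  under_straight := by
    rintro (c | c)
    · simp only [gluedNbr, gluedPos_inner]
      exact S.shrink_mem_openSegment (B.under_straight c)
    · simp only [gluedNbr, gluedPos_outer]
      exact hS.under_straight c
  counterclockwise := by
    rintro (c | c)
    · simp only [gluedNbr, gluedPos_inner]
      change 0 < (_ - (S.shrink _).1) * (_ - (S.shrink _).2) - (_ - (S.shrink _).2) * (_ - (S.shrink _).1)
      rw [shrink_det]
      exact mul_pos S.rot_ne (B.counterclockwise c)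
    · simp only [gluedNbr, gluedPos_outer]
      exact hS.counterclockwise c

end OuterPiece

/-! ### Circles of a glued diagram. -/

namespace OuterPiece

variable {S : OuterPiece} (hS : S.IsPlane) {B : BallTangleDiagram}

/-- A half-edge of the inserted diagram, in the glued one. -/
def innerDart (d : B.G.Dart) : (glue hS B).G.Dart :=
  ⟨(S.inner B d.fst, S.inner B d.snd), Or.inl ⟨_, _, d.adj, rfl, rfl⟩⟩

variable (B) in
/-- An edge of the outer piece, in the glued diagram. -/
def outerDart (e : S.E) : (glue hS B).G.Dart :=
  ⟨(S.outer B (S.ends e).1, S.outer B (S.ends e).2), Or.inr ⟨e, rfl⟩⟩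

variable {hS} in
theorem dart_cases (x : (glue hS B).G.Dart) :
    (∃ d, innerDart hS d = x) ∨ ∃ e, outerDart hS B e = x ∨ (outerDart hS B e).symm = x := by
  rcases x with ⟨⟨a, b⟩, ⟨u, v, h, h1, h2⟩ | ⟨e, h⟩⟩
  · exact Or.inl ⟨⟨(u, v), h⟩, BallTangleDiagram.dart_ext h1.symm h2.symm⟩
  · refine Or.inr ⟨e, ?_⟩
    rcases Sym2.eq_iff.1 h with ⟨h1, h2⟩ | ⟨h1, h2⟩
    · exact Or.inl (BallTangleDiagram.dart_ext h1 h2)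
    · exact Or.inr (BallTangleDiagram.dart_ext h2 h1)

theorem innerDart_injective : Function.Injective (innerDart hS : B.G.Dart → _) := fun _ _ h =>
  BallTangleDiagram.dart_ext
    (S.inner_injective B (congrArg (fun x : (glue hS B).G.Dart => x.fst) h))
    (S.inner_injective B (congrArg (fun x : (glue hS B).G.Dart => x.snd) h))

/-- By `inner_adj` an outer edge never joins two inner end points. So an inserted edge and an outer
edge cannot become the same edge after gluing. -/
theorem not_inner_edge (e : S.E) {u v : TangleVertex B.W B.K} (h1 : S.inner B u = S.outer B (S.ends e).1)
    (h2 : S.inner B v = S.outer B (S.ends e).2) : False := by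
  obtain ⟨p, _, hp⟩ := (S.inner_eq_outer_iff B).1 h1
  obtain ⟨q, _, hq⟩ := (S.inner_eq_outer_iff B).1 h2
  obtain ⟨w, hw⟩ := S.inner_adj p
  cases (hw (.inl q)).1 ⟨e, by rw [hp, hq]⟩

theorem innerDart_ne_outerDart (d : B.G.Dart) (e : S.E) : innerDart hS d ≠ outerDart hS B e := fun h =>
  not_inner_edge e (congrArg (fun x : (glue hS B).G.Dart => x.fst) h)
    (congrArg (fun x : (glue hS B).G.Dart => x.snd) h)

theorem innerDart_ne_outerDart_symm (d : B.G.Dart) (e : S.E) :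
    innerDart hS d ≠ (outerDart hS B e).symm := fun h =>
  not_inner_edge e (congrArg (fun x : (glue hS B).G.Dart => x.snd) h)
    (congrArg (fun x : (glue hS B).G.Dart => x.fst) h)

theorem eq_of_outerDart {e e' : S.E}
    (h : outerDart hS B e = outerDart hS B e' ∨ outerDart hS B e = (outerDart hS B e').symm) :
    e = e' := by
  apply S.ends_injective
  rw [Sym2.eq_iff]
  rcases h with h | h
  · exact Or.inl ⟨S.outer_injective B (congrArg (fun x : (glue hS B).G.Dart => x.fst) h),
      S.outer_injective B (congrArg (fun x : (glue hS B).G.Dart => x.snd) h)⟩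
  · exact Or.inr ⟨S.outer_injective B (congrArg (fun x : (glue hS B).G.Dart => x.fst) h),
      S.outer_injective B (congrArg (fun x : (glue hS B).G.Dart => x.snd) h)⟩

/-- Inserted half-edges and the two directions of outer edges exhaust the glued half-edges without
overlap, so values on the two sorts can be prescribed independently. -/
theorem exists_dart_function {Q : Type*} (gi : B.G.Dart → Q) (go : S.E → Q) :
    ∃ g : (glue hS B).G.Dart → Q, (∀ d, g (innerDart hS d) = gi d) ∧
      ∀ e, g (outerDart hS B e) = go e ∧ g (outerDart hS B e).symm = go e := by
  classical
  let g : (glue hS B).G.Dart → Q := fun x =>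
    if h : ∃ d, innerDart hS d = x then gi h.choose
    else go ((dart_cases x).resolve_left h).choose
  have hg : ∀ e x, (outerDart hS B e = x ∨ (outerDart hS B e).symm = x) → g x = go e := by
    intro e x hx
    have h : ¬ ∃ d, innerDart hS d = x := by
      rintro ⟨d, rfl⟩
      rcases hx with hx | hx
      · exact innerDart_ne_outerDart hS d e hx.symm
      · exact innerDart_ne_outerDart_symm hS d e hx.symm
    simp only [g, h, dif_neg, not_false_eq_true]
    congr 1
    have h2 := ((dart_cases x).resolve_left h).choose_spec
    generalize ((dart_cases x).resolve_left h).choose = e' at h2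
    apply eq_of_outerDart hS (B := B)
    rcases hx with rfl | rfl <;> rcases h2 with h2 | h2
    · exact Or.inl h2
    · exact Or.inr (by rw [← h2, SimpleGraph.Dart.symm_symm])
    · exact Or.inr h2
    · exact Or.inl (SimpleGraph.Dart.symm_involutive.injective h2)
  refine ⟨g, fun d => ?_, fun e => ⟨hg e _ (Or.inl rfl), hg e _ (Or.inr rfl)⟩⟩
  have h : ∃ d', innerDart hS d' = innerDart hS d := ⟨d, rfl⟩
  simp only [g, h, dif_pos]
  congr 1
  exact innerDart_injective hS h.choose_spec

variable (S) in
/-- The vertex `v` is an end of the edge `e`. -/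
def Incident (e : S.E) (v : Corner ⊕ TangleVertex S.W S.K) : Prop :=
  ∃ y, s((S.ends e).1, (S.ends e).2) = s(v, y)

variable (S) in
/-- Edges of an outer piece that are connected at a vertex of it or by an arc of the closure, in a state. -/
def Consecutive (cl : TangleClosure) (τ : S.K → Splitting) (e e' : S.E) : Prop :=
  (∃ w, S.Incident e (.inr (.bend w)) ∧ S.Incident e' (.inr (.bend w))) ∨
  (∃ c i, s((S.ends e).1, (S.ends e).2) = s(.inr (.crossing c), S.nbr c i) ∧
    s((S.ends e').1, (S.ends e').2) = s(.inr (.crossing c), S.nbr c ((τ c).partner i))) ∨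
  ∃ p, S.Incident e (.inr (.endpoint p)) ∧ S.Incident e' (.inr (.endpoint (cl.partner p)))

theorem outer_dart_of_fst {x : (glue hS B).G.Dart} {v : Corner ⊕ TangleVertex S.W S.K}
    (hx : x.fst = S.outer B v) :
    (∃ d p, innerDart hS d = x ∧ v = .inl p ∧ d.fst = .endpoint p) ∨
      ∃ e y, s((S.ends e).1, (S.ends e).2) = s(v, y) ∧ x.snd = S.outer B y ∧
        (outerDart hS B e = x ∨ (outerDart hS B e).symm = x) := by
  rcases dart_cases x with ⟨d, rfl⟩ | ⟨e, rfl | rfl⟩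
  · obtain ⟨p, h1, h2⟩ := (S.inner_eq_outer_iff B).1 hx
    exact Or.inl ⟨d, p, rfl, h2, h1⟩
  · refine Or.inr ⟨e, (S.ends e).2, ?_, rfl, Or.inl rfl⟩
    rw [S.outer_injective B hx]
  · refine Or.inr ⟨e, (S.ends e).1, ?_, rfl, Or.inr rfl⟩
    rw [← S.outer_injective B hx]
    exact Sym2.eq_swap

theorem inner_dart_of_fst {x : (glue hS B).G.Dart} {u : TangleVertex B.W B.K}
    (hu : ∀ p, u ≠ .endpoint p) (hx : x.fst = S.inner B u) :
    ∃ d, innerDart hS d = x ∧ d.fst = u := by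
  have key : ∀ v, S.outer B v ≠ S.inner B u := by
    intro v h
    obtain ⟨p, h1, -⟩ := (S.inner_eq_outer_iff B).1 h.symm
    exact hu p h1
  rcases dart_cases x with ⟨d, rfl⟩ | ⟨e, rfl | rfl⟩
  · exact ⟨d, rfl, S.inner_injective B hx⟩
  · exact absurd hx (key _)
  · exact absurd hx (key _)

/-- Functions that are constant on the circles of a state of the glued diagram. -/
theorem exists_lift (cl : TangleClosure) (σ : B.State) (τ : S.K → Splitting) {Q : Type*}
    (gi : B.G.Dart → Q) (go : S.E → Q) (hsymm : ∀ d, gi d.symm = gi d)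
    (hbend : ∀ w d e, d.fst = .bend w → e.fst = .bend w → gi d = gi e)
    (hcross : ∀ c i d e, d.fst = .crossing c → e.fst = .crossing c → d.snd = B.nbr c i →
      e.snd = B.nbr c ((σ c).partner i) → gi d = gi e)
    (hend : ∀ p d e, d.fst = .endpoint p → S.Incident e (.inl p) → gi d = go e)
    (hgo : ∀ e e', S.Consecutive cl τ e e' → go e = go e') :
    ∃ g : Quot ((glue hS B).Connects cl (Sum.elim σ τ)) → Q,
      (∀ d, g (Quot.mk _ (innerDart hS d)) = gi d) ∧ ∀ e, g (Quot.mk _ (outerDart hS B e)) = go e := by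
  obtain ⟨g, hg1, hg2⟩ := exists_dart_function hS gi go
  have hgo' : ∀ {e x}, (outerDart hS B e = x ∨ (outerDart hS B e).symm = x) → g x = go e := by
    rintro e x (rfl | rfl)
    · exact (hg2 e).1
    · exact (hg2 e).2
  have houter : ∀ {x : (glue hS B).G.Dart} {v : TangleVertex S.W S.K}, x.fst = S.outer B (.inr v) →
      ∃ e y, s((S.ends e).1, (S.ends e).2) = s(.inr v, y) ∧ x.snd = S.outer B y ∧ g x = go e := by
    intro x v hx
    rcases outer_dart_of_fst hS hx with ⟨d, p, _, h, _⟩ | ⟨e, y, h1, h2, h3⟩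
    · cases h
    · exact ⟨e, y, h1, h2, hgo' h3⟩
  suffices h : ∀ x y, (glue hS B).Connects cl (Sum.elim σ τ) x y → g x = g y from
    ⟨Quot.lift g h, hg1, fun e => (hg2 e).1⟩
  rintro x y (_ | ⟨w, _, _, hx, hy⟩ | ⟨c, i, _, _, hx, hy, hxi, hyi⟩ | ⟨p, _, _, hx, hy⟩)
  · rcases dart_cases x with ⟨d, rfl⟩ | ⟨e, rfl | rfl⟩
    · change g _ = g (innerDart hS d.symm)
      rw [hg1, hg1, hsymm]
    · rw [(hg2 e).1, (hg2 e).2]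
    · rw [SimpleGraph.Dart.symm_symm, (hg2 e).1, (hg2 e).2]
  · rcases w with w | p | w
    · obtain ⟨d, rfl, hd⟩ := inner_dart_of_fst hS (u := .bend w) (by simp) hx
      obtain ⟨d', rfl, hd'⟩ := inner_dart_of_fst hS (u := .bend w) (by simp) hy
      rw [hg1, hg1]
      exact hbend w d d' hd hd'
    -- Only at the bend replacing an inner end point do the two sorts of half-edges meet; `hend`
    -- says that their values agree there.
    · have key : ∀ x : (glue hS B).G.Dart, x.fst = S.outer B (.inl p) → g x = gi (B.endDart p) := by
        intro x hx
        rcases outer_dart_of_fst hS hx with ⟨d, q, rfl, h, hd⟩ | ⟨e, z, h1, h2, h3⟩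
        · cases h
          rw [hg1, B.eq_endDart hd]
        · rw [hgo' h3]
          exact (hend p _ e (B.endDart_fst p) ⟨z, h1⟩).symm
      rw [key x hx, key y hy]
    · obtain ⟨e, z, h1, h2, h3⟩ := houter (v := .bend w) hx
      obtain ⟨e', z', h1', h2', h3'⟩ := houter (v := .bend w) hy
      rw [h3, h3']
      exact hgo _ _ (Or.inl ⟨w, ⟨z, h1⟩, ⟨z', h1'⟩⟩)
  · rcases c with c | c
    · obtain ⟨d, rfl, hd⟩ := inner_dart_of_fst hS (u := .crossing c) (by simp) hx
      obtain ⟨d', rfl, hd'⟩ := inner_dart_of_fst hS (u := .crossing c) (by simp) hy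
      rw [hg1, hg1]
      exact hcross c i d d' hd hd' (S.inner_injective B hxi) (S.inner_injective B hyi)
    · obtain ⟨e, z, h1, h2, h3⟩ := houter (v := .crossing c) hx
      obtain ⟨e', z', h1', h2', h3'⟩ := houter (v := .crossing c) hy
      rw [h3, h3']
      obtain rfl : z = S.nbr c i := S.outer_injective B (h2.symm.trans hxi)
      obtain rfl : z' = S.nbr c ((τ c).partner i) := S.outer_injective B (h2'.symm.trans hyi)
      exact hgo _ _ (Or.inr (Or.inl ⟨c, i, h1, h1'⟩))
  · obtain ⟨e, z, h1, h2, h3⟩ := houter (v := .endpoint p) hx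
    obtain ⟨e', z', h1', h2', h3'⟩ := houter (v := .endpoint (cl.partner p)) hy
    rw [h3, h3']
    exact hgo _ _ (Or.inr (Or.inr ⟨p, ⟨z, h1⟩, ⟨z', h1'⟩⟩))

section Quotient

variable (cl : TangleClosure) (σ : B.State) (τ : S.K → Splitting)

theorem exists_dart_mk_eq {e : S.E} {v y : Corner ⊕ TangleVertex S.W S.K}
    (h : s((S.ends e).1, (S.ends e).2) = s(v, y)) :
    ∃ x : (glue hS B).G.Dart, x.fst = S.outer B v ∧ x.snd = S.outer B y ∧
      (Quot.mk ((glue hS B).Connects cl (Sum.elim σ τ)) x) = Quot.mk _ (outerDart hS B e) := by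
  rcases Sym2.eq_iff.1 h with ⟨rfl, rfl⟩ | ⟨rfl, rfl⟩
  · exact ⟨outerDart hS B e, rfl, rfl, rfl⟩
  · exact ⟨(outerDart hS B e).symm, rfl, rfl, (Quot.sound (.edge _)).symm⟩

theorem mk_outerDart_eq {e e' : S.E} (h : S.Consecutive cl τ e e') :
    (Quot.mk ((glue hS B).Connects cl (Sum.elim σ τ)) (outerDart hS B e)) =
      Quot.mk _ (outerDart hS B e') := by
  rcases h with ⟨w, ⟨y, h1⟩, ⟨y', h1'⟩⟩ | ⟨c, i, h1, h1'⟩ | ⟨p, ⟨y, h1⟩, ⟨y', h1'⟩⟩ <;>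
    obtain ⟨x, hx, hxy, h⟩ := exists_dart_mk_eq hS cl σ τ h1 <;>
    obtain ⟨x', hx', hxy', h'⟩ := exists_dart_mk_eq hS cl σ τ h1' <;> rw [← h, ← h']
  · exact Quot.sound (.bend (show (glue hS B).W from Sum.inr (Sum.inr w)) _ _ hx hx')
  · exact Quot.sound (.crossing (show (glue hS B).K from Sum.inr c) i _ _ hx hx' hxy hxy')
  · exact Quot.sound (.closure p _ _ hx hx')

theorem mk_innerDart_eq {d : B.G.Dart} {e : S.E} {p : Corner} (hd : d.fst = .endpoint p)
    (he : S.Incident e (.inl p)) :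
    (Quot.mk ((glue hS B).Connects cl (Sum.elim σ τ)) (innerDart hS d)) =
      Quot.mk _ (outerDart hS B e) := by
  obtain ⟨y, h1⟩ := he
  obtain ⟨x, hx, hxy, h⟩ := exists_dart_mk_eq hS cl σ τ h1
  rw [← h]
  refine Quot.sound (.bend (show (glue hS B).W from Sum.inr (Sum.inl p)) _ _ ?_ hx)
  change S.inner B d.fst = _
  rw [hd]
  rfl

theorem mk_outerDart_eq_of_eqvGen {e e' : S.E} (h : Relation.EqvGen (S.Consecutive cl τ) e e') :
    (Quot.mk ((glue hS B).Connects cl (Sum.elim σ τ)) (outerDart hS B e)) =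
      Quot.mk _ (outerDart hS B e') := by
  induction h with
  | rel _ _ h => exact mk_outerDart_eq hS cl σ τ h
  | refl _ => rfl
  | symm _ _ _ ih => exact ih.symm
  | trans _ _ _ _ _ ih1 ih2 => exact ih1.trans ih2

/-- If, in a state and a closure, an outer piece connects the inner end points like a closure `cl'`,
without further circles, then the glued diagram has as many circles as the closure `cl'` of the
inserted one. The function `lam` selects for every edge an inner end point on the same arc. -/
theorem circles_glue_eq (cl' : TangleClosure) (lam : S.E → Corner)
    (h1 : ∀ e p, S.Incident e (.inl p) → lam e = p ∨ lam e = cl'.partner p)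
    (h2 : ∀ e e', S.Consecutive cl τ e e' → lam e = lam e' ∨ lam e = cl'.partner (lam e'))
    (h3 : ∀ e, ∃ e', S.Incident e' (.inl (lam e)) ∧ Relation.EqvGen (S.Consecutive cl τ) e e')
    (h4 : ∀ p, ∃ e e', S.Incident e (.inl p) ∧ S.Incident e' (.inl (cl'.partner p)) ∧
      Relation.EqvGen (S.Consecutive cl τ) e e') :
    (glue hS B).circles cl (Sum.elim σ τ) = B.circles cl' σ := by
  have hpartner : ∀ p q, p = q ∨ p = cl'.partner q →
      Quot.mk (B.Connects cl' σ) (B.endDart p) = Quot.mk _ (B.endDart q) := by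
    rintro p q (rfl | rfl)
    · rfl
    · exact (Quot.sound (.closure q _ _ (B.endDart_fst _) (B.endDart_fst _))).symm
  -- `g` retracts circles of the glued diagram to circles of the closure `cl'`, sending an outer
  -- edge to the class of the corner `lam`. It gives injectivity of the map induced by `innerDart`;
  -- `h4` makes that map well defined and `h3` makes it onto.
  obtain ⟨g, hg1, hg2⟩ := exists_lift hS cl σ τ (Quot.mk (B.Connects cl' σ))
    (fun e => Quot.mk _ (B.endDart (lam e))) (fun d => (Quot.sound (.edge d)).symm)
    (fun w d e hd he => Quot.sound (.bend w d e hd he))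
    (fun c i d e hd he hdi hei => Quot.sound (.crossing c i d e hd he hdi hei))
    (fun p d e hd he => by
      rw [B.eq_endDart hd]
      exact (hpartner _ _ (h1 e p he)).symm)
    (fun e e' h => hpartner _ _ (h2 e e' h))
  symm
  refine Nat.card_eq_of_bijective (Quot.lift
    (fun d => Quot.mk ((glue hS B).Connects cl (Sum.elim σ τ)) (innerDart hS d)) ?_) ⟨?_, ?_⟩
  · rintro d d' (_ | ⟨w, _, _, hd, hd'⟩ | ⟨c, i, _, _, hd, hd', hdi, hdi'⟩ | ⟨p, _, _, hd, hd'⟩)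
    · exact Quot.sound (.edge (innerDart hS d))
    · exact Quot.sound (.bend (show (glue hS B).W from Sum.inl w) _ _ (congrArg (S.inner B) hd) (congrArg (S.inner B) hd'))
    · exact Quot.sound (.crossing (show (glue hS B).K from Sum.inl c) i _ _ (congrArg (S.inner B) hd) (congrArg (S.inner B) hd')
        (congrArg (S.inner B) hdi) (congrArg (S.inner B) hdi'))
    · obtain ⟨e, e', he, he', hee⟩ := h4 p
      exact (mk_innerDart_eq hS cl σ τ hd he).trans
        ((mk_outerDart_eq_of_eqvGen hS cl σ τ hee).trans (mk_innerDart_eq hS cl σ τ hd' he').symm)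
  · rintro ⟨d⟩ ⟨d'⟩ h
    have := congrArg g h
    rwa [hg1, hg1] at this
  · rintro ⟨x⟩
    have houter : ∀ e, ∃ d, Quot.mk ((glue hS B).Connects cl (Sum.elim σ τ)) (innerDart hS d) =
        Quot.mk _ (outerDart hS B e) := by
      intro e
      obtain ⟨e', he', hee⟩ := h3 e
      exact ⟨B.endDart (lam e), (mk_innerDart_eq hS cl σ τ (B.endDart_fst _) he').trans
        (mk_outerDart_eq_of_eqvGen hS cl σ τ hee).symm⟩
    rcases dart_cases x with ⟨d, rfl⟩ | ⟨e, rfl | rfl⟩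
    · exact ⟨Quot.mk _ d, rfl⟩
    · obtain ⟨d, hd⟩ := houter e
      exact ⟨Quot.mk _ d, hd⟩
    · obtain ⟨d, hd⟩ := houter e
      exact ⟨Quot.mk _ d, hd.trans (Quot.sound (.edge _))⟩

/-- If, in a state and a closure, some edges of an outer piece form circles by themselves, then the
glued diagram has several circles. -/
theorem circles_glue_ne_one (f : S.E → Bool)
    (h1 : ∀ e p, S.Incident e (.inl p) → f e = false)
    (h2 : ∀ e e', S.Consecutive cl τ e e' → f e = f e') (h3 : ∃ e, f e = true) :
    (glue hS B).circles cl (Sum.elim σ τ) ≠ 1 := by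
  obtain ⟨g, hg1, hg2⟩ := exists_lift hS cl σ τ (fun _ => false) f (fun _ => rfl)
    (fun _ _ _ _ _ => rfl) (fun _ _ _ _ _ _ _ _ => rfl) (fun p _ e _ he => (h1 e p he).symm) h2
  obtain ⟨e, he⟩ := h3
  intro h
  have := (Nat.card_eq_one_iff_unique.1 h).1
  have h4 := congrArg g (Subsingleton.elim (Quot.mk _ (innerDart hS (B.endDart .NW)))
    (Quot.mk _ (outerDart hS B e)))
  rw [hg1, hg2, he] at h4
  cases h4

end Quotient

end OuterPiece

/-! ### The crossing, cap and turn pieces, with their finite incidence data. -/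

instance {W K : Type} [DecidableEq W] [DecidableEq K] : DecidableEq (TangleVertex W K)
  | .endpoint p, .endpoint q => decidable_of_iff (p = q) (by simp)
  | .bend v, .bend w => decidable_of_iff (v = w) (by simp)
  | .crossing c, .crossing d => decidable_of_iff (c = d) (by simp)
  | .endpoint _, .bend _ => isFalse (by simp)
  | .endpoint _, .crossing _ => isFalse (by simp)
  | .bend _, .endpoint _ => isFalse (by simp)
  | .bend _, .crossing _ => isFalse (by simp)
  | .crossing _, .endpoint _ => isFalse (by simp)
  | .crossing _, .bend _ => isFalse (by simp)

instance {W K : Type} [Fintype W] [Fintype K] : Fintype (TangleVertex W K) :=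
  Fintype.ofEquiv (Corner ⊕ W ⊕ K)
    { toFun := fun
        | .inl p => .endpoint p
        | .inr (.inl w) => .bend w
        | .inr (.inr c) => .crossing c
      invFun := fun
        | .endpoint p => .inl p
        | .bend w => .inr (.inl w)
        | .crossing c => .inr (.inr c)
      left_inv := by rintro (_ | _ | _) <;> rfl
      right_inv := by rintro (_ | _ | _) <;> rfl }

namespace OuterPiece

variable (S : OuterPiece)

theorem incident_iff (e : S.E) (v : Corner ⊕ TangleVertex S.W S.K) :
    S.Incident e v ↔ (S.ends e).1 = v ∨ (S.ends e).2 = v := by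
  simp only [Incident, Sym2.eq_iff]
  constructor
  · rintro ⟨y, h | h⟩
    · exact Or.inl h.1
    · exact Or.inr h.2
  · rintro (h | h)
    · exact ⟨_, Or.inl ⟨h, rfl⟩⟩
    · exact ⟨_, Or.inr ⟨rfl, h⟩⟩

instance [DecidableEq S.W] (e : S.E) (v : Corner ⊕ TangleVertex S.W S.K) :
    Decidable (S.Incident e v) := decidable_of_iff _ (S.incident_iff e v).symm

instance [DecidableEq S.W] [Fintype S.W] (cl : TangleClosure) (τ : S.K → Splitting) (e e' : S.E) :
    Decidable (S.Consecutive cl τ e e') :=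
  inferInstanceAs (Decidable ((∃ w, S.Incident e (.inr (.bend w)) ∧ S.Incident e' (.inr (.bend w))) ∨
    (∃ c i, s((S.ends e).1, (S.ends e).2) = s(.inr (.crossing c), S.nbr c i) ∧
      s((S.ends e').1, (S.ends e').2) = s(.inr (.crossing c), S.nbr c ((τ c).partner i))) ∨
    ∃ p, S.Incident e (.inr (.endpoint p)) ∧ S.Incident e' (.inr (.endpoint (cl.partner p)))))

/-- A single crossing, placed to the right of the inner disc. -/
noncomputable abbrev crossingPiece : OuterPiece where
  W := Empty
  K := Unit
  E := Fin 6
  ends := ![(.inl .NW, .inr (.endpoint .NW)), (.inl .SW, .inr (.endpoint .SW)),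
    (.inl .NE, .inr (.crossing ())), (.inl .SE, .inr (.crossing ())),
    (.inr (.crossing ()), .inr (.endpoint .SE)), (.inr (.crossing ()), .inr (.endpoint .NE))]
  rot := (1 / 4, 0)
  center := (-3 / 4, 0)
  pos
    | .endpoint p => p.pos
    | .bend w => w.elim
    -- The inner corners on the right are (-1/2, ±1/4). The segments joining them to the diagonally
    -- opposite outer corners (1, ∓1) cross at this point.
    | .crossing _ => (-1 / 5, 0)
  nbr _ := ![.inr (.endpoint .NE), .inl .NE, .inl .SE, .inr (.endpoint .SE)]
  ends_ne := by decide
  ends_injective := by decide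
  rot_ne := by norm_num
  inner_disc := by
    rintro ⟨x, y⟩ h
    simp only at *
    nlinarith [sq_nonneg (x + 3), sq_nonneg y]
  pos_injective := by
    rintro (p | w | c) (q | w' | c') h
    · cases p <;> cases q <;> first | rfl | (exfalso; simp only [Corner.pos, Prod.mk.injEq] at h; norm_num at h)
    · exact w'.elim
    · exfalso; cases p <;> simp only [Corner.pos, Prod.mk.injEq] at h <;> norm_num at h
    · exact w.elim
    · exact w.elim
    · exact w.elim
    · exfalso; cases q <;> simp only [Corner.pos, Prod.mk.injEq] at h <;> norm_num at h
    · exact w'.elim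
    · rfl
  pos_endpoint _ := rfl
  pos_bend w := w.elim
  pos_crossing _ := by norm_num
  pos_outside := by
    rintro (p | w | c)
    · cases p <;> norm_num [Corner.pos]
    · exact w.elim
    · norm_num
  inner_adj := by decide
  endpoint_adj := by decide
  bend_adj w := w.elim
  crossing_adj := by decide

/-- A cap to the right of the inner disc, and an arc separated from it. -/
noncomputable abbrev capPiece : OuterPiece where
  W := Unit
  K := Empty
  E := Fin 5
  ends := ![(.inl .NW, .inr (.endpoint .NW)), (.inl .SW, .inr (.endpoint .SW)),
    (.inl .NE, .inr (.bend ())), (.inl .SE, .inr (.bend ())),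
    (.inr (.endpoint .NE), .inr (.endpoint .SE))]
  rot := (1 / 4, 0)
  center := (-3 / 4, 0)
  pos
    | .endpoint p => p.pos
    | .bend _ => (-1 / 5, 0)
    | .crossing c => c.elim
  nbr c := c.elim
  ends_ne := by decide
  ends_injective := by decide
  rot_ne := by norm_num
  inner_disc := by
    rintro ⟨x, y⟩ h
    simp only at *
    nlinarith [sq_nonneg (x + 3), sq_nonneg y]
  pos_injective := by
    rintro (p | w | c) (q | w' | c') h
    · cases p <;> cases q <;> first | rfl | (exfalso; simp only [Corner.pos, Prod.mk.injEq] at h; norm_num at h)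
    · exfalso; cases p <;> simp only [Corner.pos, Prod.mk.injEq] at h <;> norm_num at h
    · exact c'.elim
    · exfalso; cases q <;> simp only [Corner.pos, Prod.mk.injEq] at h <;> norm_num at h
    · rfl
    · exact c'.elim
    · exact c.elim
    · exact c.elim
    · exact c.elim
  pos_endpoint _ := rfl
  pos_bend _ := by norm_num
  pos_crossing c := c.elim
  pos_outside := by
    rintro (p | w | c)
    · cases p <;> norm_num [Corner.pos]
    · norm_num
    · exact c.elim
  inner_adj := by decide
  endpoint_adj := by decide
  bend_adj := by
    rintro ⟨⟩
    exact ⟨.inl .NE, .inl .SE, by decide, by decide⟩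
  crossing_adj c := c.elim

/-- The rotation of the corners by a quarter turn. -/
def _root_.Corner.turn : Corner → Corner
  | .NW => .SW
  | .SW => .SE
  | .SE => .NE
  | .NE => .NW

/-- Four radial edges around an inner disc that is rotated by a quarter turn. -/
noncomputable abbrev turnPiece : OuterPiece where
  W := Empty
  K := Empty
  E := Corner
  ends p := (.inl p, .inr (.endpoint p.turn))
  rot := (0, 1 / 2)
  center := (0, 0)
  pos
    | .endpoint p => p.pos
    | .bend w => w.elim
    | .crossing c => c.elim
  nbr c := c.elim
  ends_ne := by decide
  ends_injective := by decide
  rot_ne := by norm_num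
  inner_disc := by
    rintro ⟨x, y⟩ h
    simp only at *
    nlinarith [sq_nonneg x, sq_nonneg y]
  pos_injective := by
    rintro (p | w | c) (q | w' | c') h
    · cases p <;> cases q <;> first | rfl | (exfalso; simp only [Corner.pos, Prod.mk.injEq] at h; norm_num at h)
    · exact w'.elim
    · exact c'.elim
    · exact w.elim
    · exact w.elim
    · exact w.elim
    · exact c.elim
    · exact c.elim
    · exact c.elim
  pos_endpoint _ := rfl
  pos_bend w := w.elim
  pos_crossing c := c.elim
  pos_outside := by
    rintro (p | w | c)
    · cases p <;> norm_num [Corner.pos]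
    · exact w.elim
    · exact c.elim
  inner_adj := by decide
  endpoint_adj := by decide
  bend_adj w := w.elim
  crossing_adj c := c.elim

end OuterPiece

/-! ### Planarity of the three pieces. -/

namespace OuterPiece

theorem exists_param_of_mem_segment {p q x : ℝ × ℝ} (h : x ∈ segment ℝ p q) :
    ∃ t, 0 ≤ t ∧ t ≤ 1 ∧ x.1 = p.1 + t * (q.1 - p.1) ∧ x.2 = p.2 + t * (q.2 - p.2) := by
  obtain ⟨a, b, ha, hb, hab, rfl⟩ := h
  obtain rfl : a = 1 - b := by linarith
  exact ⟨b, hb, by linarith, by simp; ring, by simp; ring⟩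

theorem crossingPiece_isPlane : crossingPiece.IsPlane where
  edge_outside := by
    intro e x hx
    obtain ⟨t, ht0, ht1, h1, h2⟩ := exists_param_of_mem_segment hx
    -- An edge with an inner end point lists it first, so contact with the inner disc can occur only
    -- at parameter 0.
    rcases ht0.eq_or_lt with rfl | ht
    · fin_cases e
      · exact Or.inr ⟨.NW, Or.inl rfl, Prod.ext (by rw [h1]; simp) (by rw [h2]; simp)⟩
      · exact Or.inr ⟨.SW, Or.inl rfl, Prod.ext (by rw [h1]; simp) (by rw [h2]; simp)⟩
      · exact Or.inr ⟨.NE, Or.inl rfl, Prod.ext (by rw [h1]; simp) (by rw [h2]; simp)⟩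
      · exact Or.inr ⟨.SE, Or.inl rfl, Prod.ext (by rw [h1]; simp) (by rw [h2]; simp)⟩
      all_goals
        left
        simp [place, crossingPiece] at h1 h2
        rw [h1, h2]
        norm_num
    · left
      fin_cases e <;>
        simp [place, shrink, Corner.pos, crossingPiece] at h1 h2 <;> rw [h1, h2] <;> simp <;> nlinarith
  edges_disjoint := by
    intro e e' hne x hx hx'
    obtain ⟨t, ht0, ht1, h1, h2⟩ := exists_param_of_mem_segment hx
    obtain ⟨t', ht0', ht1', h1', h2'⟩ := exists_param_of_mem_segment hx'
    clear hx hx'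
    -- Equality of two points on given edges is linear in the two parameters. It is contradictory
    -- unless both edges end at the crossing, and then it forces that point.
    fin_cases e <;> fin_cases e' <;> first
      | exact absurd rfl hne
      | (exfalso
         simp [place, shrink, Corner.pos, crossingPiece] at h1 h2 h1' h2'
         linarith)
      | (refine ⟨.inr (.crossing ()), by decide, by decide, ?_⟩
         simp [place, shrink, Corner.pos, crossingPiece] at h1 h2 h1' h2' ⊢
         refine Prod.ext ?_ ?_
         · change x.1 = -1 / 5
           linarith
         · change x.2 = 0
           linarith)
  over_straight := by
    rintro ⟨⟩
    refine ⟨1 / 5, 4 / 5, by norm_num, by norm_num, by norm_num, ?_⟩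
    simp [place, shrink, Corner.pos]
    norm_num
  under_straight := by
    rintro ⟨⟩
    refine ⟨4 / 5, 1 / 5, by norm_num, by norm_num, by norm_num, ?_⟩
    simp [place, shrink, Corner.pos]
    norm_num
  counterclockwise := by
    rintro ⟨⟩
    simp [place, shrink, Corner.pos]
    norm_num

theorem capPiece_isPlane : capPiece.IsPlane where
  edge_outside := by
    intro e x hx
    obtain ⟨t, ht0, ht1, h1, h2⟩ := exists_param_of_mem_segment hx
    rcases ht0.eq_or_lt with rfl | ht
    · fin_cases e
      · exact Or.inr ⟨.NW, Or.inl rfl, Prod.ext (by rw [h1]; simp) (by rw [h2]; simp)⟩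
      · exact Or.inr ⟨.SW, Or.inl rfl, Prod.ext (by rw [h1]; simp) (by rw [h2]; simp)⟩
      · exact Or.inr ⟨.NE, Or.inl rfl, Prod.ext (by rw [h1]; simp) (by rw [h2]; simp)⟩
      · exact Or.inr ⟨.SE, Or.inl rfl, Prod.ext (by rw [h1]; simp) (by rw [h2]; simp)⟩
      · left
        simp [place, Corner.pos, capPiece] at h1 h2
        rw [h1, h2]
        norm_num
    · left
      fin_cases e <;>
        simp [place, shrink, Corner.pos, capPiece] at h1 h2 <;> rw [h1, h2] <;> simp <;> nlinarith
  edges_disjoint := by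
    intro e e' hne x hx hx'
    obtain ⟨t, ht0, ht1, h1, h2⟩ := exists_param_of_mem_segment hx
    obtain ⟨t', ht0', ht1', h1', h2'⟩ := exists_param_of_mem_segment hx'
    clear hx hx'
    fin_cases e <;> fin_cases e' <;> first
      | exact absurd rfl hne
      | (exfalso
         simp [place, shrink, Corner.pos, capPiece] at h1 h2 h1' h2'
         linarith)
      | (refine ⟨.inr (.bend ()), by decide, by decide, ?_⟩
         simp [place, shrink, Corner.pos, capPiece] at h1 h2 h1' h2' ⊢
         refine Prod.ext ?_ ?_
         · change x.1 = -1 / 5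
           linarith
         · change x.2 = 0
           linarith)
  over_straight c := c.elim
  under_straight c := c.elim
  counterclockwise c := c.elim

theorem turnPiece_isPlane : turnPiece.IsPlane where
  edge_outside := by
    intro e x hx
    obtain ⟨t, ht0, ht1, h1, h2⟩ := exists_param_of_mem_segment hx
    rcases ht0.eq_or_lt with rfl | ht
    · exact Or.inr ⟨e, Or.inl rfl, Prod.ext (by rw [h1]; simp) (by rw [h2]; simp)⟩
    · left
      cases e <;>
        simp [place, shrink, Corner.pos, Corner.turn] at h1 h2 <;> rw [h1, h2] <;> simp <;>
        nlinarith
  edges_disjoint := by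
    intro e e' hne x hx hx'
    obtain ⟨t, ht0, ht1, h1, h2⟩ := exists_param_of_mem_segment hx
    obtain ⟨t', ht0', ht1', h1', h2'⟩ := exists_param_of_mem_segment hx'
    clear hx hx'
    exfalso
    cases e <;> cases e' <;> first
      | exact absurd rfl hne
      | (simp [place, shrink, Corner.pos, Corner.turn] at h1 h2 h1' h2'
         linarith)
  over_straight c := c.elim
  under_straight c := c.elim
  counterclockwise c := c.elim

end OuterPiece

/-! ### State sums of glued diagrams, reduced to finite checks. -/

namespace OuterPiece

variable {S : OuterPiece} (hS : S.IsPlane) (B : BallTangleDiagram)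

/-- The contribution to the bracket of a glued diagram of the states extending a given state of the
outer piece. -/
noncomputable def partialBracket (cl : TangleClosure) (τ : S.K → Splitting) : ℂ :=
  ∑ σ : B.State, if (glue hS B).circles cl (Sum.elim σ τ) = 1 then ∏ c, (σ c).weight else 0

/-- A state of the glued diagram is a pair of states, and its weight is the product of theirs. -/
theorem bracket_glue (cl : TangleClosure) :
    (glue hS B).bracket cl kauffmanRoot =
      ∑ τ : S.K → Splitting, (∏ c, (τ c).weight) * partialBracket hS B cl τ := by
  rw [BallTangleDiagram.bracket_eq]
  simp only [partialBracket, Finset.mul_sum]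
  rw [Finset.sum_comm, ← Fintype.sum_prod_type']
  refine Fintype.sum_equiv (Equiv.sumArrowEquivProdArrow B.K S.K Splitting) _ _ fun ρ => ?_
  have h1 : (glue hS B).circles cl (Sum.elim (fun c => ρ (.inl c)) (fun c => ρ (.inr c))) =
      (glue hS B).circles cl ρ :=
    congrArg ((glue hS B).circles cl) (Sum.elim_comp_inl_inr ρ)
  have h2 : ∏ c, (ρ c).weight = (∏ c, (ρ (.inl c)).weight) * ∏ c, (ρ (.inr c)).weight :=
    Fintype.prod_sum_type (fun c : B.K ⊕ S.K => (ρ c).weight)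
  change (if (glue hS B).circles cl ρ = 1 then (∏ c : B.K ⊕ S.K, (ρ c).weight) else 0) =
    _ * if (glue hS B).circles cl (Sum.elim (fun c => ρ (.inl c)) (fun c => ρ (.inr c))) = 1
      then _ else 0
  rw [h1, h2]
  split_ifs
  · exact mul_comm _ _
  · exact (mul_zero _).symm

variable (S) in
/-- Two edges of an outer piece are connected through at most three vertices or closing arcs. -/
def Reaches (cl : TangleClosure) (τ : S.K → Splitting) (e e' : S.E) : Prop :=
  ∃ a b, (e = a ∨ S.Consecutive cl τ e a) ∧ (a = b ∨ S.Consecutive cl τ a b) ∧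
    (b = e' ∨ S.Consecutive cl τ b e')

instance [DecidableEq S.W] [Fintype S.W] [DecidableEq S.E] [Fintype S.E] (cl : TangleClosure)
    (τ : S.K → Splitting) (e e' : S.E) : Decidable (S.Reaches cl τ e e') :=
  inferInstanceAs (Decidable (∃ a b, (e = a ∨ S.Consecutive cl τ e a) ∧
    (a = b ∨ S.Consecutive cl τ a b) ∧ (b = e' ∨ S.Consecutive cl τ b e')))

theorem Reaches.eqvGen {cl : TangleClosure} {τ : S.K → Splitting} {e e' : S.E}
    (h : S.Reaches cl τ e e') : Relation.EqvGen (S.Consecutive cl τ) e e' := by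
  have key : ∀ a b, (a = b ∨ S.Consecutive cl τ a b) → Relation.EqvGen (S.Consecutive cl τ) a b := by
    rintro a b (rfl | h)
    · exact .refl _
    · exact .rel _ _ h
  obtain ⟨a, b, h1, h2, h3⟩ := h
  exact ((key _ _ h1).trans _ _ _ (key _ _ h2)).trans _ _ _ (key _ _ h3)

/-- With `Reaches` in place of the generated equivalence relation, the hypotheses of
`circles_glue_eq` become decidable for a concrete piece. -/
theorem partialBracket_eq (cl : TangleClosure) (τ : S.K → Splitting) (cl' : TangleClosure)
    (lam : S.E → Corner)
    (h1 : ∀ e p, S.Incident e (.inl p) → lam e = p ∨ lam e = cl'.partner p)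
    (h2 : ∀ e e', S.Consecutive cl τ e e' → lam e = lam e' ∨ lam e = cl'.partner (lam e'))
    (h3 : ∀ e, ∃ e', S.Incident e' (.inl (lam e)) ∧ S.Reaches cl τ e e')
    (h4 : ∀ p, ∃ e e', S.Incident e (.inl p) ∧ S.Incident e' (.inl (cl'.partner p)) ∧
      S.Reaches cl τ e e') :
    partialBracket hS B cl τ = B.bracket cl' kauffmanRoot := by
  rw [BallTangleDiagram.bracket_eq, partialBracket]
  refine Finset.sum_congr rfl fun σ _ => ?_
  rw [circles_glue_eq hS cl σ τ cl' lam h1 h2 (fun e => (h3 e).imp fun _ h => ⟨h.1, h.2.eqvGen⟩)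
    (fun p => (h4 p).imp fun _ h => h.imp fun _ h => ⟨h.1, h.2.1, h.2.2.eqvGen⟩)]

theorem partialBracket_eq_zero (cl : TangleClosure) (τ : S.K → Splitting) (f : S.E → Bool)
    (h1 : ∀ e p, S.Incident e (.inl p) → f e = false)
    (h2 : ∀ e e', S.Consecutive cl τ e e' → f e = f e') (h3 : ∃ e, f e = true) :
    partialBracket hS B cl τ = 0 :=
  Finset.sum_eq_zero fun σ _ => if_neg (circles_glue_ne_one hS cl σ τ f h1 h2 h3)

theorem bracket_glue_of_unique [IsEmpty S.K] (cl : TangleClosure) :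
    (glue hS B).bracket cl kauffmanRoot = partialBracket hS B cl isEmptyElim := by
  rw [bracket_glue, Fintype.sum_unique, Finset.univ_eq_empty, Finset.prod_empty, one_mul]
  congr 1

section Pieces

variable {B}

theorem bracket_turn_numerator :
    (glue turnPiece_isPlane B).bracket .numerator kauffmanRoot = B.bracket .denominator kauffmanRoot := by
  rw [bracket_glue_of_unique]
  exact partialBracket_eq _ _ _ _ .denominator (fun e : Corner => e)
    (by decide) (by decide) (by decide) (by decide)

theorem bracket_turn_denominator :
    (glue turnPiece_isPlane B).bracket .denominator kauffmanRoot = B.bracket .numerator kauffmanRoot := by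
  rw [bracket_glue_of_unique]
  exact partialBracket_eq _ _ _ _ .numerator (fun e : Corner => e)
    (by decide) (by decide) (by decide) (by decide)

theorem bracket_cap_numerator :
    (glue capPiece_isPlane B).bracket .numerator kauffmanRoot = B.bracket .denominator kauffmanRoot := by
  rw [bracket_glue_of_unique]
  exact partialBracket_eq _ _ _ _ .denominator ![.NW, .SW, .NE, .SE, .NW]
    (by decide) (by decide) (by decide) (by decide)

/-- The separate arc from NE to SE and the closing arc between them form a circle of their own, so
no state has just one circle. -/
theorem bracket_cap_denominator :
    (glue capPiece_isPlane B).bracket .denominator kauffmanRoot = 0 := by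
  rw [bracket_glue_of_unique]
  exact partialBracket_eq_zero _ _ _ _ ![false, false, false, false, true]
    (by decide) (by decide) (by decide)

theorem sum_unit_splitting (f : (Unit → Splitting) → ℂ) :
    ∑ τ, f τ = f (fun _ => .A) + f (fun _ => .B) := by
  rw [← (Equiv.funUnique Unit Splitting).symm.sum_comp]
  change Finset.sum {Splitting.A, Splitting.B} _ = _
  rw [Finset.sum_pair (by decide)]
  rfl

theorem bracket_crossing_numerator :
    (glue crossingPiece_isPlane B).bracket .numerator kauffmanRoot =
      kauffmanRoot * B.bracket .denominator kauffmanRoot +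
        kauffmanRoot⁻¹ * B.bracket .numerator kauffmanRoot := by
  rw [bracket_glue]
  refine (sum_unit_splitting _).trans ?_
  -- The A-splitting joins inner NW to inner SW through the upper closing arc, the crossing and the
  -- lower closing arc; this uses all three steps of `Reaches`. The other two inner ends meet at the
  -- crossing, so the inserted diagram sees its denominator closure. The B-splitting lets the
  -- strands run through.
  rw [partialBracket_eq crossingPiece_isPlane B .numerator (fun _ => .A) .denominator
    ![.NW, .SW, .NE, .SE, .SW, .NW] (by decide) (by decide) (by decide) (by decide),
    partialBracket_eq crossingPiece_isPlane B .numerator (fun _ => .B) .numerator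
    ![.NW, .SW, .NE, .SE, .SE, .NE] (by decide) (by decide) (by decide) (by decide)]
  simp [Splitting.weight]

theorem bracket_crossing_denominator :
    (glue crossingPiece_isPlane B).bracket .denominator kauffmanRoot =
      kauffmanRoot⁻¹ * B.bracket .denominator kauffmanRoot := by
  rw [bracket_glue]
  refine (sum_unit_splitting _).trans ?_
  -- The A-splitting joins outer NE to outer SE, and the closing arc completes this to a free
  -- circle.
  rw [partialBracket_eq_zero crossingPiece_isPlane B .denominator (fun _ => .A)
    ![false, false, false, false, true, true] (by decide) (by decide) (by decide),
    partialBracket_eq crossingPiece_isPlane B .denominator (fun _ => .B) .denominator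
    ![.NW, .SW, .NE, .SE, .SE, .NE] (by decide) (by decide) (by decide) (by decide)]
  simp [Splitting.weight]

end Pieces

end OuterPiece

/-! ### Moves on realized pairs, the trivial diagram, and the Euclidean algorithm. -/

namespace BallTangleDiagram

open OuterPiece

variable {B : BallTangleDiagram} {u v : ℤ}

theorem I_mul_pow_eight {z : ℂ} (hz : z ^ 8 = 1) : (Complex.I * z) ^ 8 = 1 := by
  rw [mul_pow, hz, show 8 = 4 * 2 from rfl, pow_mul, Complex.I_pow_four]; simp

/-- The turn interchanges the closures. Replacing z by iz moves the factor i to the other entry, and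
i² = -1 produces the sign. -/
theorem Realizes.turn (h : B.Realizes u v) : (glue turnPiece_isPlane B).Realizes v (-u) := by
  obtain ⟨z, hz, h1, h2⟩ := h
  refine ⟨Complex.I * z, I_mul_pow_eight hz, ?_, ?_⟩
  · rw [bracket_turn_numerator, h2]
  · rw [bracket_turn_denominator]
    push_cast
    rw [← h1]
    linear_combination (z * B.bracket .numerator kauffmanRoot) * Complex.I_sq

theorem Realizes.cap (h : B.Realizes u v) : (glue capPiece_isPlane B).Realizes v 0 := by
  obtain ⟨z, hz, h1, h2⟩ := h
  refine ⟨Complex.I * z, I_mul_pow_eight hz, ?_, ?_⟩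
  · rw [bracket_cap_numerator, h2]
  · rw [bracket_cap_denominator]
    simp

theorem Realizes.crossing (h : B.Realizes u v) :
    (glue crossingPiece_isPlane B).Realizes (u + v) v := by
  obtain ⟨z, hz, h1, h2⟩ := h
  have h0 : kauffmanRoot * kauffmanRoot⁻¹ = 1 := mul_inv_cancel₀ kauffmanRoot_ne_zero
  -- The extra factor A cancels the A⁻¹ of the B-splitting, while with the A-splitting it gives A² =
  -- i, exactly the factor of the second entry.
  refine ⟨z * kauffmanRoot, by rw [mul_pow, hz, kauffmanRoot_pow_eight, one_mul], ?_, ?_⟩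
  · rw [bracket_crossing_numerator]
    push_cast
    rw [← h1, ← h2]
    linear_combination (z * B.bracket .denominator kauffmanRoot) * kauffmanRoot_sq +
      (z * B.bracket .numerator kauffmanRoot) * h0
  · rw [bracket_crossing_denominator, ← h2]
    linear_combination (Complex.I * z * B.bracket .denominator kauffmanRoot) * h0

/-- The graph of the trivial diagram: a strand from `NW` to `NE` and one from `SW` to `SE`. -/
def trivialGraph : SimpleGraph (TangleVertex Empty Empty) where
  Adj
    | .endpoint p, .endpoint q => q = TangleClosure.numerator.partner p
    | _, _ => False
  symm := ⟨by
    rintro (p | w | c) (q | w' | c') h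
    · change p = _
      change q = _ at h
      rw [h, TangleClosure.partner_partner]
    all_goals exact h.elim⟩
  loopless := ⟨by
    rintro (p | w | c) h
    · change p = _ at h
      cases p <;> cases h
    · exact h
    · exact h⟩

/-- The diagram without crossings that consists of two horizontal strands. -/
noncomputable def trivial : BallTangleDiagram where
  W := Empty
  K := Empty
  pos
    | .endpoint p => p.pos
    | .bend w => w.elim
    | .crossing c => c.elim
  G := trivialGraph
  nbr c := c.elim
  pos_injective := turnPiece.pos_injective
  pos_endpoint _ := rfl
  pos_bend w := w.elim
  pos_crossing c := c.elim
  edges_disjoint := by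
    rintro (p | w | c) (q | w | c) (p' | w | c) (q' | w | c) h h' hne x ⟨hx, hx'⟩
    · obtain ⟨t, ht0, ht1, h1, h2⟩ := exists_param_of_mem_segment hx
      obtain ⟨t', ht0', ht1', h1', h2'⟩ := exists_param_of_mem_segment hx'
      change q = _ at h
      change q' = _ at h'
      subst h h'
      exfalso
      cases p <;> cases p' <;> first
        | exact hne rfl
        | exact hne Sym2.eq_swap
        | (simp only [TangleClosure.partner, Corner.pos] at h2 h2'
           linarith)
    all_goals first
      | exact h.elim
      | exact h'.elim
  degree_endpoint p := by
    rw [Set.ncard_eq_one]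
    refine ⟨.endpoint (TangleClosure.numerator.partner p), Set.ext ?_⟩
    rintro (q | w | c)
    · change q = _ ↔ _ = _
      simp
    · exact w.elim
    · exact c.elim
  degree_bend w := w.elim
  neighbors_crossing c := c.elim
  over_straight c := c.elim
  under_straight c := c.elim
  counterclockwise c := c.elim

theorem trivial_dart_cases (d : trivial.G.Dart) : ∃ p, d = trivial.endDart p := by
  rcases h : d.fst with p | w | c
  · exact ⟨p, trivial.eq_endDart h⟩
  · exact w.elim
  · exact c.elim

theorem trivial_endDart_symm (p : Corner) :
    (trivial.endDart p).symm = trivial.endDart (TangleClosure.numerator.partner p) := by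
  refine trivial.eq_endDart (p := TangleClosure.numerator.partner p) ?_
  have h := (trivial.endDart p).adj
  rw [trivial.endDart_fst] at h
  change (trivial.endDart p).snd = _
  generalize (trivial.endDart p).snd = y at h
  rcases y with q | w | c
  · exact congrArg _ h
  · exact w.elim
  · exact c.elim

theorem trivial_circles_numerator (σ : trivial.State) : trivial.circles .numerator σ ≠ 1 := by
  let f : trivial.G.Dart → Prop := fun d =>
    d.fst = .endpoint .NW ∨ d.fst = .endpoint .NE
  have hf : ∀ p, f (trivial.endDart p) ↔ p = .NW ∨ p = .NE := by
    intro p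
    simp only [f, trivial.endDart_fst, TangleVertex.endpoint.injEq]
  have hpartner : ∀ p : Corner, (p = .NW ∨ p = .NE) ↔
      (TangleClosure.numerator.partner p = .NW ∨ TangleClosure.numerator.partner p = .NE) := by
    decide
  have hr : ∀ d e, trivial.Connects .numerator σ d e → f d = f e := by
    rintro d e (_ | ⟨w, _⟩ | ⟨c, _⟩ | ⟨p, _, _, hd, he⟩)
    · obtain ⟨p, rfl⟩ := trivial_dart_cases d
      rw [trivial_endDart_symm, hf, hf, hpartner]
    · exact w.elim
    · exact c.elim
    · rw [trivial.eq_endDart hd, trivial.eq_endDart he, hf, hf, hpartner]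
  intro h
  have := (Nat.card_eq_one_iff_unique.1 h).1
  have h1 := congrArg (Quot.lift f hr)
    (Subsingleton.elim (Quot.mk _ (trivial.endDart .NW)) (Quot.mk _ (trivial.endDart .SW)))
  have h2 : f (trivial.endDart .NW) = f (trivial.endDart .SW) := h1
  rw [hf, hf] at h2
  simp at h2

theorem trivial_circles_denominator (σ : trivial.State) : trivial.circles .denominator σ = 1 := by
  refine Nat.card_eq_one_iff_unique.2 ⟨⟨?_⟩, ⟨Quot.mk _ (trivial.endDart .NW)⟩⟩
  have hnum : ∀ p, Quot.mk (trivial.Connects .denominator σ)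
      (trivial.endDart (TangleClosure.numerator.partner p)) = Quot.mk _ (trivial.endDart p) := by
    intro p
    rw [← trivial_endDart_symm]
    exact (Quot.sound (.edge _)).symm
  have hden : ∀ p, Quot.mk (trivial.Connects .denominator σ)
      (trivial.endDart (TangleClosure.denominator.partner p)) = Quot.mk _ (trivial.endDart p) :=
    fun p => (Quot.sound (.closure p _ _ (trivial.endDart_fst _) (trivial.endDart_fst _))).symm
  have key : ∀ d, Quot.mk (trivial.Connects .denominator σ) d = Quot.mk _ (trivial.endDart .NW) := by
    intro d
    obtain ⟨p, rfl⟩ := trivial_dart_cases d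
    cases p
    · rfl
    · exact hnum .NW
    · exact hden .NW
    · exact (hden .NE).trans (hnum .NW)
  rintro ⟨d⟩ ⟨e⟩
  exact (key d).trans (key e).symm

theorem trivial_realizes : trivial.Realizes 0 1 := by
  -- The closures have two circles and one circle, so the brackets are 0 and 1; -i cancels the
  -- factor i of the second entry.
  refine ⟨-Complex.I, ?_, ?_, ?_⟩
  · rw [Even.neg_pow (by decide), show 8 = 4 * 2 from rfl, pow_mul, Complex.I_pow_four, one_pow]
  · rw [bracket_eq, Finset.sum_eq_zero fun σ _ => if_neg (trivial_circles_numerator σ)]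
    simp
  · have h : ∀ σ : trivial.State, ∏ c, (σ c).weight = 1 := fun σ =>
      Finset.prod_eq_one fun c _ => Empty.elim c
    have hcard : Fintype.card trivial.State = 1 := by
      rw [Fintype.card_eq_one_iff]
      exact ⟨fun c => Empty.elim c, fun σ => funext fun c => Empty.elim c⟩
    rw [bracket_eq]
    simp only [trivial_circles_denominator, if_true, h, Finset.sum_const, Finset.card_univ, hcard]
    simp

/-- The pairs of integers that are realized by a diagram. -/
def Realizable (u v : ℤ) : Prop := ∃ B : BallTangleDiagram, B.Realizes u v

theorem Realizable.neg (h : Realizable u v) : Realizable (-u) (-v) := h.imp fun _ h => h.neg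

theorem Realizable.turn (h : Realizable u v) : Realizable v (-u) :=
  h.elim fun _ h => ⟨_, h.turn⟩

theorem Realizable.turn' (h : Realizable u v) : Realizable (-v) u := by
  simpa using h.turn.neg

theorem Realizable.cap (h : Realizable u v) : Realizable v 0 := h.elim fun _ h => ⟨_, h.cap⟩

theorem Realizable.add (h : Realizable u v) : Realizable (u + v) v :=
  h.elim fun _ h => ⟨_, h.crossing⟩

/-- In PSL₂(ℤ) the inverse of adding is a word in adding and quarter turns, so no piece with the
opposite crossing is needed: (u, v), (v, -u), (v - u, -u), (u, v - u), (v, v - u), (v - u, -v), then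
a sign. -/
theorem Realizable.sub (h : Realizable u v) : Realizable (u - v) v := by
  have h1 := h.turn.add.turn'.add.turn
  convert h1.neg using 1 <;> ring

/-- Adding n crossings to the trivial diagram gives (n, 1). A quarter turn brings n to the second
place, and the cap discards the 1; this is the only source of pairs with a common divisor. -/
theorem realizable_nat_zero (n : ℕ) : Realizable n 0 := by
  have h : Realizable n 1 := by
    induction n with
    | zero => exact ⟨trivial, trivial_realizes⟩
    | succ n ih =>
      push_cast
      exact ih.add
  exact h.turn'.cap

theorem realizable_int_zero (u : ℤ) : Realizable u 0 := by
  obtain ⟨n, rfl | rfl⟩ := u.eq_nat_or_neg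
  · exact realizable_nat_zero n
  · simpa using (realizable_nat_zero n).neg

/-- Every pair of integers is realized, by the Euclidean algorithm. -/
theorem realizable (u v : ℤ) : Realizable u v := by
  induction hn : u.natAbs + v.natAbs using Nat.strong_induction_on generalizing u v with
  | _ n ih =>
    subst hn
    by_cases hv : v = 0
    · subst hv
      exact realizable_int_zero u
    by_cases hu : u = 0
    · subst hu
      simpa using (realizable_int_zero v).turn'
    -- Either the difference or the sum is smaller in absolute value, according to the signs of the
    -- entries.
    have key : ∀ u v : ℤ, u ≠ 0 → v ≠ 0 → v.natAbs ≤ u.natAbs →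
        (u - v).natAbs + v.natAbs < u.natAbs + v.natAbs ∨
          (u + v).natAbs + v.natAbs < u.natAbs + v.natAbs := by
      intro u v hu hv h
      omega
    rcases le_total v.natAbs u.natAbs with h | h
    · rcases key u v hu hv h with h' | h'
      · simpa using (ih _ h' (u - v) v rfl).add
      · simpa using (ih _ h' (u + v) v rfl).sub
    · rcases key v u hv hu h with h' | h'
      -- A change of the second entry is a change of the first one, conjugated by quarter turns.
      · have h2 := (ih ((v - u).natAbs + u.natAbs) (by omega) u (v - u) (by omega)).turn.sub
        simpa using h2.turn'
      · have h2 := (ih ((v + u).natAbs + u.natAbs) (by omega) u (v + u) (by omega)).turn.add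
        simpa using h2.turn'

end BallTangleDiagram

/-- The ball tangle invariant is a map from ball tangle diagrams to `PM 2 1`, and it is onto. -/
theorem theorem4p4 :
    (∀ B : BallTangleDiagram, B.invariant ∈ PM 2 1) ∧
      ∀ P ∈ PM 2 1, ∃ B : BallTangleDiagram, B.invariant = P := by
  refine ⟨fun B => B.invariant_mem_PM, ?_⟩
  rintro P ⟨M, rfl⟩
  obtain ⟨B, hB⟩ := BallTangleDiagram.realizable (M 0 0) (M 1 0)
  refine ⟨B, ?_⟩
  have hM : M = !![M 0 0; M 1 0] := by
    ext i j
    fin_cases i <;> fin_cases j <;> rfl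
  rw [hB.invariant_eq, ← hM]
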